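/- **Conventions.** Polynomial time is measured in the bit model, for sequences of functions: a sequence of tests $\psi_N:\{0,1\}^{N\times N\times N}\to\{0,1\}$ is polynomial-time if $\psi_N$ is computed by a Boolean circuit with at most $(N+2)^C$ gates for a constant $C$. For data $Y\in\mathbb R^{p_1\times p_2\times p_3}$ with noise level $\sigma$, a polynomial-time algorithm reads the integers $\lfloor Y_{ijk}/\delta\rfloor$ for a precision $\delta>0$ with $\log_2(\sigma/\delta)$ at most polynomial in $p_1p_2p_3$, and computes integer outputs by Boolean circuits: on the inputs with integers of at most $\ell$ bits, circuit size and output length are polynomial in $p_1p_2p_3+\ell$. A polynomial-time estimator $\hat{\mathbf X}$ is the output tensor of such an algorithm times a scalar $\eta_p$; a polynomial-time estimator $\hat U_k$, with $\hat U_k^\top\hat U_k=I_{r_k}$, is an orthonormal basis of the column space of the output matrix of such an algorithm. **Hypothesis $\mathbf H(\tau)$.** For $V\subseteq\{1,\dots,N\}$ let $\mathcal G_3(N,1/2,\kappa,V)$ be the random 3-uniform hypergraph on $\{1,\dots,N\}$ obtained by including each triple of distinct vertices independently with probability $1/2$, then drawing a set $C\subseteq V$ of $\kappa$ vertices uniformly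 and independently, and adding all triples of distinct vertices inside $C$. Let $V_1=\{1,\dots,\lfloor N/2\rfloor\}$, $V_2=\{\lfloor N/2\rfloor+1,\dots,N\}$. For a test $\psi$ of the adjacency tensor $\mathbf A\in\{0,1\}^{N\times N\times N}$ let $$\mathcal R_{N,\kappa}(\psi)=\mathbb P_{\mathcal G_3(N,1/2,\kappa,V_1)}\{\psi(\mathbf A)=1\}+\mathbb P_{\mathcal G_3(N,1/2,\kappa,V_2)}\{\psi(\mathbf A)=0\}.$$ $\mathbf H(\tau)$ states: for every integer sequence $\kappa_N$ with $1\le\kappa_N\le\lfloor N/2\rfloor$ $(N\ge2)$ and $\limsup_{N\to\infty}\log\kappa_N/\log\sqrt N\le 1-\tau$, and every sequence of polynomial-time tests $\psi_N$, one has $\liminf_{N\to\infty}\mathcal R_{N,\kappa_N}(\psi_N)\ge\frac12$. **Model.** Let $\mathbf Y=\mathbf X+\mathbf Z\in\mathbb R^{p_1\times p_2\times p_3}$ with i.i.d. entries $Z_{ijk}\sim N(0,\sigma^2)$. Let $\mathcal M_k(\mathbf X)$ be the mode-$k$ matricization, $\sigma_i(\cdot)$ the $i$-th largest singular value, and $$\mathcal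 F_{\boldsymbol p,\boldsymbol r}(\lambda)=\{\mathbf X\in\mathbb R^{p_1\times p_2\times p_3}:\ \operatorname{rank}\mathcal M_k(\mathbf X)\le r_k,\ \sigma_{r_k}(\mathcal M_k(\mathbf X))\ge\lambda,\ k=1,2,3\}.$$ For $\mathbf X$ in this class let $U_k\in\mathbb R^{p_k\times r_k}$ be the matrix of left singular vectors of $\mathcal M_k(\mathbf X)$. For matrices $U,\hat U$ with $r$ orthonormal columns, $\|\sin\Theta(\hat U,U)\|=\max_{i\le r}\sin\arccos\sigma_i(\hat U^\top U)$. **Theorem 4 (Computational Lower Bound).** There are absolute constants $c_0,c_1>0$ such that the following holds. Let $\tau\in(0,1)$ be such that $\mathbf H(\tau)$ holds. Let $r_1,r_2,r_3\ge1$ be integers with $r_1\le r_2r_3$, $r_2\le r_3r_1$, $r_3\le r_1r_2$. For each $p\in\mathbb N$ let $(p_1,p_2,p_3)$ be dimensions with $\min\{p_1,p_2,p_3\}=p$, and let $\lambda,\sigma>0$ (all depending on $p$) satisfy $$\frac{\lambda}{\sigma}\le c_0\,\frac{p^{3(1-\tau)/4}}{\sqrt{\log 3p}}\qquad(p\ge1).$$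 Then for all sequences of polynomial-time estimators $\hat U_k^{(p)}$, $\hat{\mathbf X}^{(p)}$, $$\liminf_{p\to\infty}\ \sup_{\mathbf X\in\mathcal F_{\boldsymbol p,\boldsymbol r}(\lambda)}\mathbb E\big\|\sin\Theta\big(\hat U_k^{(p)},U_k\big)\big\|^2\ge c_1,\quad k=1,2,3,$$ $$\liminf_{p\to\infty}\ \sup_{\mathbf X\in\mathcal F_{\boldsymbol p,\boldsymbol r}(\lambda)}\frac{\mathbb E\|\hat{\mathbf X}^{(p)}-\mathbf X\|_{\rm F}^2}{\|\mathbf X\|_{\rm F}^2}\ge c_1.$$ -/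

import Mathlib

open Filter MeasureTheory ProbabilityTheory
open scoped ENNReal

noncomputable section

/-! ## Boolean circuits and polynomial time -/

/-- A gate of a Boolean straight-line program whose input bits are indexed by `ι`.
The numbers in `nand u v` are positions of earlier gates. -/
inductive Gate (ι : Type) where
  | input : ι → Gate ι
  | const : Bool → Gate ι
  | nand : ℕ → ℕ → Gate ι

/-- Value of a gate on the input `x`, given the list `w` of the values of the earlier gates. -/
def Gate.value {ι : Type} (x : ι → Bool) (w : List Bool) : Gate ι → Bool
  | .input i => x i
  | .const b => b
  | .nand u v => !(w.getD u false && w.getD v false)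

/-- Values of all the gates of a straight-line program, in order of execution. -/
def gateValues {ι : Type} (x : ι → Bool) (gs : List (Gate ι)) : List Bool :=
  gs.foldl (fun w g => w ++ [g.value x w]) []

/-- A Boolean circuit with input bits indexed by `ι` and output bits indexed by `κ`. -/
structure Circuit (ι κ : Type) where
  /-- the gates, in order of execution -/
  gates : List (Gate ι)
  /-- the gate at which each output bit is read -/
  out : κ → ℕ

/-- The function that a circuit computes. -/
def Circuit.eval {ι κ : Type} (C : Circuit ι κ) (x : ι → Bool) : κ → Bool :=
  fun k => (gateValues x C.gates).getD (C.out k) false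

/-- The number of elementary operations. -/
def Circuit.size {ι κ : Type} (C : Circuit ι κ) : ℕ := C.gates.length

/-- All entries of `q` are integers of at most `ℓ` bits, plus a sign. -/
def FitsIn {I : Type} (ℓ : ℕ) (q : I → ℤ) : Prop := ∀ i, -2 ^ ℓ ≤ q i ∧ q i < 2 ^ ℓ

/-- Two's complement encoding of integer data with `ℓ + 1` bits per entry. -/
def intBits {I : Type} (ℓ : ℕ) (q : I → ℤ) : I × Fin (ℓ + 1) → Bool :=
  fun a => (q a.1).testBit a.2

/-- A sequence of maps between finite families of integers is computable in polynomial time: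
on the inputs whose entries have at most `ℓ` bits, the map `f p` is computed by a Boolean
circuit whose size is at most a fixed polynomial in the input size. -/
def PolyTimeIntMaps {I J : ℕ → Type} [∀ p, Fintype (I p)]
    (f : ∀ p, (I p → ℤ) → (J p → ℤ)) : Prop :=
  ∃ c : ℕ, ∀ p ℓ : ℕ, ∃ (w : ℕ) (C : Circuit (I p × Fin (ℓ + 1)) (J p × Fin (w + 1))),
    w ≤ (Fintype.card (I p) + ℓ + 2) ^ c ∧
    C.size ≤ (Fintype.card (I p) + ℓ + 2) ^ c ∧
    ∀ q : I p → ℤ, FitsIn ℓ q → FitsIn w (f p q) ∧ C.eval (intBits ℓ q) = intBits w (f p q)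

/-! ## Planted cliques in 3-uniform hypergraphs

A hypergraph on the vertex set `Fin N` is given by its finite set of hyper-edges, which are
three-element sets of vertices. -/

/-- The set of all hypergraphs on `N` vertices. Drawing uniformly from it includes each
hyper-edge independently with probability `1/2`. -/
def hypergraphs (N : ℕ) : Finset (Finset (Finset (Fin N))) :=
  (Finset.powersetCard 3 Finset.univ).powerset

/-- The adjacency tensor of a hypergraph. -/
def adjacency {N : ℕ} (E : Finset (Finset (Fin N))) : Fin N × Fin N × Fin N → Bool :=
  fun v => decide (({v.1, v.2.1, v.2.2} : Finset (Fin N)) ∈ E)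

/-- Connect all hyper-edges inside `C`. -/
def plantClique {N : ℕ} (E : Finset (Finset (Fin N))) (C : Finset (Fin N)) :
    Finset (Finset (Fin N)) :=
  E ∪ Finset.powersetCard 3 C

/-- Probability that the adjacency tensor has the property `Q`, for a random hypergraph with
edge probability `1/2` in which a clique is planted on a set of `κ` vertices that is drawn
uniformly at random from `V`, independently of the hypergraph. -/
def plantedProb {N : ℕ} (κ : ℕ) (V : Finset (Fin N))
    (Q : (Fin N × Fin N × Fin N → Bool) → Prop) : ℝ :=
  open scoped Classical in
  (((hypergraphs N ×ˢ Finset.powersetCard κ V).filter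
      (fun EC => Q (adjacency (plantClique EC.1 EC.2)))).card : ℝ) /
    ((hypergraphs N ×ˢ Finset.powersetCard κ V).card : ℝ)

/-- The first `⌊N/2⌋` vertices. -/
def firstHalf (N : ℕ) : Finset (Fin N) := Finset.univ.filter (fun i => (i : ℕ) < N / 2)

/-- The remaining vertices. -/
def secondHalf (N : ℕ) : Finset (Fin N) := Finset.univ.filter (fun i => N / 2 ≤ (i : ℕ))

/-- Sum of the type I and type II errors of a test for whether the clique is planted in the
first half (null hypothesis) or in the second half of the vertices. -/
def cliqueRisk {N : ℕ} (κ : ℕ) (ψ : (Fin N × Fin N × Fin N → Bool) → Bool) : ℝ :=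
  plantedProb κ (firstHalf N) (fun A => ψ A = true) +
    plantedProb κ (secondHalf N) (fun A => ψ A = false)

/-- A sequence of tests of polynomial time. -/
def PolyTimeTests (ψ : ∀ N : ℕ, (Fin N × Fin N × Fin N → Bool) → Bool) : Prop :=
  ∃ c : ℕ, ∀ N : ℕ, ∃ C : Circuit (Fin N × Fin N × Fin N) Unit,
    C.size ≤ (N + 2) ^ c ∧ ∀ A, C.eval A () = ψ N A

/-- The hypergraphic planted clique hardness hypothesis with parameter `τ`. -/
def HypothesisH (τ : ℝ) : Prop :=
  ∀ κ : ℕ → ℕ, (∀ N, 2 ≤ N → 1 ≤ κ N ∧ κ N ≤ N / 2) →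
    limsup (fun N : ℕ => Real.log (κ N) / Real.log (Real.sqrt N)) atTop ≤ 1 - τ →
    ∀ ψ : ∀ N : ℕ, (Fin N × Fin N × Fin N → Bool) → Bool, PolyTimeTests ψ →
      (1 / 2 : ℝ) ≤ liminf (fun N => cliqueRisk (κ N) (ψ N)) atTop

/-! ## Singular values, tensors and the tensor SVD model -/

/-- The `i`-th largest singular value of a matrix, counted from `i = 1` and with multiplicity
(zero when `i` exceeds the rank). -/
def singularValue {m n : Type} [Fintype m] [Fintype n] [DecidableEq n]
    (M : Matrix m n ℝ) (i : ℕ) : ℝ :=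
  (Matrix.toEuclideanLin M).singularValues (i - 1)

/-- The columns of `U` are left singular vectors of `M`: `U` is the left factor of a
singular value decomposition `M = U Σ Vᵀ` with `r` singular values. -/
def IsLeftSingular {m n : Type} [Fintype m] [Fintype n] {r : ℕ}
    (U : Matrix m (Fin r) ℝ) (M : Matrix m n ℝ) : Prop :=
  U.transpose * U = 1 ∧ ∃ (V : Matrix n (Fin r) ℝ) (s : Fin r → ℝ),
    V.transpose * V = 1 ∧ Antitone s ∧ (∀ i, 0 ≤ s i) ∧
    M = U * Matrix.diagonal s * V.transpose

/-- The spectral norm of `sin Θ(U, W)`: the largest sine of a principal angle, the principal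
angles being the arccosines of the singular values of `Uᵀ W`. -/
def sinTheta {m : Type} [Fintype m] {r : ℕ} (U W : Matrix m (Fin r) ℝ) : ℝ :=
  ⨆ i : Fin r, Real.sin (Real.arccos (singularValue (U.transpose * W) (i + 1)))

/-- Index set of the `a × b × c` tensors. -/
abbrev Idx (a b c : ℕ) : Type := Fin a × Fin b × Fin c

/-- Real `a × b × c` tensors. -/
abbrev Tensor (a b c : ℕ) : Type := Idx a b c → ℝ

/-- Mode-1 matricization. -/
def unfold1 {a b c : ℕ} (X : Tensor a b c) : Matrix (Fin a) (Fin b × Fin c) ℝ :=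
  Matrix.of fun i jk => X (i, jk.1, jk.2)

/-- Mode-2 matricization. -/
def unfold2 {a b c : ℕ} (X : Tensor a b c) : Matrix (Fin b) (Fin c × Fin a) ℝ :=
  Matrix.of fun j ki => X (ki.2, j, ki.1)

/-- Mode-3 matricization. -/
def unfold3 {a b c : ℕ} (X : Tensor a b c) : Matrix (Fin c) (Fin a × Fin b) ℝ :=
  Matrix.of fun k ij => X (ij.1, ij.2, k)

/-- Squared Frobenius norm. -/
def frobSq {a b c : ℕ} (X : Tensor a b c) : ℝ := ∑ i, X i ^ 2

/-- Tensors of Tucker ranks at most `(r₁, r₂, r₃)` for which the `r_k`-th singular value of the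
mode-`k` matricization is at least `lam`, for `k = 1, 2, 3`. -/
def lowRankClass (a b c r₁ r₂ r₃ : ℕ) (lam : ℝ) : Set (Tensor a b c) :=
  {X | (unfold1 X).rank ≤ r₁ ∧ (unfold2 X).rank ≤ r₂ ∧ (unfold3 X).rank ≤ r₃ ∧
    lam ≤ singularValue (unfold1 X) r₁ ∧ lam ≤ singularValue (unfold2 X) r₂ ∧
    lam ≤ singularValue (unfold3 X) r₃}

/-- Law of a noise tensor with i.i.d. `N(0, σ²)` entries. -/
def noise (a b c : ℕ) (σ : ℝ) : Measure (Tensor a b c) :=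
  Measure.pi fun _ => gaussianReal 0 (Real.toNNReal (σ ^ 2))

/-! ## Risks

Expectations of nonnegative losses, with values in `[0, ∞]`. -/

/-- Worst-case risk `sup_X E ‖sin Θ(Û, U)‖²` over a class of signals `X`, for an estimator `Û`
of the left singular vectors `U` of the matricization `unf X`. -/
def subspaceRisk {a b c m r : ℕ} {n : Type} [Fintype n]
    (F : Set (Tensor a b c)) (σ : ℝ) (unf : Tensor a b c → Matrix (Fin m) n ℝ)
    (Uhat : Tensor a b c → Matrix (Fin m) (Fin r) ℝ) : ℝ≥0∞ :=
  ⨆ X ∈ F, ⨆ (U : Matrix (Fin m) (Fin r) ℝ) (_ : IsLeftSingular U (unf X)),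
    ∫⁻ Z, ENNReal.ofReal (sinTheta (Uhat (X + Z)) U ^ 2) ∂(noise a b c σ)

/-- Worst-case relative risk `sup_X E ‖X̂ - X‖_F² / ‖X‖_F²` over a class of signals. -/
def tensorRisk {a b c : ℕ} (F : Set (Tensor a b c)) (σ : ℝ)
    (Xhat : Tensor a b c → Tensor a b c) : ℝ≥0∞ :=
  ⨆ X ∈ F, ∫⁻ Z, ENNReal.ofReal (frobSq (Xhat (X + Z) - X) / frobSq X) ∂(noise a b c σ)

/-! ## Polynomial-time estimators -/

/-- Finite-precision record of real data on the grid `δ ℤ`. -/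
def record {I : Type} (δ : ℝ) (Y : I → ℝ) : I → ℤ := fun i => ⌊Y i / δ⌋

/-- An admissible precision at which an algorithm reads its data: the number of binary digits
to which the noise level is resolved is polynomial in the number of entries. -/
def Precision (p₁ p₂ p₃ : ℕ → ℕ) (σ δ : ℕ → ℝ) : Prop :=
  ∃ c : ℕ, ∀ p, 0 < δ p ∧ σ p / δ p ≤ 2 ^ ((p₁ p * p₂ p * p₃ p + 2) ^ c)

/-- Polynomial-time estimators of `r` singular vectors in dimension `m p`. The algorithm reads
the data at finite precision and returns an integer matrix `B`; the estimate is an orthonormal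
basis of the column space of `B` (which determines its `sin Θ` distances). No condition is made
when `m p < r`, where no `r` orthonormal vectors exist. -/
def PolyTimeSubspaceEstimator (p₁ p₂ p₃ : ℕ → ℕ) (σ : ℕ → ℝ) (m : ℕ → ℕ) (r : ℕ)
    (Uhat : ∀ p, Tensor (p₁ p) (p₂ p) (p₃ p) → Matrix (Fin (m p)) (Fin r) ℝ) : Prop :=
  ∃ (δ : ℕ → ℝ) (B : ∀ p, (Idx (p₁ p) (p₂ p) (p₃ p) → ℤ) → (Fin (m p) × Fin r → ℤ)),
    Precision p₁ p₂ p₃ σ δ ∧ PolyTimeIntMaps B ∧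
    ∀ p, r ≤ m p → ∀ Y, (Uhat p Y).transpose * Uhat p Y = 1 ∧
      ∃ R : Matrix (Fin r) (Fin r) ℝ,
        Uhat p Y = Matrix.of (fun i j => (B p (record (δ p) Y) (i, j) : ℝ)) * R

/-- Polynomial-time estimators of the signal tensor. The algorithm reads the data at finite
precision and returns a tensor with entries on some grid `η ℤ`. -/
def PolyTimeTensorEstimator (p₁ p₂ p₃ : ℕ → ℕ) (σ : ℕ → ℝ)
    (Xhat : ∀ p, Tensor (p₁ p) (p₂ p) (p₃ p) → Tensor (p₁ p) (p₂ p) (p₃ p)) : Prop :=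
  ∃ (δ η : ℕ → ℝ)
    (B : ∀ p, (Idx (p₁ p) (p₂ p) (p₃ p) → ℤ) → (Idx (p₁ p) (p₂ p) (p₃ p) → ℤ)),
    Precision p₁ p₂ p₃ σ δ ∧ PolyTimeIntMaps B ∧
    ∀ p Y i, Xhat p Y i = η p * (B p (record (δ p) Y) i : ℝ)

end

/-! An estimator with risk below 1/32 for infinitely many `p` would reveal on which of two disjoint
sides of the index set a signal lives. Suppose that the singular vectors vanish off side `s`. The
first column of the integer matrix `B` lies in the estimated column space, so if at least half of
its squared mass is on the wrong side, then ‖sin Θ‖² ≥ 1/2 (`half_le_sinTheta_sq_of_signErr`). The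
squared mass of a tensor estimate works the same way (`half_le_relative_error_of_signErr`).
Comparing the two masses means taking the sign of an integer quadratic form in the output, which a
circuit can do. By Markov's inequality this sign test errs with probability at most twice the risk,
hence at most 1/16. `not_frequently_signErr_le` excludes such tests, in two regimes.

If some dimension is at least `p ^ 5`, polynomial size in the number of entries need not be
polynomial in `p`, and clique hardness cannot be invoked. But such problems are statistically
impossible: spread the signal along the wide mode with random signs. For either side the mixture has
chi-square divergence at most 1/16 from pure noise, so the test would have to err rarely on the
noise itself for both sides, although the two errors are complementary events
(`statistical_lower_bound`).

If all dimensions are below `p ^ 5`, take a hypergraph on `N = 3p` vertices, vertex `3i + k`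
standing for index `i` of mode `k`. Distinct entries of the `p × p × p` corner then correspond to
distinct hyperedges. Each edge bit passes through a channel whose two output laws average exactly to
`N(0, σ²)`, the law for `true` being a truncated `N(μσ, σ²)` (`exists_channel`). Edges outside the
clique thus give exact noise, and the clique gives data whose law is at most twice that of a planted
signal plus noise. The sign test composed with the channels detects the half containing the clique.
Fixing the channel randomness at a good value yields one circuit of polynomial size with total error
at most 9/20 < 1/2 (`exists_clique_test`), against `HypothesisH`. With `μ` of order `(log p) ^
(-1/2)` and a clique of size about `N ^ ((1 - τ) / 2) * log N`, which the hypothesis still allows,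
the planted singular values reach `lam`.

For the ranks, indices carry labels modulo `r₁`, `r₂`, `r₃`, and only label triples in a transversal
set `T` are used. Any two labels of a triple determine the third, so rows of an unfolding with
different labels are orthogonal and the singular value decomposition is explicit
(`exists_svd_of_labels`). The inequalities between the ranks are what makes `T` exist
(`exists_isTransversal`). -/

noncomputable section

/-! ## Building Boolean circuits -/

section Circuits

variable {ι : Type}

theorem gateValues_append_singleton (x : ι → Bool) (gs : List (Gate ι)) (g : Gate ι) :
    gateValues x (gs ++ [g]) = gateValues x gs ++ [g.value x (gateValues x gs)] := by
  simp [gateValues, List.foldl_append]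

@[simp] theorem length_gateValues (x : ι → Bool) (gs : List (Gate ι)) :
    (gateValues x gs).length = gs.length := by
  induction gs using List.reverseRecOn with
  | nil => rfl
  | append_singleton gs g ih => simp [gateValues_append_singleton, ih]

theorem gateValues_append_getD (x : ι → Bool) (gs hs : List (Gate ι)) {k : ℕ}
    (hk : k < gs.length) :
    (gateValues x (gs ++ hs)).getD k false = (gateValues x gs).getD k false := by
  induction hs using List.reverseRecOn with
  | nil => simp
  | append_singleton hs g ih =>
    rw [← List.append_assoc, gateValues_append_singleton, List.getD_append _ _ _ _ (by simp; omega),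
      ih]

/-- The straight-line program `gs` computes the Boolean function `f` at one of its gates. -/
def Avail (gs : List (Gate ι)) (f : (ι → Bool) → Bool) : Prop :=
  ∃ k < gs.length, ∀ x, (gateValues x gs).getD k false = f x

theorem Avail.append {gs : List (Gate ι)} {f : (ι → Bool) → Bool} (h : Avail gs f)
    (hs : List (Gate ι)) : Avail (gs ++ hs) f := by
  obtain ⟨k, hk, h⟩ := h
  exact ⟨k, by simp; omega, fun x => by rw [gateValues_append_getD x gs hs hk, h]⟩

theorem avail_last (gs : List (Gate ι)) (g : Gate ι) :
    Avail (gs ++ [g]) (fun x => g.value x (gateValues x gs)) :=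
  ⟨gs.length, by simp, fun x => by
    rw [gateValues_append_singleton, List.getD_append_right _ _ _ _ (by simp)]; simp⟩

/-- Every program that computes the functions in `A` can be extended by at most `n` gates to one
that computes the functions in `B`. -/
def Derives (A : Set ((ι → Bool) → Bool)) (n : ℕ) (B : Set ((ι → Bool) → Bool)) : Prop :=
  ∀ gs : List (Gate ι), (∀ f ∈ A, Avail gs f) →
    ∃ hs : List (Gate ι), hs.length ≤ n ∧ ∀ f ∈ B, Avail (gs ++ hs) f

variable {A B D : Set ((ι → Bool) → Bool)} {n m : ℕ}

theorem Derives.mono {A' B' : Set ((ι → Bool) → Bool)} (h : Derives A n B) (hA : A ⊆ A')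
    (hB : B' ⊆ B) (hn : n ≤ m) : Derives A' m B' := fun gs hgs => by
  obtain ⟨hs, h1, h2⟩ := h gs fun f hf => hgs f (hA hf)
  exact ⟨hs, h1.trans hn, fun f hf => h2 f (hB hf)⟩

theorem Derives.of_subset (h : B ⊆ A) : Derives A 0 B := fun gs hgs =>
  ⟨[], by simp, fun f hf => by simpa using hgs f (h hf)⟩

theorem Derives.trans (h1 : Derives A n B) (h2 : Derives (A ∪ B) m D) :
    Derives A (n + m) (A ∪ B ∪ D) := fun gs hgs => by
  obtain ⟨hs, hl, hB⟩ := h1 gs hgs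
  have hAB : ∀ f ∈ A ∪ B, Avail (gs ++ hs) f := by
    rintro f (hf | hf)
    · exact (hgs f hf).append hs
    · exact hB f hf
  obtain ⟨hs', hl', hD⟩ := h2 (gs ++ hs) hAB
  refine ⟨hs ++ hs', by simp; omega, ?_⟩
  rw [← List.append_assoc]
  rintro f (hf | hf)
  · exact (hAB f hf).append hs'
  · exact hD f hf

theorem Derives.comp (h1 : Derives A n B) (h2 : Derives B m D) : Derives A (n + m) D :=
  (h1.trans (h2.mono Set.subset_union_right subset_rfl le_rfl)).mono subset_rfl
    Set.subset_union_right le_rfl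

theorem Derives.union (h1 : Derives A n B) (h2 : Derives A m D) : Derives A (n + m) (B ∪ D) :=
  (h1.trans (h2.mono Set.subset_union_left subset_rfl le_rfl)).mono subset_rfl
    (by intro f; simp only [Set.mem_union]; tauto) le_rfl

theorem Derives.keep (h : Derives A n B) : Derives A n (A ∪ B) := by
  simpa using (Derives.of_subset (subset_refl A)).union h

theorem Derives.family {J : Type*} (s : Finset J) {f : J → Set ((ι → Bool) → Bool)}
    (h : ∀ j ∈ s, Derives A n (f j)) : Derives A (s.card * n) {g | ∃ j ∈ s, g ∈ f j} := by
  classical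
  induction s using Finset.induction_on with
  | empty => exact Derives.of_subset (by simp) |>.mono subset_rfl subset_rfl (by simp)
  | insert j s hj ih =>
    refine ((h j (by simp)).union (ih fun i hi => h i (by simp [hi]))).mono subset_rfl ?_ ?_
    · rintro g ⟨i, hi, hg⟩
      rcases Finset.mem_insert.mp hi with rfl | hi
      · exact Or.inl hg
      · exact Or.inr ⟨i, hi, hg⟩
    · rw [Finset.card_insert_of_notMem hj]; ring_nf; rfl

theorem Derives.const (b : Bool) : Derives A 1 {fun _ => b} := fun gs _ =>
  ⟨[.const b], by simp, by rintro f rfl; exact avail_last gs (.const b)⟩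

theorem Derives.input (i : ι) : Derives A 1 {fun x => x i} := fun gs _ =>
  ⟨[.input i], by simp, by rintro f rfl; exact avail_last gs (.input i)⟩

theorem Derives.nand {f g : (ι → Bool) → Bool} (hf : f ∈ A) (hg : g ∈ A) :
    Derives A 1 {fun x => !(f x && g x)} := fun gs hgs => by
  obtain ⟨u, _, hu⟩ := hgs f hf
  obtain ⟨v, _, hv⟩ := hgs g hg
  refine ⟨[.nand u v], by simp, ?_⟩
  rintro h rfl
  have := avail_last gs (.nand u v)
  simpa only [Gate.value, hu, hv] using this

theorem Derives.nand_of {f g : (ι → Bool) → Bool} (hf : Derives A n {f}) (hg : Derives A m {g}) :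
    Derives A (n + m + 1) {fun x => !(f x && g x)} :=
  (hf.union hg).comp (Derives.nand (by simp) (by simp))

theorem Derives.self {f : (ι → Bool) → Bool} (hf : f ∈ A) : Derives A 0 {f} :=
  Derives.of_subset (by simpa using hf)

theorem Derives.not_of {f : (ι → Bool) → Bool} (hf : Derives A n {f}) :
    Derives A (n + 1) {fun x => !(f x)} := by
  simpa using hf.comp (Derives.nand (A := {f}) (f := f) (g := f) (by simp) (by simp))

theorem Derives.and_of {f g : (ι → Bool) → Bool} (hf : Derives A n {f}) (hg : Derives A m {g}) :
    Derives A (n + m + 2) {fun x => f x && g x} := by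
  simpa using (hf.nand_of hg).not_of

theorem Derives.xor_of {f g : (ι → Bool) → Bool} (hf : Derives A n {f}) (hg : Derives A m {g}) :
    Derives A (2 * n + 2 * m + 5) {fun x => f x ^^ g x} := by
  have h := (hf.nand_of hg.not_of).nand_of (hf.not_of.nand_of hg)
  refine h.mono subset_rfl ?_ (by omega)
  rw [Set.singleton_subset_iff, Set.mem_singleton_iff]
  funext x
  cases f x <;> cases g x <;> rfl

theorem Derives.atLeastTwo_of {f g h : (ι → Bool) → Bool} (hf : f ∈ A) (hg : g ∈ A) (hh : h ∈ A) :
    Derives A 8 {fun x => Bool.atLeastTwo (f x) (g x) (h x)} := by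
  have h1 := ((Derives.nand hf hg).nand_of (Derives.nand hf hh)).not_of.nand_of
    (Derives.nand hg hh)
  refine h1.mono subset_rfl ?_ (by omega)
  rw [Set.singleton_subset_iff, Set.mem_singleton_iff]
  funext x
  cases f x <;> cases g x <;> cases h x <;> rfl

/-- The bits of a bit vector that depends on the input. -/
def bitFns {W : ℕ} (F : (ι → Bool) → BitVec W) : Set ((ι → Bool) → Bool) :=
  {f | ∃ k, f = fun x => (F x).getLsbD k}

theorem bit_mem_bitFns {W : ℕ} (F : (ι → Bool) → BitVec W) (k : ℕ) :
    (fun x => (F x).getLsbD k) ∈ bitFns F := ⟨k, rfl⟩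

/-- Positions past the width read as `false`, so an available bit vector always supplies this
constant gate. -/
theorem false_mem_bitFns {W : ℕ} (F : (ι → Bool) → BitVec W) : (fun _ => false) ∈ bitFns F :=
  ⟨W, by funext x; simp⟩

theorem Derives.bits {W : ℕ} {F : (ι → Bool) → BitVec W} (h0 : (fun _ => false) ∈ A)
    (h : ∀ k < W, Derives A n {fun x => (F x).getLsbD k}) : Derives A (W * n) (bitFns F) := by
  refine ((Derives.family (Finset.range W) fun k hk => h k (Finset.mem_range.mp hk)).union
    (Derives.self h0)).mono subset_rfl ?_ (by simp)
  rintro f ⟨k, rfl⟩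
  by_cases hk : k < W
  · exact Or.inl ⟨k, Finset.mem_range.mpr hk, rfl⟩
  · exact Or.inr (by rw [Set.mem_singleton_iff]; funext x; simp [BitVec.getLsbD_of_ge, not_lt.mp hk])

/-- Ripple-carry addition: each carry is a majority of three bits (8 gates) and each output bit an
exclusive or of three (15 gates). -/
theorem Derives.add {W : ℕ} (F G : (ι → Bool) → BitVec W) (hF : bitFns F ⊆ A)
    (hG : bitFns G ⊆ A) : Derives A (35 * W) (bitFns fun x => F x + G x) := by
  have h0 : (fun _ => false) ∈ A := hF (false_mem_bitFns F)
  have key : ∀ k, Derives A (8 * k)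
      (A ∪ {f | ∃ i ≤ k, f = fun x => BitVec.carry i (F x) (G x) false}) := by
    intro k
    induction k with
    | zero =>
      refine Derives.of_subset (Set.union_subset subset_rfl ?_)
      rintro f ⟨i, hi, rfl⟩
      obtain rfl : i = 0 := by omega
      simpa using h0
    | succ k ih =>
      have h1 := (Derives.atLeastTwo_of
        (A := A ∪ {f | ∃ i ≤ k, f = fun x => BitVec.carry i (F x) (G x) false})
        (f := fun x => (F x).getLsbD k) (g := fun x => (G x).getLsbD k)
        (h := fun x => BitVec.carry k (F x) (G x) false)
        (Or.inl (hF ⟨k, rfl⟩)) (Or.inl (hG ⟨k, rfl⟩)) (Or.inr ⟨k, le_rfl, rfl⟩)).keep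
      refine (ih.comp h1).mono subset_rfl ?_ (by omega)
      rintro f (hf | ⟨i, hi, rfl⟩)
      · exact Or.inl (Or.inl hf)
      · rcases Nat.lt_or_ge k i with hk | hk
        · obtain rfl : i = k + 1 := by omega
          right
          rw [Set.mem_singleton_iff]
          funext x
          rw [BitVec.carry_succ]
        · exact Or.inl (Or.inr ⟨i, hk, rfl⟩)
  refine ((key W).comp (Derives.bits (Or.inl h0) (n := 15) ?_)).mono subset_rfl subset_rfl
    (by omega)
  intro k hk
  have h1 := (Derives.self (A := A ∪ {f | ∃ i ≤ W, f = fun x => BitVec.carry i (F x) (G x) false})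
    (f := fun x => (F x).getLsbD k) (Or.inl (hF ⟨k, rfl⟩))).xor_of
    ((Derives.self (f := fun x => (G x).getLsbD k) (Or.inl (hG ⟨k, rfl⟩))).xor_of
    (Derives.self (f := fun x => BitVec.carry k (F x) (G x) false) (Or.inr ⟨k, hk.le, rfl⟩)))
  refine h1.mono subset_rfl ?_ (by omega)
  rw [Set.singleton_subset_iff, Set.mem_singleton_iff]
  funext x
  rw [BitVec.getLsbD_add hk]

theorem Derives.shiftIf {W : ℕ} (F : (ι → Bool) → BitVec W) (c : (ι → Bool) → Bool) (s : ℕ)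
    (hF : bitFns F ⊆ A) (hc : c ∈ A) :
    Derives A (W * 2) (bitFns fun x => if c x then F x <<< s else 0) := by
  refine Derives.bits (hF (false_mem_bitFns F)) fun k hk => ?_
  by_cases hs : k < s
  · refine (Derives.self (hF (false_mem_bitFns F))).mono subset_rfl ?_ (by omega)
    rw [Set.singleton_subset_iff, Set.mem_singleton_iff]
    funext x
    cases c x <;> simp [hs]
  · refine ((Derives.self hc).and_of (Derives.self (hF ⟨k - s, rfl⟩))).mono subset_rfl ?_ (by omega)
    rw [Set.singleton_subset_iff, Set.mem_singleton_iff]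
    funext x
    cases c x <;> simp [hs, hk, BitVec.getLsbD_eq_getElem (show k - s < W by omega)]

/-- Schoolbook multiplication: each of `W + 1` rounds makes one conditional shift (`2 * W` gates)
and one addition (`35 * W`). -/
theorem Derives.mul {W : ℕ} (F G : (ι → Bool) → BitVec W) (hF : bitFns F ⊆ A)
    (hG : bitFns G ⊆ A) : Derives A (37 * W * (W + 1)) (bitFns fun x => F x * G x) := by
  have key : ∀ s, Derives A (37 * W * (s + 1)) (bitFns fun x => BitVec.mulRec (F x) (G x) s) := by
    intro s
    induction s with
    | zero =>
      refine (Derives.shiftIf F (fun x => (G x).getLsbD 0) 0 hF (hG ⟨0, rfl⟩)).mono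
        subset_rfl ?_ (by omega)
      simp [BitVec.mulRec_zero_eq]
    | succ s ih =>
      have h1 := (ih.union (Derives.shiftIf F (fun x => (G x).getLsbD (s + 1)) (s + 1) hF
        (hG ⟨s + 1, rfl⟩))).comp (Derives.add _ _ Set.subset_union_left Set.subset_union_right)
      refine h1.mono subset_rfl ?_ (by ring_nf; omega)
      simp [BitVec.mulRec_succ_eq]
  refine (key W).mono subset_rfl ?_ le_rfl
  rintro f ⟨k, rfl⟩
  exact ⟨k, by funext x; rw [BitVec.getLsbD_mul]⟩

theorem Derives.constBits {W : ℕ} (b : BitVec W) (h0 : (fun _ => false) ∈ A) :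
    Derives A (W * 1) (bitFns fun _ => b) :=
  Derives.bits h0 fun k _ => Derives.const (b.getLsbD k)

/-- Weighted sum of squares. -/
theorem Derives.sumSq {W : ℕ} {J : Type*} (s : Finset J) (F : J → (ι → Bool) → BitVec W)
    (b : J → BitVec W) (h0 : (fun _ => false) ∈ A) (hF : ∀ j ∈ s, bitFns (F j) ⊆ A) :
    Derives A (s.card * (110 * W * (W + 1)) + W)
      (bitFns fun x => ∑ j ∈ s, b j * (F j x * F j x)) := by
  classical
  induction s using Finset.induction_on with
  | empty => simpa using Derives.constBits (A := A) (0 : BitVec W) h0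
  | insert j s hj ih =>
    have h1 := (Derives.constBits (b j) h0).union
      (Derives.mul (F j) (F j) (hF j (by simp)) (hF j (by simp)))
    have h2 := h1.comp (Derives.mul (fun _ => b j) (fun x => F j x * F j x)
      Set.subset_union_left Set.subset_union_right)
    have h3 := (h2.union (ih fun i hi => hF i (by simp [hi]))).comp
      (Derives.add _ _ Set.subset_union_left Set.subset_union_right)
    refine h3.mono subset_rfl ?_ ?_
    · simp [Finset.sum_insert hj]
    · rw [Finset.card_insert_of_notMem hj]
      nlinarith [Nat.zero_le (W * W)]

/-- Feeding computed bits into a circuit. -/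
theorem Derives.subcircuit {κ : Type} (gs : List (Gate κ)) (y : (ι → Bool) → κ → Bool)
    (h0 : (fun _ => false) ∈ A) (hy : ∀ i, (fun x => y x i) ∈ A) :
    Derives A gs.length {f | ∃ k, f = fun x => (gateValues (y x) gs).getD k false} := by
  suffices h : Derives A gs.length
      (A ∪ {f | ∃ k, f = fun x => (gateValues (y x) gs).getD k false}) from
    h.mono subset_rfl Set.subset_union_right le_rfl
  induction gs using List.reverseRecOn with
  | nil =>
    refine Derives.of_subset (Set.union_subset subset_rfl ?_)
    rintro f ⟨k, rfl⟩
    simpa [gateValues] using h0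
  | append_singleton gs g ih =>
    set E := {f | ∃ k, f = fun x => (gateValues (y x) gs).getD k false} with hE
    have h1 : Derives (A ∪ E) 1 {fun x => g.value (y x) (gateValues (y x) gs)} := by
      cases g with
      | input i => exact (Derives.self (Or.inl (hy i))).mono subset_rfl subset_rfl (by omega)
      | const b => exact Derives.const b
      | nand u v => exact Derives.nand (Or.inr ⟨u, rfl⟩) (Or.inr ⟨v, rfl⟩)
    refine (ih.comp h1.keep).mono subset_rfl ?_ (by simp)
    rintro f (hf | ⟨k, rfl⟩)
    · exact Or.inl (Or.inl hf)
    · rcases lt_trichotomy k gs.length with hk | hk | hk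
      · refine Or.inl (Or.inr ⟨k, ?_⟩)
        funext x
        rw [gateValues_append_getD _ _ _ hk]
      · right
        rw [Set.mem_singleton_iff]
        funext x
        rw [gateValues_append_singleton, List.getD_append_right _ _ _ _ (by simp [hk])]
        simp [hk]
      -- A position past the last gate reads the default value `false`.
      · refine Or.inl (Or.inl ?_)
        convert h0 using 2 with x
        exact List.getD_eq_default _ _ (by simp; omega)

/-- Sign extension: above position `w` a two's complement integer repeats its sign bit. -/
theorem testBit_eq_of_fits {w : ℕ} {b : ℤ} (h1 : -2 ^ w ≤ b) (h2 : b < 2 ^ w) {k : ℕ}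
    (hk : w ≤ k) : b.testBit k = b.testBit w := by
  have key : ∀ m : ℕ, m < 2 ^ w → m.testBit k = m.testBit w := fun m hm => by
    rw [Nat.testBit_eq_false_of_lt (hm.trans_le (Nat.pow_le_pow_right (by norm_num) hk)),
      Nat.testBit_eq_false_of_lt hm]
  cases b with
  | ofNat m =>
    exact key m (by rw [Int.ofNat_eq_natCast] at h2; exact_mod_cast h2)
  | negSucc m =>
    simp only [Int.testBit]
    rw [key m]
    rw [Int.negSucc_eq] at h1
    have : (m : ℤ) < 2 ^ w := by omega
    exact_mod_cast this

theorem getLsbD_ofInt_eq_testBit {W k : ℕ} (hk : k < W) (b : ℤ) :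
    (BitVec.ofInt W b).getLsbD k = b.testBit k := by
  cases b with
  | ofNat m => simp [Int.testBit, hk, -BitVec.getLsbD_eq_getElem, BitVec.getLsbD_ofNat]
  | negSucc m =>
    rw [BitVec.ofInt_negSucc_eq_not_ofNat]
    simp [Int.testBit, hk, -BitVec.getLsbD_eq_getElem, BitVec.getLsbD_ofNat]

end Circuits

/-- The integers `q₀` and `q₁` are the hard-wired channel outputs of the reduction, so every bit fed
to `C` is a constant, an input bit or a negated input bit. The quadratic form is computed modulo `2
^ W`. -/
theorem exists_circuit_sumSq_neg {α I J : Type} [Fintype I] [Fintype J] {ℓ w : ℕ}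
    (C : Circuit (I × Fin (ℓ + 1)) (J × Fin (w + 1))) (f : (I → ℤ) → J → ℤ)
    (hC : ∀ q, FitsIn ℓ q → FitsIn w (f q) ∧ C.eval (intBits ℓ q) = intBits w (f q))
    (q₀ q₁ : I → ℤ) (h₀ : FitsIn ℓ q₀) (h₁ : FitsIn ℓ q₁) (v : I → α) (wt : J → ℤ)
    (hwt : ∀ j, |wt j| ≤ 1) :
    ∃ D : Circuit α Unit,
      D.size ≤ 3 * (Fintype.card I * (ℓ + 1)) + C.size + 2 +
        Fintype.card J * (110 * (2 * w + Fintype.card J + 2) * (2 * w + Fintype.card J + 2 + 1)) +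
        (2 * w + Fintype.card J + 2) ∧
      ∀ x, D.eval x () = decide
        (∑ j, wt j * f (fun i => if x (v i) then q₁ i else q₀ i) j ^ 2 < 0) := by
  classical
  -- Wide enough to rule out overflow: the sum is below `card J * 2 ^ (2 * w)` in absolute value or
  -- zero, so its sign is the top bit.
  set W := 2 * w + Fintype.card J + 2 with hW
  set q : (α → Bool) → I → ℤ := fun x i => if x (v i) then q₁ i else q₀ i with hq
  have hfit : ∀ x, FitsIn ℓ (q x) := fun x i => by
    simp only [hq]; split_ifs; exacts [h₁ i, h₀ i]
  have e1 : Derives (ι := α) ∅ (Fintype.card I * (ℓ + 1) * 3)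
      {g | ∃ a : I × Fin (ℓ + 1), g = fun x => intBits ℓ (q x) a} := by
    have := Derives.family (ι := α) (A := ∅) (n := 3) (Finset.univ : Finset (I × Fin (ℓ + 1)))
      (f := fun a => {fun x => intBits ℓ (q x) a}) ?_
    · refine this.mono subset_rfl ?_ (by simp)
      rintro g ⟨a, rfl⟩
      exact ⟨a, by simp, rfl⟩
    · rintro ⟨i, b⟩ -
      rcases hb1 : (q₁ i).testBit b <;> rcases hb0 : (q₀ i).testBit b
      · refine (Derives.const false).mono subset_rfl ?_ (by omega)
        rw [Set.singleton_subset_iff, Set.mem_singleton_iff]; funext x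
        rcases hx : x (v i) <;> simp [intBits, hq, hx, hb1, hb0]
      · refine (Derives.input (v i)).not_of.mono subset_rfl ?_ (by omega)
        rw [Set.singleton_subset_iff, Set.mem_singleton_iff]; funext x
        rcases hx : x (v i) <;> simp [intBits, hq, hx, hb1, hb0]
      · refine (Derives.input (v i)).mono subset_rfl ?_ (by omega)
        rw [Set.singleton_subset_iff, Set.mem_singleton_iff]; funext x
        rcases hx : x (v i) <;> simp [intBits, hq, hx, hb1, hb0]
      · refine (Derives.const true).mono subset_rfl ?_ (by omega)
        rw [Set.singleton_subset_iff, Set.mem_singleton_iff]; funext x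
        rcases hx : x (v i) <;> simp [intBits, hq, hx, hb1, hb0]
  have e2 := (e1.union (Derives.const false)).trans (Derives.subcircuit C.gates
    (fun x => intBits ℓ (q x)) (Or.inr (Or.inr rfl)) (fun a => Or.inr (Or.inl ⟨a, rfl⟩)))
  have e3 := (e2.comp (Derives.sumSq (W := W) Finset.univ
    (fun j x => BitVec.ofInt W (f (q x) j)) (fun j => BitVec.ofInt W (wt j))
    (Or.inl (Or.inr (Or.inr rfl))) ?_)) [] (by simp)
  swap
  · rintro j - g ⟨k, rfl⟩
    by_cases hk : k < W
    · right
      -- Output bit `w` is the sign bit, and positions above it reuse it.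
      refine ⟨C.out (j, ⟨min k w, by omega⟩), ?_⟩
      funext x
      obtain ⟨hf, hev⟩ := hC (q x) (hfit x)
      have := congrFun hev (j, ⟨min k w, by omega⟩)
      simp only [Circuit.eval, intBits] at this
      simp only [this, getLsbD_ofInt_eq_testBit hk]
      rcases le_total k w with h | h
      · simp [h]
      · rw [testBit_eq_of_fits (hf j).1 (hf j).2 h]; simp [h]
    · refine Or.inl (Or.inr (Or.inr ?_))
      rw [Set.mem_singleton_iff]; funext x
      exact BitVec.getLsbD_of_ge _ _ (not_lt.mp hk)
  obtain ⟨hs, hl, hav⟩ := e3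
  obtain ⟨k, hk, hval⟩ := hav _ (bit_mem_bitFns _ (W - 1))
  refine ⟨⟨hs, fun _ => k⟩, ?_, fun x => ?_⟩
  · simp only [Circuit.size] at hl ⊢
    simp only [Finset.card_univ] at hl
    have : Fintype.card I * (ℓ + 1) * 3 = 3 * (Fintype.card I * (ℓ + 1)) := by ring
    omega
  · have h1 := hval x
    simp only [List.nil_append] at h1
    simp only [Circuit.eval, h1]
    have hsum : (∑ j, BitVec.ofInt W (wt j) * (BitVec.ofInt W (f (q x) j) *
        BitVec.ofInt W (f (q x) j))) = BitVec.ofInt W (∑ j, wt j * f (q x) j ^ 2) := by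
      have : ∀ s : Finset J, (∑ j ∈ s, BitVec.ofInt W (wt j) * (BitVec.ofInt W (f (q x) j) *
        BitVec.ofInt W (f (q x) j))) = BitVec.ofInt W (∑ j ∈ s, wt j * f (q x) j ^ 2) := by
        intro s
        induction s using Finset.induction_on with
        | empty => simp
        | insert j s hj ih =>
          rw [Finset.sum_insert hj, Finset.sum_insert hj, ih, BitVec.ofInt_add, sq,
            BitVec.ofInt_mul, BitVec.ofInt_mul]
      exact this _
    have hbd : |∑ j, wt j * f (q x) j ^ 2| < 2 ^ (W - 1) := by
      calc |∑ j, wt j * f (q x) j ^ 2| ≤ ∑ j, |wt j * f (q x) j ^ 2| :=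
            Finset.abs_sum_le_sum_abs _ _
        _ ≤ ∑ _j : J, (2 : ℤ) ^ (2 * w) := by
            refine Finset.sum_le_sum fun j _ => ?_
            obtain ⟨ha, hb⟩ := (hC (q x) (hfit x)).1 j
            rw [abs_mul, abs_of_nonneg (sq_nonneg (f (q x) j))]
            have h2 : f (q x) j ^ 2 ≤ (2 ^ w) ^ 2 := sq_le_sq' ha hb.le
            calc |wt j| * f (q x) j ^ 2 ≤ 1 * f (q x) j ^ 2 :=
                  mul_le_mul_of_nonneg_right (hwt j) (sq_nonneg _)
              _ ≤ _ := by rw [one_mul, mul_comm 2 w, pow_mul]; exact h2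
        _ = (Fintype.card J : ℤ) * 2 ^ (2 * w) := by simp
        _ < 2 ^ (Fintype.card J) * 2 ^ (2 * w) := by
            have : (Fintype.card J : ℤ) < 2 ^ Fintype.card J := by
              exact_mod_cast Nat.lt_two_pow_self
            exact mul_lt_mul_of_pos_right this (by positivity)
        _ = 2 ^ (Fintype.card J + 2 * w) := (pow_add _ _ _).symm
        _ ≤ 2 ^ (W - 1) := pow_le_pow_right₀ (by norm_num) (by omega)
    rw [hsum, ← BitVec.msb_eq_getLsbD_last, BitVec.msb_eq_toInt,
      BitVec.toInt_ofInt_eq_self (by omega) (abs_lt.mp hbd).1.le (abs_lt.mp hbd).2]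

/-! ## Singular values -/

section SingularValues

open Matrix

/-- Expansion of `x` in an eigenbasis of the adjoint of `T` composed with `T`, whose eigenvalues are
the squared singular values. -/
theorem norm_sq_eq_sum_singularValues {E F : Type*} [NormedAddCommGroup E] [InnerProductSpace ℝ E]
    [FiniteDimensional ℝ E] [NormedAddCommGroup F] [InnerProductSpace ℝ F] [FiniteDimensional ℝ F]
    (T : E →ₗ[ℝ] F) {n : ℕ} (hn : Module.finrank ℝ E = n) (x : E) :
    ‖T x‖ ^ 2 = ∑ i : Fin n, T.singularValues i ^ 2 *
      (inner ℝ (T.isSymmetric_adjoint_comp_self.eigenvectorBasis hn i) x) ^ 2 := by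
  set b := T.isSymmetric_adjoint_comp_self.eigenvectorBasis hn with hb
  have h1 : ‖T x‖ ^ 2 = inner ℝ x ((LinearMap.adjoint T ∘ₗ T) x) := by
    rw [LinearMap.comp_apply, LinearMap.adjoint_inner_right, real_inner_self_eq_norm_sq]
  rw [h1, ← b.sum_inner_mul_inner]
  refine Finset.sum_congr rfl fun i _ => ?_
  have h2 : inner ℝ (b i) ((LinearMap.adjoint T ∘ₗ T) x) =
      T.isSymmetric_adjoint_comp_self.eigenvalues hn i * inner ℝ (b i) x := by
    have := T.isSymmetric_adjoint_comp_self.eigenvectorBasis_apply_self_apply hn x i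
    rw [OrthonormalBasis.repr_apply_apply, OrthonormalBasis.repr_apply_apply] at this
    exact this
  rw [h2, T.sq_singularValues_fin hn, real_inner_comm]
  ring

/-- The lower half of the min-max principle: a subspace of dimension greater than `k` contains a
nonzero vector orthogonal to the first `k` eigenvectors, and on it `T` stretches by at most the
singular value of (zero-based) index `k`. -/
theorem le_singularValues_of_subspace {E F : Type*} [NormedAddCommGroup E] [InnerProductSpace ℝ E]
    [FiniteDimensional ℝ E] [NormedAddCommGroup F] [InnerProductSpace ℝ F] [FiniteDimensional ℝ F]
    (T : E →ₗ[ℝ] F) (S : Submodule ℝ E) {k : ℕ} (hS : k < Module.finrank ℝ S) {lam : ℝ}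
    (h : ∀ x ∈ S, lam ^ 2 * ‖x‖ ^ 2 ≤ ‖T x‖ ^ 2) : lam ≤ T.singularValues k := by
  by_contra! hlt
  have h0 := T.singularValues_nonneg k
  set n := Module.finrank ℝ E with hn
  set b := T.isSymmetric_adjoint_comp_self.eigenvectorBasis (n := n) hn.symm with hb
  have hkn : k < n := hS.trans_le (Submodule.finrank_le S)
  let φ : S →ₗ[ℝ] (Fin k → ℝ) :=
    LinearMap.pi fun i => (innerₛₗ ℝ (b ⟨i, i.2.trans hkn⟩)) ∘ₗ S.subtype
  have hker : LinearMap.ker φ ≠ ⊥ := LinearMap.ker_ne_bot_of_finrank_lt (by simpa using hS)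
  obtain ⟨x, hx, hx0⟩ := (Submodule.ne_bot_iff _).mp hker
  have hxi : ∀ i : Fin n, (i : ℕ) < k → inner ℝ (b i) (x : E) = 0 := fun i hi =>
    congrFun (LinearMap.mem_ker.mp hx) ⟨i, hi⟩
  have h1 : ‖T x‖ ^ 2 ≤ T.singularValues k ^ 2 * ‖(x : E)‖ ^ 2 := by
    rw [norm_sq_eq_sum_singularValues T hn.symm, ← b.sum_sq_norm_inner_right (x : E),
      Finset.mul_sum]
    refine Finset.sum_le_sum fun i _ => ?_
    rcases lt_or_ge (i : ℕ) k with hi | hi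
    · rw [← hb, hxi i hi]; simp
    · rw [Real.norm_eq_abs, sq_abs]
      exact mul_le_mul_of_nonneg_right
        (pow_le_pow_left₀ (T.singularValues_nonneg i) (T.singularValues_antitone hi) 2) (sq_nonneg _)
  have h2 := h x x.2
  have h3 : 0 < ‖(x : E)‖ ^ 2 := by
    have : (x : E) ≠ 0 := by simpa using hx0
    positivity
  have h4 : T.singularValues k ^ 2 < lam ^ 2 := pow_lt_pow_left₀ hlt h0 two_ne_zero
  nlinarith

theorem norm_toLp_sq {n : Type*} [Fintype n] (x : n → ℝ) : ‖WithLp.toLp 2 x‖ ^ 2 = x ⬝ᵥ x := by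
  rw [EuclideanSpace.norm_sq_eq]
  simp [dotProduct, sq]

theorem le_singularValue {m n : Type} [Fintype m] [Fintype n] [DecidableEq n] {r : ℕ} (hr : 1 ≤ r)
    (M : Matrix m n ℝ) (V : Matrix n (Fin r) ℝ) (hV : Vᵀ * V = 1) {lam : ℝ}
    (h : ∀ y : Fin r → ℝ, lam ^ 2 * (y ⬝ᵥ y) ≤ (M *ᵥ (V *ᵥ y)) ⬝ᵥ (M *ᵥ (V *ᵥ y))) :
    lam ≤ singularValue M r := by
  have hiso : ∀ y, (V *ᵥ y) ⬝ᵥ (V *ᵥ y) = y ⬝ᵥ y := fun y => by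
    rw [dotProduct_mulVec, vecMul_mulVec, ← dotProduct_mulVec, hV, one_mulVec]
  refine le_singularValues_of_subspace _ (LinearMap.range (toEuclideanLin V)) (k := r - 1) ?_ ?_
  · rw [LinearMap.finrank_range_of_inj]
    · simp; omega
    · rw [← LinearMap.ker_eq_bot, LinearMap.ker_eq_bot']
      intro y hy
      have h1 : V *ᵥ (WithLp.ofLp y) = 0 := by
        have := congrArg WithLp.ofLp hy
        simpa using this
      have h2 := hiso (WithLp.ofLp y)
      rw [h1, zero_dotProduct, eq_comm, dotProduct_self_eq_zero] at h2
      ext i; exact congrFun h2 i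
  · rintro _ ⟨y, rfl⟩
    have h1 : toEuclideanLin V y = WithLp.toLp 2 (V *ᵥ WithLp.ofLp y) := rfl
    have h2 : toEuclideanLin M (WithLp.toLp 2 (V *ᵥ WithLp.ofLp y)) =
      WithLp.toLp 2 (M *ᵥ (V *ᵥ WithLp.ofLp y)) := rfl
    rw [h1, h2, norm_toLp_sq, norm_toLp_sq, hiso]
    exact h _

theorem singularValue_sq_mul_le {r : ℕ} (hr : 1 ≤ r) (M : Matrix (Fin r) (Fin r) ℝ)
    (y : Fin r → ℝ) : singularValue M r ^ 2 * (y ⬝ᵥ y) ≤ (M *ᵥ y) ⬝ᵥ (M *ᵥ y) := by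
  have hn : Module.finrank ℝ (EuclideanSpace ℝ (Fin r)) = r := by simp
  have h1 : toEuclideanLin M (WithLp.toLp 2 y) = WithLp.toLp 2 (M *ᵥ y) := rfl
  rw [← norm_toLp_sq, ← norm_toLp_sq, ← h1, norm_sq_eq_sum_singularValues _ hn,
    ← ((toEuclideanLin M).isSymmetric_adjoint_comp_self.eigenvectorBasis hn).sum_sq_norm_inner_right
      (WithLp.toLp 2 y), Finset.mul_sum]
  refine Finset.sum_le_sum fun i _ => ?_
  rw [Real.norm_eq_abs, sq_abs]
  exact mul_le_mul_of_nonneg_right (pow_le_pow_left₀ ((toEuclideanLin M).singularValues_nonneg _)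
    ((toEuclideanLin M).singularValues_antitone (by omega)) 2) (sq_nonneg _)

/-- A vector in the column space of `A` has little mass outside the support of the columns of `U`
when the column spaces are close. -/
theorem mass_le_sinTheta_sq {m : Type} [Fintype m] {r : ℕ} (hr : 1 ≤ r)
    {A U : Matrix m (Fin r) ℝ} (hA : Aᵀ * A = 1) (hU : Uᵀ * U = 1) (S : m → Prop)
    [DecidablePred S] (hS : ∀ i a, ¬ S i → U i a = 0) (y : Fin r → ℝ) :
    ∑ i, (if S i then 0 else (A *ᵥ y) i ^ 2) ≤ sinTheta A U ^ 2 * ∑ i, (A *ᵥ y) i ^ 2 := by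
  set b := A *ᵥ y with hb
  set W := Aᵀ * U with hW
  set σ := singularValue W r with hσ
  have hσ0 : 0 ≤ σ := (toEuclideanLin W).singularValues_nonneg _
  have hbb : ∑ i, b i ^ 2 = y ⬝ᵥ y := by
    have : b ⬝ᵥ b = y ⬝ᵥ y := by
      rw [hb, dotProduct_mulVec, vecMul_mulVec, ← dotProduct_mulVec, hA, one_mulVec]
    rw [← this]; simp [dotProduct, sq]
  -- The smallest cosine `σ` gives the largest sine. If `σ` exceeded 1 the left side would be
  -- negative.
  have hs : 1 - σ ^ 2 ≤ sinTheta A U ^ 2 := by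
    have h1 : Real.sin (Real.arccos (singularValue W ((⟨r - 1, by omega⟩ : Fin r) + 1))) ≤
        sinTheta A U :=
      le_ciSup (f := fun i : Fin r => Real.sin (Real.arccos (singularValue (Aᵀ * U) (i + 1))))
        (Set.finite_range _).bddAbove (⟨r - 1, by omega⟩ : Fin r)
    have h2 : ((⟨r - 1, by omega⟩ : Fin r) : ℕ) + 1 = r := by simp; omega
    rw [h2, Real.sin_arccos] at h1
    rcases le_total 0 (1 - σ ^ 2) with h | h
    · calc 1 - σ ^ 2 = Real.sqrt (1 - σ ^ 2) ^ 2 := (Real.sq_sqrt h).symm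
        _ ≤ _ := pow_le_pow_left₀ (Real.sqrt_nonneg _) h1 2
    · exact h.trans (sq_nonneg _)
  -- The transpose of `W` also has `σ` as a lower bound. When `σ > 0`, `W` is invertible; write `y =
  -- W z` and apply Cauchy-Schwarz to `⟨y, y⟩ = ⟨Wᵀ y, z⟩`.
  have hWt : σ ^ 2 * (y ⬝ᵥ y) ≤ (Uᵀ *ᵥ b) ⬝ᵥ (Uᵀ *ᵥ b) := by
    have hUb : Uᵀ *ᵥ b = Wᵀ *ᵥ y := by
      rw [hb, mulVec_mulVec, hW, transpose_mul, transpose_transpose]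
    rw [hUb]
    have hq0 : 0 ≤ (Wᵀ *ᵥ y) ⬝ᵥ (Wᵀ *ᵥ y) := by simpa using dotProduct_self_star_nonneg (Wᵀ *ᵥ y)
    rcases hσ0.eq_or_lt with h0 | hpos
    · rw [← h0]; simpa using hq0
    have hy0 : 0 ≤ y ⬝ᵥ y := by simpa using dotProduct_self_star_nonneg y
    rcases hy0.eq_or_lt with hy | hy
    · rw [← hy]; simpa using hq0
    have hinj : Function.Injective W.mulVec := by
      have h0 : Function.Injective (Matrix.mulVecLin W) := by
        rw [← LinearMap.ker_eq_bot, LinearMap.ker_eq_bot']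
        intro z hz
        have h1 := singularValue_sq_mul_le hr W z
        have h2 : W *ᵥ z = 0 := hz
        rw [h2, zero_dotProduct] at h1
        have h3 : 0 ≤ z ⬝ᵥ z := by simpa using dotProduct_self_star_nonneg z
        have h4 : z ⬝ᵥ z = 0 := by
          have : 0 < σ ^ 2 := by positivity
          nlinarith
        exact dotProduct_self_eq_zero.mp h4
      exact h0
    obtain ⟨z, rfl⟩ : ∃ z, W *ᵥ z = y := by
      have := Matrix.mulVec_surjective_iff_isUnit.mpr (Matrix.mulVec_injective_iff_isUnit.mp hinj)
      exact this y
    set y := W *ᵥ z with hy'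
    have h1 := singularValue_sq_mul_le hr W z
    rw [← hσ, ← hy'] at h1
    have h2 : y ⬝ᵥ y = (Wᵀ *ᵥ y) ⬝ᵥ z := by
      rw [mulVec_transpose, ← dotProduct_mulVec]
    have h3 : ((Wᵀ *ᵥ y) ⬝ᵥ z) ^ 2 ≤ ((Wᵀ *ᵥ y) ⬝ᵥ (Wᵀ *ᵥ y)) * (z ⬝ᵥ z) := by
      have := Finset.sum_mul_sq_le_sq_mul_sq Finset.univ (Wᵀ *ᵥ y) z
      simpa [dotProduct, sq] using this
    rw [← h2] at h3
    have h4 : (σ ^ 2 * (y ⬝ᵥ y)) * (y ⬝ᵥ y) ≤ ((Wᵀ *ᵥ y) ⬝ᵥ (Wᵀ *ᵥ y)) * (y ⬝ᵥ y) := by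
      calc _ = σ ^ 2 * (y ⬝ᵥ y) ^ 2 := by ring
        _ ≤ σ ^ 2 * (((Wᵀ *ᵥ y) ⬝ᵥ (Wᵀ *ᵥ y)) * (z ⬝ᵥ z)) := by gcongr
        _ = ((Wᵀ *ᵥ y) ⬝ᵥ (Wᵀ *ᵥ y)) * (σ ^ 2 * (z ⬝ᵥ z)) := by ring
        _ ≤ _ := by gcongr
    exact le_of_mul_le_mul_right h4 hy
  -- The residual of the projection of `b` onto the columns of `U` coincides with `b` wherever the
  -- rows of `U` vanish.
  have hres : ∑ i, (if S i then 0 else b i ^ 2) ≤ y ⬝ᵥ y - (Uᵀ *ᵥ b) ⬝ᵥ (Uᵀ *ᵥ b) := by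
    set e := b - U *ᵥ (Uᵀ *ᵥ b) with he
    have h1 : e ⬝ᵥ e = y ⬝ᵥ y - (Uᵀ *ᵥ b) ⬝ᵥ (Uᵀ *ᵥ b) := by
      have h2 : b ⬝ᵥ (U *ᵥ (Uᵀ *ᵥ b)) = (Uᵀ *ᵥ b) ⬝ᵥ (Uᵀ *ᵥ b) := by
        rw [dotProduct_mulVec, mulVec_transpose]
      have h3 : (U *ᵥ (Uᵀ *ᵥ b)) ⬝ᵥ (U *ᵥ (Uᵀ *ᵥ b)) = (Uᵀ *ᵥ b) ⬝ᵥ (Uᵀ *ᵥ b) := by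
        rw [dotProduct_mulVec (U *ᵥ (Uᵀ *ᵥ b)), vecMul_mulVec, ← dotProduct_mulVec, hU, one_mulVec]
      rw [he, sub_dotProduct, dotProduct_sub, dotProduct_sub, h3,
        dotProduct_comm (U *ᵥ (Uᵀ *ᵥ b)) b, h2, ← hbb]
      simp [dotProduct, sq]
    rw [← h1, dotProduct]
    refine Finset.sum_le_sum fun i _ => ?_
    split_ifs with hi
    · exact mul_self_nonneg _
    · have : (U *ᵥ (Uᵀ *ᵥ b)) i = 0 := by
        rw [mulVec, dotProduct]
        exact Finset.sum_eq_zero fun a _ => by rw [hS i a hi, zero_mul]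
      rw [he, Pi.sub_apply, this, sub_zero, sq]
  have hy0 : 0 ≤ y ⬝ᵥ y := by simpa using dotProduct_self_star_nonneg y
  rw [hbb]
  nlinarith

/-- Singular value decomposition of a matrix whose rows are multiples of `r` orthogonal vectors. -/
theorem exists_svd_of_labels {m n : Type} [Fintype m] [Fintype n] [DecidableEq n] {r : ℕ}
    (hr : 1 ≤ r) (M : Matrix m n ℝ) (α : m → Fin r) (x : m → ℝ) (y : Fin r → n → ℝ)
    (hM : ∀ i c, M i c = x i * y (α i) c) (hy : ∀ a b, a ≠ b → y a ⬝ᵥ y b = 0) {lam : ℝ}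
    (hlam : 0 < lam)
    (h : ∀ a, lam ^ 2 ≤ (∑ i, if α i = a then x i ^ 2 else 0) * (y a ⬝ᵥ y a)) :
    M.rank ≤ r ∧ lam ≤ singularValue M r ∧
      ∃ U : Matrix m (Fin r) ℝ, IsLeftSingular U M ∧ ∀ i a, x i = 0 → U i a = 0 := by
  classical
  set N : Fin r → ℝ := fun a => ∑ i, if α i = a then x i ^ 2 else 0 with hN
  set L : Fin r → ℝ := fun a => y a ⬝ᵥ y a with hL
  have hN0 : ∀ a, 0 ≤ N a := fun a => Finset.sum_nonneg fun i _ => by split_ifs <;> positivity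
  have hL0 : ∀ a, 0 ≤ L a := fun a => by simpa using dotProduct_self_star_nonneg (y a)
  have hpos : ∀ a, 0 < N a ∧ 0 < L a := fun a => by
    have h1 : 0 < N a * L a := lt_of_lt_of_le (by positivity) (h a)
    exact ⟨(hN0 a).lt_of_ne fun h0 => by simp [← h0] at h1,
      (hL0 a).lt_of_ne fun h0 => by simp [← h0] at h1⟩
  -- `IsLeftSingular` wants decreasing singular values, so the labels are sorted by `sqrt (N a * L
  -- a)`, the singular value of label `a`.
  set π := Tuple.sort fun a => -Real.sqrt (N a * L a) with hπ
  set s : Fin r → ℝ := fun a => Real.sqrt (N (π a) * L (π a)) with hs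
  set U : Matrix m (Fin r) ℝ := Matrix.of fun i a =>
    if α i = π a then x i / Real.sqrt (N (π a)) else 0 with hU
  set V : Matrix n (Fin r) ℝ := Matrix.of fun c a => y (π a) c / Real.sqrt (L (π a)) with hV
  have hUU : Uᵀ * U = 1 := by
    ext a b
    rw [mul_apply]
    by_cases hab : a = b
    · subst hab
      rw [one_apply_eq]
      have : ∀ i, Uᵀ a i * U i a = (if α i = π a then x i ^ 2 else 0) / N (π a) := fun i => by
        simp only [hU, transpose_apply, of_apply]
        split_ifs
        · rw [div_mul_div_comm, Real.mul_self_sqrt (hN0 _), sq]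
        · simp
      rw [Finset.sum_congr rfl fun i _ => this i, ← Finset.sum_div]
      exact div_self (hpos _).1.ne'
    · rw [one_apply_ne hab]
      refine Finset.sum_eq_zero fun i _ => ?_
      simp only [hU, transpose_apply, of_apply]
      split_ifs with h1 h2
      · exact absurd (π.injective (h1.symm.trans h2)) hab
      all_goals simp
  have hVV : Vᵀ * V = 1 := by
    ext a b
    rw [mul_apply]
    have : ∀ c, Vᵀ a c * V c b =
        (y (π a) c * y (π b) c) / (Real.sqrt (L (π a)) * Real.sqrt (L (π b))) := fun c => by
      simp only [hV, transpose_apply, of_apply]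
      rw [div_mul_div_comm]
    rw [Finset.sum_congr rfl fun c _ => this c, ← Finset.sum_div]
    change (y (π a) ⬝ᵥ y (π b)) / _ = _
    by_cases hab : a = b
    · subst hab
      rw [one_apply_eq, Real.mul_self_sqrt (hL0 _)]
      exact div_self (hpos _).2.ne'
    · rw [one_apply_ne hab, hy _ _ fun h => hab (π.injective h), zero_div]
  have hdec : M = U * diagonal s * Vᵀ := by
    ext i c
    rw [hM, mul_apply]
    simp only [mul_diagonal, transpose_apply]
    rw [Finset.sum_eq_single (π.symm (α i))]
    · have h1 := Real.sqrt_pos.mpr (hpos (α i)).1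
      have h2 := Real.sqrt_pos.mpr (hpos (α i)).2
      simp only [hU, hs, hV, of_apply, Equiv.apply_symm_apply, if_true]
      rw [Real.sqrt_mul (hN0 _)]
      field_simp
    · intro a _ ha
      have : α i ≠ π a := fun h => ha (by rw [h]; simp)
      simp [hU, this]
    · simp
  have hslam : ∀ a, lam ^ 2 ≤ s a ^ 2 := fun a => by
    rw [hs]
    simp only
    rw [Real.sq_sqrt (mul_nonneg (hN0 _) (hL0 _))]
    exact h _
  refine ⟨?_, ?_, U, ⟨hUU, V, s, hVV, ?_, fun a => Real.sqrt_nonneg _, hdec⟩, ?_⟩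
  · rw [hdec, Matrix.mul_assoc]
    exact (rank_mul_le_left _ _).trans (by simpa using rank_le_card_width U)
  · refine le_singularValue hr M V hVV fun z => ?_
    have h1 : M *ᵥ (V *ᵥ z) = U *ᵥ (diagonal s *ᵥ z) := by
      rw [hdec, mulVec_mulVec, Matrix.mul_assoc, hVV, Matrix.mul_one, mulVec_mulVec]
    rw [h1, dotProduct_mulVec (U *ᵥ (diagonal s *ᵥ z)), vecMul_mulVec, ← dotProduct_mulVec, hUU,
      one_mulVec]
    simp only [dotProduct, mulVec_diagonal, Finset.mul_sum]
    refine Finset.sum_le_sum fun a _ => ?_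
    have := hslam a
    nlinarith [mul_self_nonneg (z a)]
  · intro a b hab
    have := Tuple.monotone_sort (fun a => -Real.sqrt (N a * L a)) hab
    simpa [hs, hπ] using this
  · intro i a hi
    simp [hU, hi]

end SingularValues

/-! ## Block tensors -/

section BlockTensors

open Matrix

/-- A set of positions in an `r₁ × r₂ × r₃` array such that every slice contains a position and
any two coordinates of a position determine the third. -/
structure IsTransversal {r₁ r₂ r₃ : ℕ} (T : Finset (Fin r₁ × Fin r₂ × Fin r₃)) : Prop where
  inj1 : ∀ {a a' b c}, (a, b, c) ∈ T → (a', b, c) ∈ T → a = a'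
  inj2 : ∀ {a b b' c}, (a, b, c) ∈ T → (a, b', c) ∈ T → b = b'
  inj3 : ∀ {a b c c'}, (a, b, c) ∈ T → (a, b, c') ∈ T → c = c'
  surj1 : ∀ a, ∃ b c, (a, b, c) ∈ T
  surj2 : ∀ b, ∃ a c, (a, b, c) ∈ T
  surj3 : ∀ c, ∃ a b, (a, b, c) ∈ T

/-- The points `(i % s, i % t)` with `i < max s t` cover both coordinates. There are at most `r` of
them, and they extend to exactly `r` points because `r ≤ s * t`. -/
theorem exists_equiv_cover {r s t : ℕ} (hs : 1 ≤ s) (ht : 1 ≤ t) (hsr : s ≤ r) (htr : t ≤ r)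
    (hr : r ≤ s * t) : ∃ f : Fin r → Fin s × Fin t, Function.Injective f ∧
      (∀ b, ∃ a, (f a).1 = b) ∧ ∀ c, ∃ a, (f a).2 = c := by
  classical
  let g : ℕ → Fin s × Fin t := fun i => (⟨i % s, Nat.mod_lt _ hs⟩, ⟨i % t, Nat.mod_lt _ ht⟩)
  set D : Finset (Fin s × Fin t) := (Finset.range (max s t)).image g with hD
  have hDr : D.card ≤ r := Finset.card_image_le.trans (by simp; omega)
  obtain ⟨E, hDE, -, hE⟩ := Finset.exists_subsuperset_card_eq (Finset.subset_univ D) hDr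
    (by simpa using hr)
  refine ⟨fun a => (E.equivFinOfCardEq hE).symm a, ?_, ?_, ?_⟩
  · exact Subtype.val_injective.comp (Equiv.injective _)
  · intro b
    have : g b ∈ E := hDE (Finset.mem_image_of_mem g (Finset.mem_range.mpr (by omega)))
    exact ⟨E.equivFinOfCardEq hE ⟨g b, this⟩, by
      simp only [Equiv.symm_apply_apply]; ext; simp [g, Nat.mod_eq_of_lt b.2]⟩
  · intro c
    have : g c ∈ E := hDE (Finset.mem_image_of_mem g (Finset.mem_range.mpr (by omega)))
    exact ⟨E.equivFinOfCardEq hE ⟨g c, this⟩, by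
      simp only [Equiv.symm_apply_apply]; ext; simp [g, Nat.mod_eq_of_lt c.2]⟩

/-- The largest rank is embedded in the product of the other two so that both coordinates are
covered; `T` is the graph of the embedding. -/
theorem exists_isTransversal {r₁ r₂ r₃ : ℕ} (h₁ : 1 ≤ r₁) (h₂ : 1 ≤ r₂) (h₃ : 1 ≤ r₃)
    (h₁' : r₁ ≤ r₂ * r₃) (h₂' : r₂ ≤ r₃ * r₁) (h₃' : r₃ ≤ r₁ * r₂) :
    ∃ T : Finset (Fin r₁ × Fin r₂ × Fin r₃), IsTransversal T := by
  classical
  rcases le_total r₂ r₁ with h21 | h12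
  · rcases le_total r₃ r₁ with h31 | h13
    · obtain ⟨f, hf, hs, ht⟩ := exists_equiv_cover h₂ h₃ h21 h31 h₁'
      refine ⟨Finset.univ.filter fun e => f e.1 = (e.2.1, e.2.2), ?_⟩
      constructor <;> simp only [Finset.mem_filter, Finset.mem_univ, true_and]
      · intro a a' b c h h'; exact hf (h.trans h'.symm)
      · intro a b b' c h h'; rw [h] at h'; exact congrArg Prod.fst h'
      · intro a b c c' h h'; rw [h] at h'; exact congrArg Prod.snd h'
      · intro a; exact ⟨_, _, rfl⟩
      · intro b; obtain ⟨a, rfl⟩ := hs b; exact ⟨a, _, rfl⟩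
      · intro c; obtain ⟨a, rfl⟩ := ht c; exact ⟨a, _, rfl⟩
    · obtain ⟨f, hf, hs, ht⟩ := exists_equiv_cover h₁ h₂ h13 (h21.trans h13) h₃'
      refine ⟨Finset.univ.filter fun e => f e.2.2 = (e.1, e.2.1), ?_⟩
      constructor <;> simp only [Finset.mem_filter, Finset.mem_univ, true_and]
      · intro a a' b c h h'; rw [h] at h'; exact congrArg Prod.fst h'
      · intro a b b' c h h'; rw [h] at h'; exact congrArg Prod.snd h'
      · intro a b c c' h h'; exact hf (h.trans h'.symm)
      · intro a; obtain ⟨c, rfl⟩ := hs a; exact ⟨_, c, rfl⟩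
      · intro b; obtain ⟨c, rfl⟩ := ht b; exact ⟨_, c, rfl⟩
      · intro c; exact ⟨_, _, rfl⟩
  · rcases le_total r₃ r₂ with h32 | h23
    · obtain ⟨f, hf, hs, ht⟩ := exists_equiv_cover h₃ h₁ h32 h12 h₂'
      refine ⟨Finset.univ.filter fun e => f e.2.1 = (e.2.2, e.1), ?_⟩
      constructor <;> simp only [Finset.mem_filter, Finset.mem_univ, true_and]
      · intro a a' b c h h'; rw [h] at h'; exact congrArg Prod.snd h'
      · intro a b b' c h h'; exact hf (h.trans h'.symm)
      · intro a b c c' h h'; rw [h] at h'; exact congrArg Prod.fst h'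
      · intro a; obtain ⟨b, rfl⟩ := ht a; exact ⟨b, _, rfl⟩
      · intro b; exact ⟨_, _, rfl⟩
      · intro c; obtain ⟨b, rfl⟩ := hs c; exact ⟨_, b, rfl⟩
    · obtain ⟨f, hf, hs, ht⟩ := exists_equiv_cover h₁ h₂ (h12.trans h23) h23 h₃'
      refine ⟨Finset.univ.filter fun e => f e.2.2 = (e.1, e.2.1), ?_⟩
      constructor <;> simp only [Finset.mem_filter, Finset.mem_univ, true_and]
      · intro a a' b c h h'; rw [h] at h'; exact congrArg Prod.fst h'
      · intro a b b' c h h'; rw [h] at h'; exact congrArg Prod.snd h'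
      · intro a b c c' h h'; exact hf (h.trans h'.symm)
      · intro a; obtain ⟨c, rfl⟩ := hs a; exact ⟨_, c, rfl⟩
      · intro b; obtain ⟨c, rfl⟩ := ht b; exact ⟨_, c, rfl⟩
      · intro c; exact ⟨_, _, rfl⟩

/-- Signals of the class all of whose singular vectors are supported on the indices of side `s`. -/
structure Planted {a b c : ℕ} (r₁ r₂ r₃ : ℕ) (lam : ℝ) (s₁ : Fin a → Bool) (s₂ : Fin b → Bool)
    (s₃ : Fin c → Bool) (s : Bool) (X : Tensor a b c) : Prop where
  mem : X ∈ lowRankClass a b c r₁ r₂ r₃ lam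
  supp : ∀ e, s₁ e.1 ≠ s → X e = 0
  svd1 : ∃ U : Matrix (Fin a) (Fin r₁) ℝ, IsLeftSingular U (unfold1 X) ∧
    ∀ i j, s₁ i ≠ s → U i j = 0
  svd2 : ∃ U : Matrix (Fin b) (Fin r₂) ℝ, IsLeftSingular U (unfold2 X) ∧
    ∀ i j, s₂ i ≠ s → U i j = 0
  svd3 : ∃ U : Matrix (Fin c) (Fin r₃) ℝ, IsLeftSingular U (unfold3 X) ∧
    ∀ i j, s₃ i ≠ s → U i j = 0

/-- The tensor `θ (x ⊗ y ⊗ z)` restricted to the blocks in `T`. -/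
def blockTensor {a b c r₁ r₂ r₃ : ℕ} (T : Finset (Fin r₁ × Fin r₂ × Fin r₃)) (α : Fin a → Fin r₁)
    (β : Fin b → Fin r₂) (γ : Fin c → Fin r₃) (θ : ℝ) (x : Fin a → ℝ) (y : Fin b → ℝ)
    (z : Fin c → ℝ) : Tensor a b c :=
  fun e => θ * (if (α e.1, β e.2.1, γ e.2.2) ∈ T then x e.1 * y e.2.1 * z e.2.2 else 0)

/-- A single admissible pair of labels already contributes the product of two block energies. -/
theorem block_energy_le {J K R S : Type} [Fintype J] [Fintype K] [DecidableEq R] [DecidableEq S]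
    (P : R → S → Prop) [∀ b c, Decidable (P b c)] (β : J → R) (γ : K → S) (y : J → ℝ) (z : K → ℝ)
    {n₂ n₃ : ℝ} (h₂ : 0 ≤ n₂) (h₃ : 0 ≤ n₃)
    (hy : ∀ b, n₂ ≤ ∑ j, if β j = b then y j ^ 2 else 0)
    (hz : ∀ c, n₃ ≤ ∑ k, if γ k = c then z k ^ 2 else 0) {b : R} {c : S} (hbc : P b c) :
    n₂ * n₃ ≤ ∑ j, ∑ k, (if P (β j) (γ k) then y j * z k else 0) ^ 2 := by
  calc n₂ * n₃ ≤ (∑ j, if β j = b then y j ^ 2 else 0) * ∑ k, if γ k = c then z k ^ 2 else 0 :=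
        mul_le_mul (hy b) (hz c) h₃ (h₂.trans (hy b))
    _ = ∑ j, ∑ k, (if β j = b then y j ^ 2 else 0) * (if γ k = c then z k ^ 2 else 0) :=
        Finset.sum_mul_sum _ _ _ _
    _ ≤ _ := by
        refine Finset.sum_le_sum fun j _ => Finset.sum_le_sum fun k _ => ?_
        split_ifs with h1 h2 h3 h3
        · rw [mul_pow]
        · exact absurd (h1 ▸ h2 ▸ hbc) h3
        all_goals simp <;> positivity

/-- In each unfolding a row is its weight times a vector that depends only on its label. Vectors of
two labels have disjoint supports because two coordinates of a triple in `T` determine the third,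
and each has enough energy because every slice of `T` is nonempty. -/
theorem planted_blockTensor {a b c r₁ r₂ r₃ : ℕ} (hr₁ : 1 ≤ r₁) (hr₂ : 1 ≤ r₂) (hr₃ : 1 ≤ r₃)
    {T : Finset (Fin r₁ × Fin r₂ × Fin r₃)} (hT : IsTransversal T) (α : Fin a → Fin r₁)
    (β : Fin b → Fin r₂) (γ : Fin c → Fin r₃) (θ : ℝ) (x : Fin a → ℝ) (y : Fin b → ℝ)
    (z : Fin c → ℝ) {lam n₁ n₂ n₃ : ℝ} (hlam : 0 < lam) (h₁ : 0 ≤ n₁) (h₂ : 0 ≤ n₂) (h₃ : 0 ≤ n₃)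
    (hx : ∀ t, n₁ ≤ ∑ i, if α i = t then x i ^ 2 else 0)
    (hy : ∀ t, n₂ ≤ ∑ i, if β i = t then y i ^ 2 else 0)
    (hz : ∀ t, n₃ ≤ ∑ i, if γ i = t then z i ^ 2 else 0)
    (hle : lam ^ 2 ≤ θ ^ 2 * (n₁ * n₂ * n₃)) (s₁ : Fin a → Bool) (s₂ : Fin b → Bool)
    (s₃ : Fin c → Bool) (s : Bool) (hs₁ : ∀ i, s₁ i ≠ s → x i = 0) (hs₂ : ∀ i, s₂ i ≠ s → y i = 0)
    (hs₃ : ∀ i, s₃ i ≠ s → z i = 0) :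
    Planted r₁ r₂ r₃ lam s₁ s₂ s₃ s (blockTensor T α β γ θ x y z) := by
  set X := blockTensor T α β γ θ x y z with hX
  have m1 := exists_svd_of_labels hr₁ (unfold1 X) α x
    (fun t e => θ * (if (t, β e.1, γ e.2) ∈ T then y e.1 * z e.2 else 0))
    (fun i e => by
      simp only [unfold1, hX, blockTensor, of_apply]; split_ifs <;> ring)
    (fun t t' htt' => Finset.sum_eq_zero fun e _ => by
      by_cases h : (t, β e.1, γ e.2) ∈ T
      · have : (t', β e.1, γ e.2) ∉ T := fun h' => htt' (hT.inj1 h h')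
        simp [this]
      · simp [h]) hlam
    (fun t => by
      obtain ⟨b', c', hT'⟩ := hT.surj1 t
      have h := block_energy_le (fun b c => (t, b, c) ∈ T) β γ y z h₂ h₃ hy hz hT'
      simp only [dotProduct, Fintype.sum_prod_type]
      calc lam ^ 2 ≤ n₁ * (θ ^ 2 * (n₂ * n₃)) := by linarith
        _ ≤ _ := by
          refine mul_le_mul (hx t) ?_ (by positivity) (h₁.trans (hx t))
          refine (mul_le_mul_of_nonneg_left h (sq_nonneg θ)).trans (le_of_eq ?_)
          simp only [Finset.mul_sum]
          refine Finset.sum_congr rfl fun j _ => Finset.sum_congr rfl fun k _ => by ring)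
  have m2 := exists_svd_of_labels hr₂ (unfold2 X) β y
    (fun t e => θ * (if (α e.2, t, γ e.1) ∈ T then z e.1 * x e.2 else 0))
    (fun i e => by
      simp only [unfold2, hX, blockTensor, of_apply]; split_ifs <;> ring)
    (fun t t' htt' => Finset.sum_eq_zero fun e _ => by
      by_cases h : (α e.2, t, γ e.1) ∈ T
      · have : (α e.2, t', γ e.1) ∉ T := fun h' => htt' (hT.inj2 h h')
        simp [this]
      · simp [h]) hlam
    (fun t => by
      obtain ⟨a', c', hT'⟩ := hT.surj2 t
      have h := block_energy_le (fun c a => (a, t, c) ∈ T) γ α z x h₃ h₁ hz hx hT'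
      simp only [dotProduct, Fintype.sum_prod_type]
      calc lam ^ 2 ≤ n₂ * (θ ^ 2 * (n₃ * n₁)) := by linarith
        _ ≤ _ := by
          refine mul_le_mul (hy t) ?_ (by positivity) (h₂.trans (hy t))
          refine (mul_le_mul_of_nonneg_left h (sq_nonneg θ)).trans (le_of_eq ?_)
          simp only [Finset.mul_sum]
          refine Finset.sum_congr rfl fun j _ => Finset.sum_congr rfl fun k _ => by ring)
  have m3 := exists_svd_of_labels hr₃ (unfold3 X) γ z
    (fun t e => θ * (if (α e.1, β e.2, t) ∈ T then x e.1 * y e.2 else 0))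
    (fun i e => by
      simp only [unfold3, hX, blockTensor, of_apply]; split_ifs <;> ring)
    (fun t t' htt' => Finset.sum_eq_zero fun e _ => by
      by_cases h : (α e.1, β e.2, t) ∈ T
      · have : (α e.1, β e.2, t') ∉ T := fun h' => htt' (hT.inj3 h h')
        simp [this]
      · simp [h]) hlam
    (fun t => by
      obtain ⟨a', b', hT'⟩ := hT.surj3 t
      have h := block_energy_le (fun a b => (a, b, t) ∈ T) α β x y h₁ h₂ hx hy hT'
      simp only [dotProduct, Fintype.sum_prod_type]
      calc lam ^ 2 ≤ n₃ * (θ ^ 2 * (n₁ * n₂)) := by linarith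
        _ ≤ _ := by
          refine mul_le_mul (hz t) ?_ (by positivity) (h₃.trans (hz t))
          refine (mul_le_mul_of_nonneg_left h (sq_nonneg θ)).trans (le_of_eq ?_)
          simp only [Finset.mul_sum]
          refine Finset.sum_congr rfl fun j _ => Finset.sum_congr rfl fun k _ => by ring)
  obtain ⟨k1, l1, U1, hU1, z1⟩ := m1
  obtain ⟨k2, l2, U2, hU2, z2⟩ := m2
  obtain ⟨k3, l3, U3, hU3, z3⟩ := m3
  exact ⟨⟨k1, k2, k3, l1, l2, l3⟩, fun e he => by simp [hX, blockTensor, hs₁ e.1 he],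
    ⟨U1, hU1, fun i j hi => z1 i j (hs₁ i hi)⟩, ⟨U2, hU2, fun i j hi => z2 i j (hs₂ i hi)⟩,
    ⟨U3, hU3, fun i j hi => z3 i j (hs₃ i hi)⟩⟩

theorem frobSq_pos_of_mem {a b c r₁ r₂ r₃ : ℕ} {lam : ℝ} (hlam : 0 < lam) {X : Tensor a b c}
    (hX : X ∈ lowRankClass a b c r₁ r₂ r₃ lam) : 0 < frobSq X := by
  refine (Finset.sum_nonneg fun i _ => sq_nonneg (X i)).lt_of_ne fun h0 => ?_
  have h1 : X = 0 := by
    funext i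
    have := (Finset.sum_eq_zero_iff_of_nonneg fun i _ => sq_nonneg (X i)).mp h0.symm i
      (Finset.mem_univ i)
    simpa using this
  have h2 : unfold1 X = 0 := by rw [h1]; rfl
  have h3 : 0 < singularValue (unfold1 X) r₁ := hlam.trans_le hX.2.2.2.1
  rw [h2, singularValue, LinearMap.singularValues_pos_iff_lt_finrank_range, map_zero,
    LinearMap.range_zero, finrank_bot] at h3
  omega

end BlockTensors

/-! ## Tests from estimators -/

section Decoding

open Matrix

/-- The sign test for the side of a planted signal errs on the value `D`. -/
def SignErr (s : Bool) (D : ℤ) : Prop := if s then D < 0 else 0 ≤ D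

/-- The weight of an index in the comparison of the two sides. -/
def sideWeight (s : Bool) : ℤ := if s then 1 else -1

theorem abs_sideWeight (s : Bool) : |sideWeight s| ≤ 1 := by cases s <;> simp [sideWeight]

/-- An error of the sign test means that the wrong side carries at least as much mass as the right
one. -/
theorem sum_side_le_of_signErr {J : Type} [Fintype J] (side : J → Bool) (s : Bool) (v : J → ℤ)
    (h : SignErr s (∑ j, sideWeight (side j) * v j)) :
    ∑ j, (if side j = s then v j else 0) ≤ ∑ j, if side j = s then 0 else v j := by
  rw [← sub_nonneg, ← Finset.sum_sub_distrib]
  cases s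
  · simp only [SignErr, Bool.false_eq_true, if_false] at h
    refine h.trans (le_of_eq (Finset.sum_congr rfl fun j _ => ?_))
    cases side j <;> simp [sideWeight]
  · simp only [SignErr, if_true] at h
    have h' : 0 ≤ ∑ j, -(sideWeight (side j) * v j) := by rw [Finset.sum_neg_distrib]; omega
    refine h'.trans (le_of_eq (Finset.sum_congr rfl fun j _ => ?_))
    cases side j <;> simp [sideWeight]

/-- One column of `B` suffices: it is a nonzero vector of the estimated subspace, and unlike the
orthonormal basis it has integer entries. An erring sign puts at least half of its mass where `U`
vanishes. -/
theorem half_le_sinTheta_sq_of_signErr {m r : ℕ} (hr : 1 ≤ r) {A U : Matrix (Fin m) (Fin r) ℝ}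
    (hA : Aᵀ * A = 1) (hU : Uᵀ * U = 1) (B : Fin m × Fin r → ℤ) (R : Matrix (Fin r) (Fin r) ℝ)
    (hAB : A = Matrix.of (fun i j => (B (i, j) : ℝ)) * R) (side : Fin m → Bool) (s : Bool)
    (hs : ∀ i j, side i ≠ s → U i j = 0)
    (h : SignErr s (∑ e : Fin m × Fin r,
      (if (e.2 : ℕ) = 0 then sideWeight (side e.1) else 0) * B e ^ 2)) :
    1 / 2 ≤ sinTheta A U ^ 2 := by
  classical
  set B' : Matrix (Fin m) (Fin r) ℝ := Matrix.of fun i j => (B (i, j) : ℝ) with hB'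
  set o : Fin r := ⟨0, hr⟩ with ho
  -- `Aᵀ * B' * R = Aᵀ * A = 1`, and one-sided inverses of square matrices are two-sided. Hence `B'`
  -- has the column space of `A` and no zero column.
  have hinv : R * (Aᵀ * B') = 1 := by
    rw [mul_eq_one_comm, Matrix.mul_assoc, ← hAB, hA]
  have hBA : A * (Aᵀ * B') = B' := by
    conv_lhs => rw [hAB, Matrix.mul_assoc B', ← hAB, hinv, Matrix.mul_one]
  set y : Fin r → ℝ := fun j => (Aᵀ * B') j o with hy
  have hcol : ∀ i, (A *ᵥ y) i = (B (i, o) : ℝ) := fun i => by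
    have := congrFun (congrFun hBA i) o
    rw [mul_apply] at this
    simpa [mulVec, dotProduct, hy, hB'] using this
  have hy0 : y ≠ 0 := fun h0 => by
    have := congrFun (congrFun hinv o) o
    rw [mul_apply, one_apply_eq] at this
    simp only [show ∀ j, (Aᵀ * B') j o = 0 from fun j => congrFun h0 j] at this
    simp at this
  have hpos : 0 < ∑ i, (A *ᵥ y) i ^ 2 := by
    have h1 : (A *ᵥ y) ⬝ᵥ (A *ᵥ y) = y ⬝ᵥ y := by
      rw [dotProduct_mulVec, vecMul_mulVec, ← dotProduct_mulVec, hA, one_mulVec]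
    have h2 : ∑ i, (A *ᵥ y) i ^ 2 = y ⬝ᵥ y := by rw [← h1]; simp [dotProduct, sq]
    rw [h2]
    exact lt_of_le_of_ne (by simpa using dotProduct_self_star_nonneg y)
      fun h => hy0 (dotProduct_self_eq_zero.mp h.symm)
  have hmass := mass_le_sinTheta_sq hr hA hU (fun i => side i = s) hs y
  have hsum : ∑ e : Fin m × Fin r, (if (e.2 : ℕ) = 0 then sideWeight (side e.1) else 0) * B e ^ 2
      = ∑ i, sideWeight (side i) * B (i, o) ^ 2 := by
    rw [Fintype.sum_prod_type]
    refine Finset.sum_congr rfl fun i _ => ?_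
    rw [Finset.sum_eq_single o]
    · simp [ho]
    · intro j _ hj
      have : (j : ℕ) ≠ 0 := fun h => hj (Fin.ext h)
      simp [this]
    · simp
  rw [hsum] at h
  have hle := sum_side_le_of_signErr side s _ h
  have hle' : ∑ i, (if side i = s then (A *ᵥ y) i ^ 2 else 0) ≤
      ∑ i, if side i = s then 0 else (A *ᵥ y) i ^ 2 := by
    simp only [hcol]
    exact_mod_cast hle
  have hsplit : ∑ i, (A *ᵥ y) i ^ 2 = (∑ i, (if side i = s then (A *ᵥ y) i ^ 2 else 0)) +
      ∑ i, if side i = s then 0 else (A *ᵥ y) i ^ 2 := by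
    rw [← Finset.sum_add_distrib]
    exact Finset.sum_congr rfl fun i _ => by split_ifs <;> simp
  nlinarith

/-- The factor `η ^ 2` scales both masses alike, so the test need not know `η`. -/
theorem half_le_relative_error_of_signErr {a b c : ℕ} (X : Tensor a b c) (hX : 0 < frobSq X)
    (B : Idx a b c → ℤ) (η : ℝ) (side : Fin a → Bool) (s : Bool)
    (hs : ∀ e, side e.1 ≠ s → X e = 0)
    (h : SignErr s (∑ e : Idx a b c, sideWeight (side e.1) * B e ^ 2)) :
    1 / 2 ≤ frobSq ((fun e => η * (B e : ℝ)) - X) / frobSq X := by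
  rw [le_div_iff₀ hX]
  have hle := sum_side_le_of_signErr (fun e : Idx a b c => side e.1) s (fun e => B e ^ 2) h
  have hle' : ∑ e : Idx a b c, (if side e.1 = s then (B e : ℝ) ^ 2 else 0) ≤
      ∑ e : Idx a b c, if side e.1 = s then 0 else (B e : ℝ) ^ 2 := by exact_mod_cast hle
  have hle2 := mul_le_mul_of_nonneg_left hle' (sq_nonneg η)
  -- On side `s`, `(ηB - X)² + (ηB)² ≥ X² / 2`. Off it `X = 0`, so the error is exactly the
  -- subtracted mass.
  have h1 : 1 / 2 * frobSq X ≤ frobSq ((fun e => η * (B e : ℝ)) - X) +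
      η ^ 2 * ∑ e : Idx a b c, (if side e.1 = s then (B e : ℝ) ^ 2 else 0) -
      η ^ 2 * ∑ e : Idx a b c, (if side e.1 = s then 0 else (B e : ℝ) ^ 2) := by
    simp only [frobSq, Finset.mul_sum, ← Finset.sum_add_distrib, ← Finset.sum_sub_distrib]
    refine Finset.sum_le_sum fun e _ => ?_
    simp only [Pi.sub_apply]
    split_ifs with he
    · nlinarith [sq_nonneg (2 * (η * (B e : ℝ)) - X e)]
    · rw [hs e he]; nlinarith
  linarith

/-- Records take countably many values, so every event decided by them is measurable, whatever the
algorithm. -/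
theorem measurableSet_record {I : Type} [Fintype I] (δ : ℝ) (P : (I → ℤ) → Prop) :
    MeasurableSet {Y : I → ℝ | P (record δ Y)} := by
  have h : Measurable (record δ : (I → ℝ) → I → ℤ) :=
    measurable_pi_lambda _ fun i => Int.measurable_floor.comp
      (Measurable.div_const (measurable_pi_apply i : Measurable fun Y : I → ℝ => Y i) δ)
  exact h ((Set.to_countable {q | P q}).measurableSet)

/-- Markov's inequality with only the event measurable; the loss `f` may be arbitrary. -/
theorem measure_le_two_mul_lintegral {Ω : Type*} [MeasurableSpace Ω] (μ : Measure Ω) {E : Set Ω}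
    (hE : MeasurableSet E) (f : Ω → ℝ) (hf : ∀ ω ∈ E, 1 / 2 ≤ f ω) :
    μ E ≤ 2 * ∫⁻ ω, ENNReal.ofReal (f ω) ∂μ := by
  have h1 : (2 : ℝ≥0∞)⁻¹ * μ E ≤ ∫⁻ ω, ENNReal.ofReal (f ω) ∂μ := by
    rw [← lintegral_indicator_const hE]
    refine lintegral_mono fun ω => ?_
    by_cases hω : ω ∈ E
    · simp only [Set.indicator_of_mem hω]
      have := ENNReal.ofReal_le_ofReal (hf ω hω)
      rwa [one_div, ENNReal.ofReal_inv_of_pos two_pos, ENNReal.ofReal_ofNat] at this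
    · simp [Set.indicator_of_notMem hω]
  calc μ E = 2 * (2⁻¹ * μ E) := by
        rw [← mul_assoc, ENNReal.mul_inv_cancel two_ne_zero ENNReal.ofNat_ne_top, one_mul]
    _ ≤ _ := mul_le_mul_right h1 2

/-- The risk is a supremum over all choices of left singular vectors, so one choice supported on
side `s` is enough. -/
theorem signErr_le_subspaceRisk {a b c m r : ℕ} (hr : 1 ≤ r) {n : Type} [Fintype n]
    (F : Set (Tensor a b c)) (σ δ : ℝ) (unf : Tensor a b c → Matrix (Fin m) n ℝ)
    (Uhat : Tensor a b c → Matrix (Fin m) (Fin r) ℝ) (B : (Idx a b c → ℤ) → Fin m × Fin r → ℤ)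
    (hB : ∀ Y, (Uhat Y)ᵀ * Uhat Y = 1 ∧ ∃ R : Matrix (Fin r) (Fin r) ℝ,
      Uhat Y = Matrix.of (fun i j => (B (record δ Y) (i, j) : ℝ)) * R)
    (side : Fin m → Bool) (s : Bool) {X : Tensor a b c} (hX : X ∈ F)
    (hsvd : ∃ U : Matrix (Fin m) (Fin r) ℝ, IsLeftSingular U (unf X) ∧
      ∀ i j, side i ≠ s → U i j = 0) :
    noise a b c σ {Z | SignErr s (∑ e : Fin m × Fin r,
      (if (e.2 : ℕ) = 0 then sideWeight (side e.1) else 0) * B (record δ (X + Z)) e ^ 2)} ≤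
      2 * subspaceRisk F σ unf Uhat := by
  obtain ⟨U, hU, hs⟩ := hsvd
  have hmeas := (measurable_const_add X) (measurableSet_record δ fun q => SignErr s
    (∑ e : Fin m × Fin r, (if (e.2 : ℕ) = 0 then sideWeight (side e.1) else 0) * B q e ^ 2))
  refine (measure_le_two_mul_lintegral _ hmeas (fun Z => sinTheta (Uhat (X + Z)) U ^ 2)
    fun Z hZ => ?_).trans (mul_le_mul_right ?_ 2)
  · obtain ⟨hA, R, hR⟩ := hB (X + Z)
    exact half_le_sinTheta_sq_of_signErr hr hA hU.1 _ R hR side s hs hZ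
  · exact le_iSup₂_of_le X hX (le_iSup₂_of_le U hU le_rfl)

theorem signErr_le_tensorRisk {a b c : ℕ} (F : Set (Tensor a b c)) (σ δ η : ℝ)
    (Xhat : Tensor a b c → Tensor a b c) (B : (Idx a b c → ℤ) → Idx a b c → ℤ)
    (hB : ∀ Y i, Xhat Y i = η * (B (record δ Y) i : ℝ))
    (side : Fin a → Bool) (s : Bool) {X : Tensor a b c} (hX : X ∈ F) (hpos : 0 < frobSq X)
    (hs : ∀ e, side e.1 ≠ s → X e = 0) :
    noise a b c σ {Z | SignErr s (∑ e : Idx a b c,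
      sideWeight (side e.1) * B (record δ (X + Z)) e ^ 2)} ≤ 2 * tensorRisk F σ Xhat := by
  have hmeas := (measurable_const_add X) (measurableSet_record δ fun q => SignErr s
    (∑ e : Idx a b c, sideWeight (side e.1) * B q e ^ 2))
  refine (measure_le_two_mul_lintegral _ hmeas
    (fun Z => frobSq (Xhat (X + Z) - X) / frobSq X) fun Z hZ => ?_).trans (mul_le_mul_right ?_ 2)
  · have : Xhat (X + Z) = fun e => η * (B (record δ (X + Z)) e : ℝ) := funext (hB _)
    rw [this]
    exact half_le_relative_error_of_signErr X hpos _ η side s hs hZ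
  · exact le_iSup₂_of_le X hX le_rfl

end Decoding

/-! ## Gaussian measures -/

section Gaussian

open scoped NNReal

variable {I : Type} [Fintype I]

/-! ### Likelihood ratios and the second moment method -/

theorem map_noise_add {a b c : ℕ} (σ : ℝ) (X : Tensor a b c) :
    (noise a b c σ).map (fun Z => X + Z) =
      Measure.pi fun e => gaussianReal (X e) (Real.toNNReal (σ ^ 2)) := by
  have h := Measure.pi_map_pi (μ := fun _ : Idx a b c => gaussianReal 0 (Real.toNNReal (σ ^ 2)))
    (f := fun e y => X e + y) (fun e => (measurable_const_add (X e)).aemeasurable)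
  simp only [gaussianReal_map_const_add, zero_add] at h
  exact h

/-- Likelihood ratio of `N(m, v)` to `N(0, v)`. -/
def gaussianLR (v : ℝ≥0) (m y : ℝ) : ℝ := Real.exp ((m * y - m ^ 2 / 2) / v)

theorem measurable_gaussianLR (v : ℝ≥0) (m : ℝ) : Measurable (gaussianLR v m) := by
  unfold gaussianLR; fun_prop

theorem gaussianReal_eq_withDensity {v : ℝ≥0} (hv : v ≠ 0) (m : ℝ) :
    gaussianReal m v =
      (gaussianReal 0 v).withDensity fun y => ENNReal.ofReal (gaussianLR v m y) := by
  rw [gaussianReal_of_var_ne_zero _ hv, gaussianReal_of_var_ne_zero _ hv,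
    ← withDensity_mul _ (measurable_gaussianPDF 0 v) (measurable_gaussianLR v m).ennreal_ofReal]
  congr 1
  funext y
  rw [Pi.mul_apply, gaussianPDF, gaussianPDF, ← ENNReal.ofReal_mul (gaussianPDFReal_nonneg _ _ _)]
  congr 1
  rw [gaussianPDFReal, gaussianPDFReal, gaussianLR,
    mul_assoc (Real.sqrt (2 * Real.pi * v))⁻¹, ← Real.exp_add]
  congr 2
  have : (v : ℝ) ≠ 0 := by exact_mod_cast hv
  field_simp
  ring

theorem integrable_gaussianLR_mul {v : ℝ≥0} (m m' : ℝ) :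
    Integrable (fun y => gaussianLR v m y * gaussianLR v m' y) (gaussianReal 0 v) := by
  have h := (integrable_exp_mul_gaussianReal (μ := 0) (v := v) ((m + m') / v)).mul_const
    (Real.exp (-(m ^ 2 + m' ^ 2) / (2 * v)))
  refine h.congr (Eventually.of_forall fun y => ?_)
  simp only [gaussianLR, ← Real.exp_add]
  congr 1
  ring

/-- The formula behind the chi-square computations: the correlation of two likelihood ratios under
the noise is the exponential of the normalised inner product of the means. -/
theorem integral_gaussianLR_mul {v : ℝ≥0} (hv : v ≠ 0) (m m' : ℝ) :
    ∫ y, gaussianLR v m y * gaussianLR v m' y ∂gaussianReal 0 v = Real.exp (m * m' / v) := by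
  have hv' : (v : ℝ) ≠ 0 := by exact_mod_cast hv
  have h1 : ∀ y, gaussianLR v m y * gaussianLR v m' y =
      Real.exp ((m + m') / v * y) * Real.exp (-(m ^ 2 + m' ^ 2) / (2 * v)) := fun y => by
    simp only [gaussianLR, ← Real.exp_add]
    congr 1
    field_simp
    ring
  have h2 : ∫ y, Real.exp ((m + m') / v * y) ∂gaussianReal 0 v =
      Real.exp (v * ((m + m') / v) ^ 2 / 2) := by
    have := congrFun (mgf_id_gaussianReal (μ := 0) (v := v)) ((m + m') / v)
    simpa [mgf] using this
  simp_rw [h1]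
  rw [integral_mul_const, h2, ← Real.exp_add]
  congr 1
  field_simp
  ring

theorem integrable_gaussianLR {v : ℝ≥0} (m : ℝ) :
    Integrable (gaussianLR v m) (gaussianReal 0 v) := by
  exact (integrable_gaussianLR_mul (v := v) m 0).congr
    (Eventually.of_forall fun y => by simp [gaussianLR])

theorem pi_gaussianReal_real_apply {v : ℝ≥0} (hv : v ≠ 0) (X : I → ℝ) {E : Set (I → ℝ)}
    (hE : MeasurableSet E) :
    (Measure.pi fun e => gaussianReal (X e) v).real E =
      ∫ y in E, ∏ e, gaussianLR v (X e) (y e) ∂Measure.pi fun _ : I => gaussianReal 0 v := by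
  set P := Measure.pi fun _ : I => gaussianReal 0 v with hP
  have hpos : ∀ m y, 0 ≤ gaussianLR v m y := fun m y => (Real.exp_pos _).le
  have hint : Integrable (fun y : I → ℝ => ∏ e, gaussianLR v (X e) (y e)) P :=
    Integrable.fintype_prod_dep fun e => integrable_gaussianLR (X e)
  have h1 : (Measure.pi fun e => gaussianReal (X e) v) =
      P.withDensity fun y => ENNReal.ofReal (∏ e, gaussianLR v (X e) (y e)) := by
    symm
    refine (Measure.pi_eq fun s hs => ?_).symm
    rw [withDensity_apply _ (MeasurableSet.univ_pi hs),
      ← ofReal_integral_eq_lintegral_ofReal hint.integrableOn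
        (Eventually.of_forall fun y => Finset.prod_nonneg fun e _ => hpos _ _),
      ← integral_indicator (MeasurableSet.univ_pi hs)]
    have h2 : ∀ y : I → ℝ, (Set.univ.pi s).indicator
        (fun y => ∏ e, gaussianLR v (X e) (y e)) y =
        ∏ e, (s e).indicator (gaussianLR v (X e)) (y e) := fun y => by
      by_cases hy : y ∈ Set.univ.pi s
      · rw [Set.indicator_of_mem hy]
        exact Finset.prod_congr rfl fun e _ => (Set.indicator_of_mem (hy e trivial) _).symm
      · rw [Set.indicator_of_notMem hy]
        simp only [Set.mem_univ_pi, not_forall] at hy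
        obtain ⟨e, he⟩ := hy
        exact (Finset.prod_eq_zero (Finset.mem_univ e) (Set.indicator_of_notMem he _)).symm
    simp_rw [h2]
    rw [hP, integral_fintype_prod_eq_prod (fun e y => (s e).indicator (gaussianLR v (X e)) y),
      ENNReal.ofReal_prod_of_nonneg fun e _ => integral_nonneg fun y =>
        Set.indicator_nonneg (fun y _ => hpos _ y) y]
    refine Finset.prod_congr rfl fun e _ => ?_
    rw [integral_indicator (hs e), gaussianReal_eq_withDensity hv (X e),
      withDensity_apply _ (hs e),
      ofReal_integral_eq_lintegral_ofReal (integrable_gaussianLR (X e)).integrableOn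
        (Eventually.of_forall fun y => hpos _ _)]
  rw [Measure.real, h1, withDensity_apply _ hE,
    ← ofReal_integral_eq_lintegral_ofReal hint.integrableOn
        (Eventually.of_forall fun y => Finset.prod_nonneg fun e _ => hpos _ _),
    ENNReal.toReal_ofReal (integral_nonneg fun y => Finset.prod_nonneg fun e _ => hpos _ _)]

/-- Second moment bound: a Gaussian mixture of small chi-square divergence from the noise is hard to
tell from the noise. -/
theorem noise_le_mixture {S : Type} [Fintype S] [Nonempty S] {v : ℝ≥0} (hv : v ≠ 0)
    (X : S → I → ℝ) {χ : ℝ}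
    (hχ : ∑ i, ∑ j, Real.exp (∑ e, X i e * X j e / v) ≤ (1 + χ) * (Fintype.card S : ℝ) ^ 2)
    {E : Set (I → ℝ)} (hE : MeasurableSet E) {ε : ℝ}
    (hQ : ∀ i, (Measure.pi fun e => gaussianReal (X i e) v).real E ≤ ε) :
    (Measure.pi fun _ : I => gaussianReal 0 v).real E ≤ ε + 1 / 16 + 4 * χ := by
  set P := Measure.pi fun _ : I => gaussianReal 0 v with hP
  set n : ℝ := (Fintype.card S : ℝ) with hn
  have hn0 : 0 < n := by rw [hn]; exact_mod_cast Fintype.card_pos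
  set L : S → (I → ℝ) → ℝ := fun i y => ∏ e, gaussianLR v (X i e) (y e) with hL
  have hLint : ∀ i, Integrable (L i) P := fun i =>
    Integrable.fintype_prod_dep fun e => integrable_gaussianLR (X i e)
  have hLL : ∀ i j, Integrable (fun y => L i y * L j y) P := fun i j => by
    simp only [hL, ← Finset.prod_mul_distrib]
    exact Integrable.fintype_prod_dep fun e => integrable_gaussianLR_mul (X i e) (X j e)
  have hLLv : ∀ i j, ∫ y, L i y * L j y ∂P = Real.exp (∑ e, X i e * X j e / v) := fun i j => by
    simp only [hL, ← Finset.prod_mul_distrib]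
    rw [hP, integral_fintype_prod_eq_prod
      (fun e y => gaussianLR v (X i e) y * gaussianLR v (X j e) y), Real.exp_sum]
    exact Finset.prod_congr rfl fun e _ => integral_gaussianLR_mul hv _ _
  have hL1 : ∀ i, ∫ y, L i y ∂P = 1 := fun i => by
    have := pi_gaussianReal_real_apply hv (X i) MeasurableSet.univ
    rw [setIntegral_univ] at this
    rw [← hP] at this
    rw [hL, ← this]; simp
  set A : (I → ℝ) → ℝ := fun y => (∑ i, L i y) / n with hA
  have hAint : Integrable A P := (integrable_finsetSum _ fun i _ => hLint i).div_const n
  have hAA : ∀ y, A y ^ 2 = (∑ i, ∑ j, L i y * L j y) / n ^ 2 := fun y => by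
    rw [hA]; simp only; rw [div_pow, sq, Finset.sum_mul_sum]
  have hAAint : Integrable (fun y => A y ^ 2) P := by
    simp_rw [hAA]
    exact (integrable_finsetSum _ fun i _ => integrable_finsetSum _ fun j _ =>
      hLL i j).div_const _
  have hA1 : ∫ y, A y ∂P = 1 := by
    rw [hA, integral_div, integral_finsetSum _ fun i _ => hLint i]
    simp only [hL1, Finset.sum_const, Finset.card_univ, nsmul_eq_mul, mul_one]
    exact div_self hn0.ne'
  have hA2 : ∫ y, A y ^ 2 ∂P ≤ 1 + χ := by
    simp_rw [hAA]
    rw [integral_div, integral_finsetSum _ fun i _ => integrable_finsetSum _ fun j _ => hLL i j]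
    simp_rw [integral_finsetSum _ fun j _ => hLL _ j, hLLv]
    rw [div_le_iff₀ (by positivity)]
    exact hχ
  have hsq : Integrable (fun y => (A y - 1) ^ 2) P := by
    have : (fun y => (A y - 1) ^ 2) = fun y => A y ^ 2 - 2 * A y + 1 := by funext y; ring
    rw [this]
    exact (hAAint.sub (hAint.const_mul 2)).add (integrable_const 1)
  have hvar : ∫ y, (A y - 1) ^ 2 ∂P ≤ χ := by
    have : (fun y => (A y - 1) ^ 2) = fun y => A y ^ 2 - 2 * A y + 1 := by funext y; ring
    have hd : Integrable (fun y => A y ^ 2 - 2 * A y) P := hAAint.sub (hAint.const_mul 2)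
    rw [this, integral_add hd (integrable_const 1), integral_sub hAAint (hAint.const_mul 2), integral_const_mul, hA1]
    simp only [integral_const, probReal_univ, smul_eq_mul, mul_one]
    linarith
  have hEA : ∫ y in E, A y ∂P ≤ ε := by
    rw [hA, integral_div, integral_finsetSum _ fun i _ => (hLint i).integrableOn,
      div_le_iff₀ hn0]
    calc _ ≤ ∑ _i : S, ε := Finset.sum_le_sum fun i _ => by
          rw [← pi_gaussianReal_real_apply hv (X i) hE]; exact hQ i
      _ = ε * n := by simp [hn, mul_comm]
  -- Pointwise `1 ≤ A + 1/16 + 4 (A - 1)²`, because `4u² + u + 1/16 = (2u + 1/4)²`. This replaces a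
  -- Cauchy-Schwarz bound on the total variation.
  have hfin : P.real E ≤ ∫ y in E, A y ∂P + ∫ y in E, (1 / 16 + 4 * (A y - 1) ^ 2) ∂P := by
    have h1 : P.real E = ∫ _ in E, (1 : ℝ) ∂P := by simp
    have h3 : Integrable (fun y => 1 / 16 + 4 * (A y - 1) ^ 2) P :=
      (integrable_const _).add (hsq.const_mul 4)
    rw [h1, ← integral_add hAint.integrableOn h3.integrableOn]
    refine setIntegral_mono (integrable_const _).integrableOn (hAint.add h3).integrableOn
      fun y => ?_
    simp only
    nlinarith [sq_nonneg (2 * (A y - 1) + 1 / 4)]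
  have h4 : ∫ y in E, (1 / 16 + 4 * (A y - 1) ^ 2) ∂P ≤ 1 / 16 + 4 * χ := by
    have h3 : Integrable (fun y => 1 / 16 + 4 * (A y - 1) ^ 2) P :=
      (integrable_const _).add (hsq.const_mul 4)
    calc _ ≤ ∫ y, (1 / 16 + 4 * (A y - 1) ^ 2) ∂P :=
          setIntegral_le_integral h3 (Eventually.of_forall fun y => by positivity)
      _ = 1 / 16 + 4 * ∫ y, (A y - 1) ^ 2 ∂P := by
          rw [integral_add (integrable_const _) (hsq.const_mul 4), integral_const_mul]; simp
      _ ≤ _ := by linarith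
  linarith

/-- The sign `±1` of a Boolean. -/
def boolSign (b : Bool) : ℝ := if b then 1 else -1

@[simp] theorem boolSign_mul_self (b : Bool) : boolSign b * boolSign b = 1 := by
  cases b <;> simp [boolSign]

/-- One sign per fibre of `π`. The sum over `ε'` factorises over the fibres into `2 cosh (w j) ≤ 2
exp (w j ^ 2 / 2)`, with `w j` the normalised energy of the fibre, so only squares of these energies
enter. -/
theorem sum_exp_signs_le {J : Type} [Fintype J] [DecidableEq J] (g : I → ℝ) (π : I → J) (v : ℝ≥0)
    {C : ℝ} (hC : ∑ j, (∑ e, if π e = j then g e ^ 2 / v else 0) ^ 2 / 2 ≤ C) :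
    ∑ ε : J → Bool, ∑ ε' : J → Bool, Real.exp (∑ e, (g e * boolSign (ε (π e))) *
      (g e * boolSign (ε' (π e))) / v) ≤ Real.exp C * (Fintype.card (J → Bool) : ℝ) ^ 2 := by
  set w : J → ℝ := fun j => ∑ e, if π e = j then g e ^ 2 / v else 0 with hw
  have h1 : ∀ ε ε' : J → Bool, ∑ e, (g e * boolSign (ε (π e))) * (g e * boolSign (ε' (π e))) / v =
      ∑ j, w j * (boolSign (ε j) * boolSign (ε' j)) := fun ε ε' => by
    simp only [hw, Finset.sum_mul]
    rw [Finset.sum_comm]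
    refine Finset.sum_congr rfl fun e _ => ?_
    simp only [ite_mul, zero_mul]
    rw [Finset.sum_ite_eq, if_pos (Finset.mem_univ _)]
    ring
  have h2 : ∀ ε : J → Bool, ∑ ε' : J → Bool, Real.exp (∑ j, w j * (boolSign (ε j) *
      boolSign (ε' j))) ≤ Real.exp C * (Fintype.card (J → Bool) : ℝ) := fun ε => by
    simp only [Real.exp_sum]
    rw [← Fintype.prod_sum (fun j b => Real.exp (w j * (boolSign (ε j) * boolSign b)))]
    have h3 : ∀ j, ∑ b, Real.exp (w j * (boolSign (ε j) * boolSign b)) = 2 * Real.cosh (w j) :=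
      fun j => by
        rw [Fintype.sum_bool, Real.cosh_eq]
        cases ε j <;> simp [boolSign] <;> ring
    simp only [h3]
    rw [Finset.prod_mul_distrib, Finset.prod_const, Finset.card_univ, mul_comm]
    have h4 : ((Fintype.card (J → Bool) : ℕ) : ℝ) = 2 ^ Fintype.card J := by
      simp
    rw [h4]
    refine mul_le_mul_of_nonneg_right ?_ (by positivity)
    calc ∏ j, Real.cosh (w j) ≤ ∏ j, Real.exp (w j ^ 2 / 2) :=
          Finset.prod_le_prod (fun j _ => (Real.cosh_pos _).le)
            fun j _ => Real.cosh_le_exp_half_sq (w j)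
      _ = Real.exp (∑ j, w j ^ 2 / 2) := (Real.exp_sum _ _).symm
      _ ≤ _ := Real.exp_le_exp.mpr hC
  simp only [h1]
  calc _ ≤ ∑ _ε : J → Bool, Real.exp C * (Fintype.card (J → Bool) : ℝ) :=
        Finset.sum_le_sum fun ε _ => h2 ε
    _ = _ := by simp; ring

/-! ### Channels from fair bits to Gaussian data -/

theorem gaussianReal_tail_le {v : ℝ≥0} (hv : v ≠ 0) {m T : ℝ} (hT : m ≤ T) :
    (gaussianReal m v).real (Set.Ioi T) ≤ Real.exp (-(T - m) ^ 2 / (2 * v)) := by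
  have hv' : (0 : ℝ) < v := by positivity
  have h := measure_ge_le_exp_mul_mgf (μ := gaussianReal m v) (X := id) T (t := (T - m) / v)
    (div_nonneg (by linarith) hv'.le) (integrable_exp_mul_gaussianReal _)
  rw [mgf_id_gaussianReal, ← Real.exp_add] at h
  refine (measureReal_mono (show Set.Ioi T ⊆ {ω | T ≤ id ω} from Set.Ioi_subset_Ici_self)).trans
    (h.trans (le_of_eq ?_))
  congr 1
  field_simp
  ring

/-- Two laws whose equal mixture is the noise, the second of which is a truncation of a shifted
noise. -/
theorem exists_channel {σ μ : ℝ} (hσ : 0 < σ) (hμ : 0 < μ) (hμ' : μ ≤ 1 / 2)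
    (hq : Real.exp (-1 / (32 * μ ^ 2)) ≤ 1 / 8) :
    ∃ (K : Bool → Measure ℝ) (T q : ℝ), (∀ b, IsProbabilityMeasure (K b)) ∧
      K false + K true = (2 : ℝ≥0∞) • gaussianReal 0 (Real.toNNReal (σ ^ 2)) ∧
      K true = ENNReal.ofReal (1 - q)⁻¹ •
        (gaussianReal (μ * σ) (Real.toNNReal (σ ^ 2))).restrict (Set.Iic T) ∧
      0 ≤ q ∧ q ≤ Real.exp (-1 / (32 * μ ^ 2)) := by
  set v := Real.toNNReal (σ ^ 2) with hv
  have hvR : (v : ℝ) = σ ^ 2 := Real.coe_toNNReal _ (by positivity)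
  have hv0 : v ≠ 0 := by
    intro h
    rw [h] at hvR
    have : σ ^ 2 ≠ 0 := by positivity
    exact this (by simpa using hvR.symm)
  -- Below this threshold the likelihood ratio of `N(μσ, σ²)` to the noise is at most `exp (1/2)`,
  -- while the mass beyond it is at most `exp (-1 / (32 μ²))`.
  set T := σ / (2 * μ) with hT
  set G := gaussianReal (μ * σ) v with hG
  set q := G.real (Set.Ioi T) with hqdef
  have hTm : σ / (4 * μ) ≤ T - μ * σ := by
    rw [hT, div_le_iff₀ (by positivity)]
    have : (σ / (2 * μ) - μ * σ) * (4 * μ) = 2 * σ - 4 * μ ^ 2 * σ := by field_simp; ring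
    rw [this]
    nlinarith [mul_pos hσ hμ]
  have hT0 : 0 < σ / (4 * μ) := by positivity
  have hqle : q ≤ Real.exp (-1 / (32 * μ ^ 2)) := by
    refine (gaussianReal_tail_le hv0 (by linarith)).trans (Real.exp_le_exp.mpr ?_)
    rw [hvR, neg_div, neg_div, neg_le_neg_iff, le_div_iff₀ (by positivity)]
    calc 1 / (32 * μ ^ 2) * (2 * σ ^ 2) = (σ / (4 * μ)) ^ 2 := by field_simp; norm_num
      _ ≤ _ := pow_le_pow_left₀ hT0.le hTm 2
  have hq8 : q ≤ 1 / 8 := hqle.trans hq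
  have hq0 : 0 ≤ q := measureReal_nonneg
  set K1 := ENNReal.ofReal (1 - q)⁻¹ • G.restrict (Set.Iic T) with hK1
  have hIic : G (Set.Iic T) = ENNReal.ofReal (1 - q) := by
    rw [← ofReal_measureReal]
    congr 1
    have := probReal_compl_eq_one_sub (μ := G) (s := Set.Ioi T) measurableSet_Ioi
    rwa [Set.compl_Ioi] at this
  have hK1p : IsProbabilityMeasure K1 := ⟨by
    rw [hK1, Measure.smul_apply, Measure.restrict_apply MeasurableSet.univ, Set.univ_inter, hIic,
      smul_eq_mul, ← ENNReal.ofReal_mul (inv_nonneg.mpr (by linarith)),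
      inv_mul_cancel₀ (by linarith), ENNReal.ofReal_one]⟩
  -- `exp (1/2) ≤ 7/4` and the normalisation is at most `8/7`, with product 2. Hence twice the noise
  -- minus `K1` is a positive measure, of total mass 1; it serves as the law for `false`.
  have hle : K1 ≤ (2 : ℝ≥0∞) • gaussianReal 0 v := by
    have hden : G.restrict (Set.Iic T) ≤ ENNReal.ofReal (Real.exp (1 / 2)) • gaussianReal 0 v := by
      rw [Measure.le_iff]
      intro s hs
      rw [Measure.restrict_apply hs, hG, gaussianReal_eq_withDensity hv0,
        withDensity_apply _ (hs.inter measurableSet_Iic), Measure.smul_apply, smul_eq_mul]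
      calc _ ≤ ∫⁻ _ in s ∩ Set.Iic T, ENNReal.ofReal (Real.exp (1 / 2)) ∂gaussianReal 0 v := by
            refine setLIntegral_mono measurable_const fun y hy => ENNReal.ofReal_le_ofReal ?_
            refine Real.exp_le_exp.mpr ?_
            rw [hvR, div_le_iff₀ (by positivity)]
            have h1 : μ * σ * y ≤ μ * σ * T := mul_le_mul_of_nonneg_left hy.2 (by positivity)
            have h2 : μ * σ * T = 1 / 2 * σ ^ 2 := by rw [hT]; field_simp
            nlinarith [sq_nonneg (μ * σ)]
        _ = ENNReal.ofReal (Real.exp (1 / 2)) * gaussianReal 0 v (s ∩ Set.Iic T) := by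
            rw [lintegral_const, Measure.restrict_apply MeasurableSet.univ, Set.univ_inter]
        _ ≤ _ := by gcongr; exact Set.inter_subset_left
    rw [Measure.le_iff] at hden ⊢
    intro s hs
    have h1 := hden s hs
    rw [Measure.smul_apply, smul_eq_mul] at h1
    rw [hK1, Measure.smul_apply, Measure.smul_apply, smul_eq_mul, smul_eq_mul]
    calc _ ≤ ENNReal.ofReal (1 - q)⁻¹ * (ENNReal.ofReal (Real.exp (1 / 2)) * gaussianReal 0 v s) :=
          by gcongr
      _ = ENNReal.ofReal ((1 - q)⁻¹ * Real.exp (1 / 2)) * gaussianReal 0 v s := by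
          rw [← mul_assoc, ENNReal.ofReal_mul (inv_nonneg.mpr (by linarith))]
      _ ≤ ENNReal.ofReal 2 * gaussianReal 0 v s := by
          gcongr
          have h2 : Real.exp (1 / 2) ≤ 7 / 4 := by
            have h3 : Real.exp (1 / 2) ^ 2 = Real.exp 1 := by rw [← Real.exp_nat_mul]; norm_num
            have h4 := Real.exp_one_lt_d9
            nlinarith [Real.exp_pos (1 / 2)]
          have h5 : (1 - q)⁻¹ ≤ 8 / 7 := by
            rw [inv_le_comm₀ (by linarith) (by norm_num)]; norm_num; linarith
          calc _ ≤ (8 / 7 : ℝ) * (7 / 4) := by gcongr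
            _ = 2 := by norm_num
      _ = _ := by simp
  have hsub : (2 : ℝ≥0∞) • gaussianReal 0 v - K1 + K1 = (2 : ℝ≥0∞) • gaussianReal 0 v :=
    Measure.sub_add_cancel_of_le hle
  have hK0p : IsProbabilityMeasure ((2 : ℝ≥0∞) • gaussianReal 0 v - K1) := ⟨by
    have := congrArg (fun ν : Measure ℝ => ν Set.univ) hsub
    simp only [Measure.add_apply, Measure.smul_apply, measure_univ, smul_eq_mul, mul_one] at this
    have h2 : (2 : ℝ≥0∞) = 1 + 1 := by norm_num
    rw [h2] at this
    exact (ENNReal.add_left_inj ENNReal.one_ne_top).mp (by rw [h2]; exact this)⟩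
  refine ⟨fun b => if b then K1 else (2 : ℝ≥0∞) • gaussianReal 0 v - K1, T, q, ?_, ?_, ?_, hq0,
    hqle⟩
  · intro b; cases b
    · simpa using hK0p
    · simpa using hK1p
  · simpa using hsub
  · simp [hK1, hG]

/-- Dropping the truncation gives an untruncated Gaussian law at the cost of one factor `c` per
shifted coordinate. -/
theorem pi_truncated_le {v : ℝ≥0} {m T : ℝ} {c : ℝ≥0∞} {K₁ : Measure ℝ}
    (hK₁ : K₁ = c • (gaussianReal m v).restrict (Set.Iic T)) [IsProbabilityMeasure K₁]
    (D : I → Prop) [DecidablePred D] :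
    (Measure.pi fun e => if D e then K₁ else gaussianReal 0 v) ≤
      c ^ (Finset.univ.filter D).card •
        Measure.pi fun e => gaussianReal (if D e then m else 0) v := by
  classical
  set N : I → Measure ℝ := fun e => gaussianReal (if D e then m else 0) v with hN
  set t : I → Set ℝ := fun e => if D e then Set.Iic T else Set.univ with ht
  have htm : ∀ e, MeasurableSet (t e) := fun e => by
    simp only [ht]; split_ifs; exacts [measurableSet_Iic, MeasurableSet.univ]
  have hsf : ∀ e, SigmaFinite (if D e then K₁ else gaussianReal 0 v) := fun e => by
    split_ifs <;> infer_instance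
  have h1 : (Measure.pi fun e => if D e then K₁ else gaussianReal 0 v) =
      c ^ (Finset.univ.filter D).card • (Measure.pi N).restrict (Set.univ.pi t) := by
    refine Measure.pi_eq fun s hs => ?_
    rw [Measure.smul_apply, Measure.restrict_apply (MeasurableSet.univ_pi hs), ← Set.pi_inter_distrib,
      Measure.pi_pi, smul_eq_mul, ← Finset.prod_const, Finset.prod_filter,
      ← Finset.prod_mul_distrib]
    refine Finset.prod_congr rfl fun e _ => ?_
    simp only [hN, ht]
    split_ifs
    · rw [hK₁, Measure.smul_apply, Measure.restrict_apply (hs e), smul_eq_mul]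
    · simp
  rw [h1, Measure.le_iff]
  intro s _
  rw [Measure.smul_apply, Measure.smul_apply]
  exact mul_le_mul_right (Measure.restrict_apply_le _ _) _

end Gaussian

/-! ## Very unbalanced tensors: statistical indistinguishability -/

section Statistical

open scoped NNReal

theorem exp_le_of_le_one_div {C : ℝ} (h : C ≤ 1 / 32) : Real.exp C ≤ 1 + 1 / 16 := by
  have h1 := Real.add_one_le_exp (-C)
  have h2 : 0 < 1 - C := by linarith
  have h3 : Real.exp C * Real.exp (-C) = 1 := by rw [← Real.exp_add]; simp
  have h4 := Real.exp_pos C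
  nlinarith

/-- Averaged over the signs, both planted models are close to pure noise, so a test good for both
sides errs rarely on the noise for either side. But every data set is an error for one of them. -/
theorem not_forall_signErr_le {a b c : ℕ} {J : Type} [Fintype J] [DecidableEq J] {σ δ : ℝ}
    (hσ : 0 < σ) (D : (Idx a b c → ℤ) → ℤ) (π : Idx a b c → J) (g : Bool → Tensor a b c)
    (hg : ∀ s, ∑ j, (∑ e, if π e = j then g s e ^ 2 / (Real.toNNReal (σ ^ 2) : ℝ) else 0) ^ 2 / 2 ≤
      1 / 32)
    (h : ∀ s (ε : J → Bool), noise a b c σ {Z | SignErr s (D (record δ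
      ((fun e => g s e * boolSign (ε (π e))) + Z)))} ≤ ENNReal.ofReal (1 / 16)) : False := by
  set v := Real.toNNReal (σ ^ 2) with hv
  have hv0 : v ≠ 0 := by
    rw [hv, Ne, Real.toNNReal_eq_zero, not_le]
    positivity
  set E : Bool → Set (Tensor a b c) := fun s => {Y | SignErr s (D (record δ Y))} with hE
  have hEm : ∀ s, MeasurableSet (E s) := fun s => measurableSet_record δ fun q => SignErr s (D q)
  set P := Measure.pi fun _ : Idx a b c => gaussianReal 0 v with hP
  have key : ∀ s, P.real (E s) ≤ 1 / 16 + 1 / 16 + 4 * (1 / 16) := fun s => by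
    refine noise_le_mixture hv0 (fun (ε : J → Bool) e => g s e * boolSign (ε (π e)))
      ((sum_exp_signs_le (g s) π v (hg s)).trans ?_) (hEm s) fun ε => ?_
    · exact mul_le_mul_of_nonneg_right (exp_le_of_le_one_div le_rfl) (sq_nonneg _)
    · have h1 := map_noise_add σ (fun e => g s e * boolSign (ε (π e)))
      rw [← h1, Measure.real, Measure.map_apply (measurable_const_add _) (hEm s)]
      exact ENNReal.toReal_le_of_le_ofReal (by norm_num) (h s ε)
  have huniv : E true ∪ E false = Set.univ := by
    ext Y
    simp only [hE, SignErr, Set.mem_union, Set.mem_ofPred_eq, Set.mem_univ, iff_true, if_true,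
      Bool.false_eq_true, if_false]
    exact lt_or_ge _ _
  have h1 : (1 : ℝ) ≤ P.real (E true) + P.real (E false) := by
    calc (1 : ℝ) = P.real (E true ∪ E false) := by rw [huniv]; simp
      _ ≤ _ := measureReal_union_le _ _
  linarith [key true, key false]

theorem div_le_card_mod {n d c : ℕ} (hc : c < d) :
    n / d ≤ (Finset.univ.filter fun i : Fin n => (i : ℕ) % d = c).card := by
  have hd : 0 < d := by omega
  have hlt : ∀ k : Fin (n / d), c + d * k < n := fun k => by
    have h1 : d * (n / d) ≤ n := Nat.mul_div_le n d
    have h2 : d * (k + 1) ≤ d * (n / d) := Nat.mul_le_mul_left d k.2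
    rw [mul_add] at h2
    omega
  calc n / d = (Finset.univ : Finset (Fin (n / d))).card := by simp
    _ ≤ _ := Finset.card_le_card_of_injOn (fun k => (⟨c + d * k, hlt k⟩ : Fin n))
        (fun k _ => by simp [Nat.mod_eq_of_lt hc])
        (fun k _ k' _ h => by
          simp only [Fin.mk.injEq, Nat.add_left_cancel_iff] at h
          exact Fin.ext (Nat.eq_of_mul_eq_mul_left hd h))

/-- Side of an index by parity. -/
def paritySide {n : ℕ} (i : Fin n) : Bool := decide ((i : ℕ) % 2 = 1)

/-- Label of an index modulo `r`, both sides using each label. -/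
def parityLabel {n r : ℕ} (hr : 1 ≤ r) (i : Fin n) : Fin r := ⟨(i / 2) % r, Nat.mod_lt _ hr⟩

/-- Indicator of the indices of one side. -/
def wideWeight {n : ℕ} (s : Bool) (i : Fin n) : ℝ := if paritySide i = s then 1 else 0

/-- Indicator of one index of each label on one side. -/
def thinWeight {n : ℕ} (r : ℕ) (s : Bool) (i : Fin n) : ℝ :=
  if paritySide i = s ∧ (i : ℕ) < 2 * r then 1 else 0

theorem wideWeight_sq_le {n : ℕ} (s : Bool) (i : Fin n) : wideWeight s i ^ 2 ≤ 1 := by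
  unfold wideWeight; split_ifs <;> norm_num

theorem sum_thinWeight_sq_le (n r : ℕ) (s : Bool) :
    ∑ i : Fin n, thinWeight r s i ^ 2 ≤ 2 * r := by
  calc ∑ i : Fin n, thinWeight r s i ^ 2 ≤ ∑ i : Fin n, if (i : ℕ) < 2 * r then (1 : ℝ) else 0 := by
        refine Finset.sum_le_sum fun i _ => ?_
        unfold thinWeight
        split_ifs with h1 h2 h2
        · norm_num
        · exact absurd h1.2 h2
        all_goals norm_num
    _ = ((Finset.univ.filter fun i : Fin n => (i : ℕ) < 2 * r).card : ℝ) := by simp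
    _ ≤ ((Finset.range (2 * r)).card : ℝ) := by
        refine Nat.cast_le.mpr (Finset.card_le_card_of_injOn (fun i => (i : ℕ)) (fun i hi => ?_)
          fun i _ j _ h => Fin.ext h)
        simpa using hi
    _ = 2 * r := by simp

theorem one_le_thin_block {n r : ℕ} (hr : 1 ≤ r) (hn : 2 * r ≤ n) (s : Bool) (t : Fin r) :
    (1 : ℝ) ≤ ∑ i : Fin n, if parityLabel hr i = t then thinWeight r s i ^ 2 else 0 := by
  have ht := t.2
  -- The index `2t + s` has label `t` and parity `s`.
  let i : Fin n := ⟨2 * t + s.toNat, by cases s <;> (simp; omega)⟩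
  have h1 : parityLabel hr i = t := by
    apply Fin.ext
    have : (2 * (t : ℕ) + s.toNat) / 2 = t := by cases s <;> simp; omega
    simp [parityLabel, i, this, Nat.mod_eq_of_lt ht]
  have h2 : thinWeight r s i = 1 := by
    cases s <;> simp [thinWeight, paritySide, i]; omega
  calc (1 : ℝ) = if parityLabel hr i = t then thinWeight r s i ^ 2 else 0 := by rw [if_pos h1, h2]; simp
    _ ≤ _ := Finset.single_le_sum (f := fun i : Fin n =>
        if parityLabel hr i = t then thinWeight r s i ^ 2 else 0)
        (fun i _ => by split_ifs <;> positivity) (Finset.mem_univ i)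

theorem wide_block_ge {n r : ℕ} (hr : 1 ≤ r) (s : Bool) (t : Fin r) (ε : Fin n → Bool) :
    ((n / (2 * r) : ℕ) : ℝ) ≤ ∑ i : Fin n, if parityLabel hr i = t then
      (wideWeight s i * boolSign (ε i)) ^ 2 else 0 := by
  have ht := t.2
  have hc : 2 * (t : ℕ) + s.toNat < 2 * r := by cases s <;> simp; omega
  calc ((n / (2 * r) : ℕ) : ℝ) ≤
      ((Finset.univ.filter fun i : Fin n => (i : ℕ) % (2 * r) = 2 * t + s.toNat).card : ℝ) :=
        Nat.cast_le.mpr (div_le_card_mod hc)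
    _ = ∑ i : Fin n, if (i : ℕ) % (2 * r) = 2 * t + s.toNat then (1 : ℝ) else 0 := by simp
    _ ≤ _ := by
        refine Finset.sum_le_sum fun i _ => ?_
        split_ifs with h1 h2 h2
        · have h3 : paritySide i = s := by
            have : (i : ℕ) % 2 = s.toNat := by
              have h4 := Nat.mod_mod_of_dvd (i : ℕ) (Dvd.intro r rfl : 2 ∣ 2 * r)
              rw [h1] at h4
              cases s <;> simp at h4 ⊢ <;> omega
            cases s <;> simp [paritySide, this]
          rw [wideWeight, if_pos h3, one_mul, sq, boolSign_mul_self]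
        · exfalso
          apply h2
          apply Fin.ext
          have h5 : (i : ℕ) / 2 % r = (i : ℕ) % (2 * r) / 2 := (Nat.mod_mul_right_div_self _ _ _).symm
          simp only [parityLabel, h5, h1]
          cases s <;> simp; omega
        · positivity
        · exact le_rfl

theorem sum_le_of_le_mul {a b c : ℕ} (F : Idx a b c → ℝ) {C : ℝ} (u : Fin a → ℝ) (v : Fin b → ℝ)
    (w : Fin c → ℝ) (h : ∀ e, F e ≤ C * (u e.1 * (v e.2.1 * w e.2.2))) :
    ∑ e, F e ≤ C * ((∑ i, u i) * ((∑ j, v j) * ∑ k, w k)) := by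
  calc ∑ e, F e ≤ ∑ e : Idx a b c, C * (u e.1 * (v e.2.1 * w e.2.2)) :=
        Finset.sum_le_sum fun e _ => h e
    _ = _ := by
        rw [← Finset.mul_sum, Fintype.sum_prod_type]
        simp only [Fintype.sum_prod_type]
        rw [Finset.sum_mul_sum, Finset.sum_mul]
        simp only [Finset.mul_sum]

/-- The amplitude in a wide mode of dimension `n`. -/
theorem wide_amplitude_bound {n p r R : ℕ} (hr : 1 ≤ r) (hR : 1 ≤ R) (hrR : r ≤ R) (hn : p ^ 5 ≤ n)
    (hp : 4096 * R ^ 6 ≤ p) {lam σ M : ℝ} (hlam : 0 < lam) (hσ : 0 < σ) (hls : lam / σ ≤ p)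
    (hM0 : 0 ≤ M) (hM : M ≤ 4 * R ^ 2) {w : Fin n → ℝ} (hw0 : ∀ j, 0 ≤ w j)
    (hw : ∀ j, w j ≤ (lam ^ 2 / (n / (2 * r) : ℕ)) / σ ^ 2 * M) :
    ∑ j, w j ^ 2 / 2 ≤ 1 / 32 := by
  have hp1 : 1 ≤ p := by
    have : 1 ≤ R ^ 6 := Nat.one_le_pow _ _ hR
    omega
  have hRp : 4096 * (R : ℝ) ^ 6 ≤ p := by exact_mod_cast hp
  have hR1 : (1 : ℝ) ≤ R := by exact_mod_cast hR
  have hrR' : (r : ℝ) ≤ R := by exact_mod_cast hrR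
  have hr1 : (1 : ℝ) ≤ r := by exact_mod_cast hr
  have hpR : (1 : ℝ) ≤ p := by exact_mod_cast hp1
  have hnp : (p : ℝ) ^ 5 ≤ n := by exact_mod_cast hn
  have hn0 : (0 : ℝ) < n := lt_of_lt_of_le (by positivity) hnp
  have h2r : 2 * r ≤ n := by
    calc 2 * r ≤ 4096 * R ^ 6 := by nlinarith [Nat.pow_le_pow_right hR (show 1 ≤ 6 by norm_num)]
      _ ≤ p := hp
      _ ≤ p ^ 5 := Nat.le_self_pow (by norm_num) p
      _ ≤ n := hn
  have hfl : (n : ℝ) / (4 * R) ≤ (n / (2 * r) : ℕ) := by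
    have h1 : n < (n / (2 * r) + 1) * (2 * r) := by
      have := Nat.lt_div_mul_add (a := n) (b := 2 * r) (by omega)
      linarith [this]
    have h2 : 1 ≤ n / (2 * r) := (Nat.one_le_div_iff (by omega)).mpr h2r
    have h1' : (n : ℝ) ≤ ((n / (2 * r) : ℕ) + 1) * (2 * r) := by exact_mod_cast h1.le
    have h2' : (1 : ℝ) ≤ (n / (2 * r) : ℕ) := by exact_mod_cast h2
    rw [div_le_iff₀ (by positivity)]
    calc (n : ℝ) ≤ ((n / (2 * r) : ℕ) + 1) * (2 * r) := h1'
      _ ≤ ((n / (2 * r) : ℕ) + (n / (2 * r) : ℕ)) * (2 * R) := by gcongr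
      _ = _ := by ring
  have hpos : 0 < (n : ℝ) / (4 * R) := by positivity
  -- The energy per wide index is of order `p² / n`. Squaring and summing over `n` indices leaves
  -- `128 R⁶ p⁴ / n`, at most `128 R⁶ / p` for `n ≥ p ^ 5`; the constant 4096 is `32 * 128`.
  have hwb : ∀ j, w j ≤ 16 * R ^ 3 * p ^ 2 / n := fun j => by
    refine (hw j).trans ?_
    calc lam ^ 2 / (n / (2 * r) : ℕ) / σ ^ 2 * M = (lam / σ) ^ 2 / (n / (2 * r) : ℕ) * M := by
          rw [div_pow]; ring
      _ ≤ (p : ℝ) ^ 2 / ((n : ℝ) / (4 * R)) * (4 * R ^ 2) := by gcongr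
      _ = _ := by field_simp; ring
  calc (∑ j, w j ^ 2 / 2 : ℝ) ≤ ∑ _j : Fin n, ((16 * R ^ 3 * p ^ 2 / n : ℝ) ^ 2 / 2 : ℝ) :=
        Finset.sum_le_sum fun j _ => by
          have := pow_le_pow_left₀ (hw0 j) (hwb j) 2
          linarith
    _ = (128 * R ^ 6 * p ^ 4 / n : ℝ) := by
        rw [Finset.sum_const, Finset.card_univ, Fintype.card_fin, nsmul_eq_mul]
        field_simp; norm_num
    _ ≤ (128 * R ^ 6 * p ^ 4 / p ^ 5 : ℝ) := by gcongr
    _ = (128 * R ^ 6 / p : ℝ) := by field_simp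
    _ ≤ 1 / 32 := by rw [div_le_iff₀ (by positivity)]; linarith

/-- The signal fills one side of the wide mode with arbitrary signs and uses a single index per
label in the other two modes. Signs leave singular values and supports unchanged, yet make the
mixture nearly indistinguishable from noise. The three cases differ only in which mode is wide. -/
theorem statistical_lower_bound {r₁ r₂ r₃ : ℕ} (hr₁ : 1 ≤ r₁) (hr₂ : 1 ≤ r₂) (hr₃ : 1 ≤ r₃)
    {T : Finset (Fin r₁ × Fin r₂ × Fin r₃)} (hT : IsTransversal T) {a b c p : ℕ}
    (hp : 4096 * (r₁ * r₂ * r₃) ^ 6 ≤ p) (ha : p ≤ a) (hb : p ≤ b) (hc : p ≤ c)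
    (hbig : p ^ 5 ≤ a ∨ p ^ 5 ≤ b ∨ p ^ 5 ≤ c) {lam σ δ : ℝ} (hlam : 0 < lam) (hσ : 0 < σ)
    (hls : lam / σ ≤ p) (D : (Idx a b c → ℤ) → ℤ)
    (h : ∀ s X, Planted r₁ r₂ r₃ lam (paritySide (n := a)) (paritySide (n := b))
      (paritySide (n := c)) s X →
      noise a b c σ {Z | SignErr s (D (record δ (X + Z)))} ≤ ENNReal.ofReal (1 / 16)) : False := by
  set R := r₁ * r₂ * r₃ with hRdef
  have hR : 1 ≤ R := Nat.one_le_iff_ne_zero.mpr (by positivity)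
  have hR1 : r₁ ≤ R := by rw [hRdef, mul_assoc]; exact Nat.le_mul_of_pos_right _ (by positivity)
  have hR2 : r₂ ≤ R := by
    rw [hRdef, mul_comm r₁, mul_assoc]; exact Nat.le_mul_of_pos_right _ (by positivity)
  have hR3 : r₃ ≤ R := by rw [hRdef]; exact Nat.le_mul_of_pos_left _ (by positivity)
  have hRR : 2 * R ≤ p := by
    refine le_trans ?_ hp
    nlinarith [Nat.le_self_pow (show 6 ≠ 0 by norm_num) R]
  have hv : ((Real.toNNReal (σ ^ 2) : ℝ≥0) : ℝ) = σ ^ 2 := Real.coe_toNNReal _ (by positivity)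
  have hR1' : (r₁ : ℝ) ≤ R := by exact_mod_cast hR1
  have hR2' : (r₂ : ℝ) ≤ R := by exact_mod_cast hR2
  have hR3' : (r₃ : ℝ) ≤ R := by exact_mod_cast hR3
  have hn : ∀ {n r : ℕ}, 1 ≤ r → r ≤ R → p ≤ n → (0 : ℝ) < (n / (2 * r) : ℕ) := by
    intro n r hr hrR hpn
    exact_mod_cast Nat.div_pos (by omega) (by omega)
  have hsupp : ∀ {n : ℕ} (s : Bool) (ε : Fin n → Bool) (i : Fin n), paritySide i ≠ s →
      wideWeight s i * boolSign (ε i) = 0 := fun s ε i hi => by simp [wideWeight, hi]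
  have hsupp' : ∀ {n : ℕ} (r : ℕ) (s : Bool) (i : Fin n), paritySide i ≠ s →
      thinWeight r s i = 0 := fun r s i hi => by simp [thinWeight, hi]
  rcases hbig with hbig | hbig | hbig
  · set N : ℝ := ((a / (2 * r₁) : ℕ) : ℝ) with hN
    have hN0 : 0 < N := hn hr₁ hR1 ha
    -- Each wide block has energy at least `N` and each thin block at least 1, so this amplitude
    -- makes the singular values at least `lam`.
    set θ := lam / Real.sqrt N with hθ
    have hθ2 : θ ^ 2 = lam ^ 2 / N := by rw [hθ, div_pow, Real.sq_sqrt hN0.le]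
    refine not_forall_signErr_le (σ := σ) (δ := δ) hσ D (fun e => e.1) (fun s =>
      blockTensor T (parityLabel hr₁) (parityLabel hr₂) (parityLabel hr₃) θ (wideWeight s)
        (thinWeight r₂ s) (thinWeight r₃ s)) (fun s => ?_) (fun s ε => ?_)
    · refine wide_amplitude_bound (M := (2 * r₂) * (2 * r₃)) hr₁ hR hR1 hbig hp hlam hσ hls
        (by positivity) ?_ (fun j => Finset.sum_nonneg fun e _ => by split_ifs <;> positivity)
        fun j => ?_
      · calc ((2 * r₂) * (2 * r₃) : ℝ) ≤ (2 * R) * (2 * R) := by gcongr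
          _ = _ := by ring
      · refine (sum_le_of_le_mul (C := lam ^ 2 / N / σ ^ 2) _ (fun i => if i = j then 1 else 0)
          (fun i => thinWeight r₂ s i ^ 2) (fun i => thinWeight r₃ s i ^ 2) fun e => ?_).trans ?_
        · rw [← hθ2, hv]
          simp only [blockTensor]
          split_ifs
          · have := wideWeight_sq_le s e.1
            rw [mul_pow, mul_pow, mul_pow, mul_assoc (wideWeight s e.1 ^ 2), mul_div_right_comm]
            gcongr
          all_goals simp <;> positivity
        · simp only [Finset.sum_ite_eq', Finset.mem_univ, if_true, one_mul]
          gcongr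
          · exact sum_thinWeight_sq_le _ _ _
          · exact sum_thinWeight_sq_le _ _ _
    -- The signs are absorbed into the wide weight, so the signed tensor is again a block tensor.
    · have heq : (fun e : Idx a b c => blockTensor T (parityLabel hr₁) (parityLabel hr₂)
          (parityLabel hr₃) θ (wideWeight s) (thinWeight r₂ s) (thinWeight r₃ s) e *
          boolSign (ε e.1)) = blockTensor T (parityLabel hr₁) (parityLabel hr₂) (parityLabel hr₃) θ
          (fun i => wideWeight s i * boolSign (ε i)) (thinWeight r₂ s) (thinWeight r₃ s) := by
        funext e; simp only [blockTensor]; split_ifs <;> ring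
      rw [heq]
      refine h s _ (planted_blockTensor hr₁ hr₂ hr₃ hT _ _ _ θ _ _ _ (n₁ := N) (n₂ := 1) (n₃ := 1)
        hlam hN0.le zero_le_one zero_le_one (fun t => wide_block_ge hr₁ s t ε)
        (one_le_thin_block hr₂ (by omega) s) (one_le_thin_block hr₃ (by omega) s) ?_ _ _ _ s
        (hsupp s ε) (hsupp' _ s) (hsupp' _ s))
      rw [hθ2]; field_simp; rfl
  · set N : ℝ := ((b / (2 * r₂) : ℕ) : ℝ) with hN
    have hN0 : 0 < N := hn hr₂ hR2 hb
    set θ := lam / Real.sqrt N with hθ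
    have hθ2 : θ ^ 2 = lam ^ 2 / N := by rw [hθ, div_pow, Real.sq_sqrt hN0.le]
    refine not_forall_signErr_le (σ := σ) (δ := δ) hσ D (fun e => e.2.1) (fun s =>
      blockTensor T (parityLabel hr₁) (parityLabel hr₂) (parityLabel hr₃) θ (thinWeight r₁ s)
        (wideWeight s) (thinWeight r₃ s)) (fun s => ?_) (fun s ε => ?_)
    · refine wide_amplitude_bound (M := (2 * r₁) * (2 * r₃)) hr₂ hR hR2 hbig hp hlam hσ hls
        (by positivity) ?_ (fun j => Finset.sum_nonneg fun e _ => by split_ifs <;> positivity)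
        fun j => ?_
      · calc ((2 * r₁) * (2 * r₃) : ℝ) ≤ (2 * R) * (2 * R) := by gcongr
          _ = _ := by ring
      · refine (sum_le_of_le_mul (C := lam ^ 2 / N / σ ^ 2) _ (fun i => thinWeight r₁ s i ^ 2)
          (fun i => if i = j then 1 else 0) (fun i => thinWeight r₃ s i ^ 2) fun e => ?_).trans ?_
        · rw [← hθ2, hv]
          simp only [blockTensor]
          split_ifs
          · have := wideWeight_sq_le s e.2.1
            rw [mul_pow, mul_pow, mul_pow, mul_assoc (thinWeight r₁ s e.1 ^ 2), mul_div_right_comm]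
            gcongr
          all_goals simp <;> positivity
        · simp only [Finset.sum_ite_eq', Finset.mem_univ, if_true, one_mul]
          gcongr
          · exact sum_thinWeight_sq_le _ _ _
          · exact sum_thinWeight_sq_le _ _ _
    · have heq : (fun e : Idx a b c => blockTensor T (parityLabel hr₁) (parityLabel hr₂)
          (parityLabel hr₃) θ (thinWeight r₁ s) (wideWeight s) (thinWeight r₃ s) e *
          boolSign (ε e.2.1)) = blockTensor T (parityLabel hr₁) (parityLabel hr₂) (parityLabel hr₃) θ
          (thinWeight r₁ s) (fun i => wideWeight s i * boolSign (ε i)) (thinWeight r₃ s) := by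
        funext e; simp only [blockTensor]; split_ifs <;> ring
      rw [heq]
      refine h s _ (planted_blockTensor hr₁ hr₂ hr₃ hT _ _ _ θ _ _ _ (n₁ := 1) (n₂ := N) (n₃ := 1)
        hlam zero_le_one hN0.le zero_le_one (one_le_thin_block hr₁ (by omega) s)
        (fun t => wide_block_ge hr₂ s t ε) (one_le_thin_block hr₃ (by omega) s) ?_ _ _ _ s
        (hsupp' _ s) (hsupp s ε) (hsupp' _ s))
      rw [hθ2]; field_simp; rfl
  · set N : ℝ := ((c / (2 * r₃) : ℕ) : ℝ) with hN
    have hN0 : 0 < N := hn hr₃ hR3 hc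
    set θ := lam / Real.sqrt N with hθ
    have hθ2 : θ ^ 2 = lam ^ 2 / N := by rw [hθ, div_pow, Real.sq_sqrt hN0.le]
    refine not_forall_signErr_le (σ := σ) (δ := δ) hσ D (fun e => e.2.2) (fun s =>
      blockTensor T (parityLabel hr₁) (parityLabel hr₂) (parityLabel hr₃) θ (thinWeight r₁ s)
        (thinWeight r₂ s) (wideWeight s)) (fun s => ?_) (fun s ε => ?_)
    · refine wide_amplitude_bound (M := (2 * r₁) * (2 * r₂)) hr₃ hR hR3 hbig hp hlam hσ hls
        (by positivity) ?_ (fun j => Finset.sum_nonneg fun e _ => by split_ifs <;> positivity)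
        fun j => ?_
      · calc ((2 * r₁) * (2 * r₂) : ℝ) ≤ (2 * R) * (2 * R) := by gcongr
          _ = _ := by ring
      · refine (sum_le_of_le_mul (C := lam ^ 2 / N / σ ^ 2) _ (fun i => thinWeight r₁ s i ^ 2)
          (fun i => thinWeight r₂ s i ^ 2) (fun i => if i = j then 1 else 0) fun e => ?_).trans ?_
        · rw [← hθ2, hv]
          simp only [blockTensor]
          split_ifs
          · have := wideWeight_sq_le s e.2.2
            rw [mul_pow, mul_pow, mul_pow, mul_assoc (thinWeight r₁ s e.1 ^ 2), mul_div_right_comm]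
            gcongr
          all_goals simp <;> positivity
        · simp only [Finset.sum_ite_eq', Finset.mem_univ, if_true, mul_one]
          gcongr
          · exact sum_thinWeight_sq_le _ _ _
          · exact sum_thinWeight_sq_le _ _ _
    · have heq : (fun e : Idx a b c => blockTensor T (parityLabel hr₁) (parityLabel hr₂)
          (parityLabel hr₃) θ (thinWeight r₁ s) (thinWeight r₂ s) (wideWeight s) e *
          boolSign (ε e.2.2)) = blockTensor T (parityLabel hr₁) (parityLabel hr₂) (parityLabel hr₃) θ
          (thinWeight r₁ s) (thinWeight r₂ s) (fun i => wideWeight s i * boolSign (ε i)) := by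
        funext e; simp only [blockTensor]; split_ifs <;> ring
      rw [heq]
      refine h s _ (planted_blockTensor hr₁ hr₂ hr₃ hT _ _ _ θ _ _ _ (n₁ := 1) (n₂ := 1) (n₃ := N)
        hlam zero_le_one zero_le_one hN0.le (one_le_thin_block hr₁ (by omega) s)
        (one_le_thin_block hr₂ (by omega) s) (fun t => wide_block_ge hr₃ s t ε) ?_ _ _ _ s
        (hsupp' _ s) (hsupp' _ s) (hsupp s ε))
      rw [hθ2]; field_simp; rfl

end Statistical

/-! ## Random subsets of fixed size -/

section RandomSubsets

theorem sum_card_inter_powersetCard {α : Type*} [DecidableEq α] {V B : Finset α} (hB : B ⊆ V)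
    {κ : ℕ} (hκ : 1 ≤ κ) : ∑ C ∈ V.powersetCard κ, (C ∩ B).card =
      B.card * (V.card - 1).choose (κ - 1) := by
  have h1 : ∀ C : Finset α, (C ∩ B).card = ∑ x ∈ B, if {x} ⊆ C then 1 else 0 := fun C => by
    rw [Finset.inter_comm, ← Finset.filter_mem_eq_inter, Finset.card_filter]
    simp only [Finset.singleton_subset_iff]
  simp only [h1]
  rw [Finset.sum_comm]
  simp only [← Finset.card_filter]
  rw [Finset.sum_congr rfl fun x hx => Finset.card_filter_powersetCard_subset {x} V κ
    (by simpa using hB hx) (by simpa using hκ)]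
  simp

/-- The squared cardinality counts ordered pairs: diagonal pairs impose one element on `C`, the
others two. -/
theorem sum_card_inter_sq_powersetCard {α : Type*} [DecidableEq α] {V B : Finset α} (hB : B ⊆ V)
    {κ : ℕ} (hκ : 2 ≤ κ) : ∑ C ∈ V.powersetCard κ, (C ∩ B).card ^ 2 ≤
      B.card * (V.card - 1).choose (κ - 1) + B.card ^ 2 * (V.card - 2).choose (κ - 2) := by
  have h1 : ∀ C : Finset α, (C ∩ B).card ^ 2 = ∑ x ∈ B, ∑ y ∈ B, if {x, y} ⊆ C then 1 else 0 :=
    fun C => by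
      rw [Finset.inter_comm, ← Finset.filter_mem_eq_inter, Finset.card_filter, sq,
        Finset.sum_mul_sum]
      refine Finset.sum_congr rfl fun x _ => Finset.sum_congr rfl fun y _ => ?_
      simp only [Finset.insert_subset_iff, Finset.singleton_subset_iff]
      split_ifs <;> simp_all
  simp only [h1]
  rw [Finset.sum_comm]
  have h2 : ∀ x ∈ B, ∑ C ∈ V.powersetCard κ, ∑ y ∈ B, (if {x, y} ⊆ C then 1 else 0) ≤
      (V.card - 1).choose (κ - 1) + B.card * (V.card - 2).choose (κ - 2) := by
    intro x hx
    rw [Finset.sum_comm]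
    simp only [← Finset.card_filter]
    calc _ ≤ ∑ y ∈ B, ((if y = x then (V.card - 1).choose (κ - 1) else 0) +
          (V.card - 2).choose (κ - 2)) := by
          refine Finset.sum_le_sum fun y hy => ?_
          have hsub : ({x, y} : Finset α) ⊆ V := by
            simp [Finset.insert_subset_iff, hB hx, hB hy]
          split_ifs with hxy
          · subst hxy
            rw [Finset.card_filter_powersetCard_subset _ V κ hsub (by simp; omega)]
            simp
          · have hc : ({x, y} : Finset α).card = 2 := Finset.card_pair (Ne.symm hxy)
            rw [Finset.card_filter_powersetCard_subset _ V κ hsub (by omega), hc]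
            omega
      _ = _ := by
          rw [Finset.sum_add_distrib]
          simp [hx]
  calc _ ≤ ∑ _x ∈ B, ((V.card - 1).choose (κ - 1) + B.card * (V.card - 2).choose (κ - 2)) :=
        Finset.sum_le_sum h2
    _ = _ := by rw [Finset.sum_const, smul_eq_mul]; ring

/-- Chebyshev's inequality for the intersection of a random `κ`-subset with a fixed set. -/
theorem card_small_inter_le {α : Type*} [DecidableEq α] {V B : Finset α} (hB : B ⊆ V) {κ : ℕ}
    (hκ : 2 ≤ κ) (hV : κ ≤ V.card) {m : ℝ} (hm : m = κ * B.card / V.card) :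
    (((V.powersetCard κ).filter fun C => ((C ∩ B).card : ℝ) < m / 2).card : ℝ) * m ≤
      4 * (V.powersetCard κ).card := by
  set n := V.card with hn
  set b := B.card with hb
  set P := V.powersetCard κ with hP
  have hPc : P.card = n.choose κ := Finset.card_powersetCard _ _
  have hn0 : (0 : ℝ) < n := by exact_mod_cast (show 0 < n by omega)
  have e1 : (n : ℝ) * (n - 1).choose (κ - 1) = κ * P.card := by
    have := Nat.add_one_mul_choose_eq (n - 1) (κ - 1)
    rw [show n - 1 + 1 = n by omega, show κ - 1 + 1 = κ by omega] at this
    rw [hPc]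
    exact_mod_cast this.trans (mul_comm _ _)
  have e2 : ((n : ℝ) - 1) * (n - 2).choose (κ - 2) = (κ - 1) * (n - 1).choose (κ - 1) := by
    have := Nat.add_one_mul_choose_eq (n - 2) (κ - 2)
    rw [show n - 2 + 1 = n - 1 by omega, show κ - 2 + 1 = κ - 1 by omega] at this
    have h3 : ((n - 1 : ℕ) : ℝ) = n - 1 := by rw [Nat.cast_sub (by omega)]; simp
    have h4 : ((κ - 1 : ℕ) : ℝ) = κ - 1 := by rw [Nat.cast_sub (by omega)]; simp
    rw [← h3, ← h4]
    exact_mod_cast this.trans (mul_comm _ _)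
  have s1 : ∑ C ∈ P, ((C ∩ B).card : ℝ) = P.card * m := by
    have := sum_card_inter_powersetCard hB (show 1 ≤ κ by omega)
    have h' : ∑ C ∈ P, ((C ∩ B).card : ℝ) = b * (n - 1).choose (κ - 1) := by exact_mod_cast this
    rw [h', hm]
    field_simp
    linear_combination (b : ℝ) * e1
  have s2 : ∑ C ∈ P, ((C ∩ B).card : ℝ) ^ 2 ≤ P.card * (m + m ^ 2) := by
    have := sum_card_inter_sq_powersetCard hB hκ
    have h' : ∑ C ∈ P, ((C ∩ B).card : ℝ) ^ 2 ≤
        b * (n - 1).choose (κ - 1) + b ^ 2 * (n - 2).choose (κ - 2) := by exact_mod_cast this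
    refine h'.trans ?_
    have f1 : (b : ℝ) * (n - 1).choose (κ - 1) = P.card * m := by
      rw [hm]; field_simp; linear_combination (b : ℝ) * e1
    -- Sampling without replacement is negatively correlated: `κ(κ-1) / (n(n-1)) ≤ κ² / n²`. So the
    -- variance is at most the mean `m`.
    have f2 : (n : ℝ) ^ 2 * (n - 2).choose (κ - 2) ≤ κ ^ 2 * P.card := by
      have hκn : (κ : ℝ) ≤ n := by exact_mod_cast hV
      have hκ2 : (2 : ℝ) ≤ κ := by exact_mod_cast hκ
      have hn1 : (0 : ℝ) < n - 1 := by linarith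
      have hle : (n : ℝ) * (κ - 1) ≤ κ * (n - 1) := by nlinarith
      have hN0 : (0 : ℝ) ≤ P.card := Nat.cast_nonneg _
      have : (n - 1 : ℝ) * (n ^ 2 * (n - 2).choose (κ - 2)) ≤ (n - 1) * (κ ^ 2 * P.card) := by
        calc (n - 1 : ℝ) * (n ^ 2 * (n - 2).choose (κ - 2)) =
              (n * (κ - 1)) * (κ * P.card) := by
              linear_combination (n : ℝ) ^ 2 * e2 + (n : ℝ) * (κ - 1) * e1
          _ ≤ (κ * (n - 1)) * (κ * P.card) := by gcongr
          _ = _ := by ring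
      exact le_of_mul_le_mul_left this hn1
    have f3 : (b : ℝ) ^ 2 * (n - 2).choose (κ - 2) ≤ P.card * m ^ 2 := by
      rw [hm, div_pow, mul_div_assoc', le_div_iff₀ (by positivity)]
      calc ((b : ℝ) ^ 2 * (n - 2).choose (κ - 2) * n ^ 2 : ℝ) =
            (b ^ 2 * (n ^ 2 * (n - 2).choose (κ - 2)) : ℝ) := by ring
        _ ≤ (b ^ 2 * (κ ^ 2 * P.card) : ℝ) := by gcongr
        _ = _ := by ring
    rw [f1, mul_add]
    linarith
  have hm0 : 0 ≤ m := by rw [hm]; positivity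
  rcases hm0.eq_or_lt with h0 | hpos
  · rw [← h0]; simp
  have var : ∑ C ∈ P, (((C ∩ B).card : ℝ) - m) ^ 2 ≤ P.card * m := by
    have : ∑ C ∈ P, (((C ∩ B).card : ℝ) - m) ^ 2 = ∑ C ∈ P, ((C ∩ B).card : ℝ) ^ 2 -
        2 * m * ∑ C ∈ P, ((C ∩ B).card : ℝ) + P.card * m ^ 2 := by
      rw [Finset.mul_sum, ← Finset.sum_sub_distrib]
      have : (P.card : ℝ) * m ^ 2 = ∑ _C ∈ P, m ^ 2 := by simp
      rw [this, ← Finset.sum_add_distrib]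
      exact Finset.sum_congr rfl fun C _ => by ring
    rw [this, s1]
    linarith
  have low : ((P.filter fun C => ((C ∩ B).card : ℝ) < m / 2).card : ℝ) * (m / 2) ^ 2 ≤
      ∑ C ∈ P, (((C ∩ B).card : ℝ) - m) ^ 2 := by
    rw [← nsmul_eq_mul, ← Finset.sum_const]
    refine (Finset.sum_le_sum fun C hC => ?_).trans
      (Finset.sum_le_sum_of_subset_of_nonneg (Finset.filter_subset _ P)
        fun C _ _ => sq_nonneg (((C ∩ B).card : ℝ) - m))
    have := (Finset.mem_filter.mp hC).2
    nlinarith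
  have hfin := low.trans var
  have : ((P.filter fun C => ((C ∩ B).card : ℝ) < m / 2).card : ℝ) * m * (m / 4) ≤
      4 * P.card * (m / 4) := by nlinarith
  exact le_of_mul_le_mul_right this (by positivity)

end RandomSubsets

/-! ## Averaging over hypergraphs -/

section Hypergraphs

open Classical in
/-- A family of independent fair bits, some of which are forced to be true, turned into data by
channels whose equal mixture is `g`. -/
theorem sum_powerset_pi {I α : Type} [Fintype I] (S : Finset α) (Dom : I → Prop)
    (t : I → α) (ht : ∀ e, Dom e → t e ∈ S) (hinj : ∀ e e', Dom e → Dom e' → t e = t e' → e = e')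
    (forced : α → Prop) (F : I → Bool → Measure ℝ) [hF : ∀ e b, IsProbabilityMeasure (F e b)]
    (g : Measure ℝ) [IsProbabilityMeasure g] (hdom : ∀ e, Dom e → F e false + F e true = (2 : ℝ≥0∞) • g)
    (hout : ∀ e b, ¬ Dom e → F e b = g) (A : Set (I → ℝ)) :
    ∑ E ∈ S.powerset, (Measure.pi fun e => F e (decide (t e ∈ E ∨ forced (t e)))).real A =
      2 ^ S.card * (Measure.pi fun e => if Dom e ∧ forced (t e) then F e true else g).real A := by
  have hM : ∀ e, IsProbabilityMeasure (if Dom e ∧ forced (t e) then F e true else g) := fun e => by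
    split_ifs <;> infer_instance
  have h2 : (2 : ℝ≥0∞) ^ S.card ≠ 0 := by simp
  have h2' : (2 : ℝ≥0∞) ^ S.card ≠ ∞ := by simp
  have key : ∑ E ∈ S.powerset, (Measure.pi fun e => F e (decide (t e ∈ E ∨ forced (t e)))) =
      (2 : ℝ≥0∞) ^ S.card •
        Measure.pi fun e => if Dom e ∧ forced (t e) then F e true else g := by
    have h3 : (Measure.pi fun e => if Dom e ∧ forced (t e) then F e true else g) =
        ((2 : ℝ≥0∞) ^ S.card)⁻¹ • ∑ E ∈ S.powerset,
          (Measure.pi fun e => F e (decide (t e ∈ E ∨ forced (t e)))) := by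
      refine Measure.pi_eq fun s hs => ?_
      rw [Measure.smul_apply, Measure.finsetSum_apply, smul_eq_mul]
      simp only [Measure.pi_pi]
      have hprod : ∀ E : Finset α, ∏ e, F e (decide (t e ∈ E ∨ forced (t e))) (s e) =
          (∏ e with ¬ Dom e, g (s e)) * ∏ x ∈ S, ∏ e with Dom e ∧ t e = x,
            F e (decide (x ∈ E ∨ forced x)) (s e) := fun E => by
        rw [← Finset.prod_filter_mul_prod_filter_not Finset.univ Dom, mul_comm]
        congr 1
        · exact Finset.prod_congr rfl fun e he => by rw [hout e _ (Finset.mem_filter.mp he).2]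
        · rw [← Finset.prod_fiberwise_of_maps_to (s := Finset.univ.filter Dom) (t := S) (g := t)
            fun e he => ht e (Finset.mem_filter.mp he).2]
          refine Finset.prod_congr rfl fun x _ => ?_
          rw [Finset.filter_filter]
          exact Finset.prod_congr rfl fun e he => by rw [(Finset.mem_filter.mp he).2.2]
      simp only [hprod]
      rw [← Finset.mul_sum]
      -- Expanding a product of two-term factors over `S` gives the sum over subsets; this is the
      -- independence of the edges.
      have hadd : ∑ E ∈ S.powerset, ∏ x ∈ S, ∏ e with Dom e ∧ t e = x,
          F e (decide (x ∈ E ∨ forced x)) (s e) =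
          ∏ x ∈ S, ((∏ e with Dom e ∧ t e = x, F e true (s e)) +
            ∏ e with Dom e ∧ t e = x, F e (decide (forced x)) (s e)) := by
        rw [Finset.prod_add]
        refine Finset.sum_congr rfl fun E hE => ?_
        rw [← Finset.prod_sdiff (Finset.mem_powerset.mp hE), mul_comm]
        congr 1
        · exact Finset.prod_congr rfl fun x hx => by simp [hx]
        · exact Finset.prod_congr rfl fun x hx => by simp [(Finset.mem_sdiff.mp hx).2]
      -- Each edge feeds at most one coordinate. A forced edge contributes `F e true` twice, a free
      -- edge the two channel laws, which add up to `2 • g`, and an unused edge `1 + 1`.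
      have hx : ∀ x ∈ S, ((∏ e with Dom e ∧ t e = x, F e true (s e)) +
            ∏ e with Dom e ∧ t e = x, F e (decide (forced x)) (s e)) =
          2 * ∏ e with Dom e ∧ t e = x,
            (if Dom e ∧ forced (t e) then F e true else g) (s e) := fun x _ => by
        by_cases hex : ∃ e, Dom e ∧ t e = x
        · obtain ⟨e, he, rfl⟩ := hex
          have : (Finset.univ.filter fun e' => Dom e' ∧ t e' = t e) = {e} := by
            ext e'
            simp only [Finset.mem_filter, Finset.mem_univ, true_and, Finset.mem_singleton]
            exact ⟨fun h => hinj _ _ h.1 he h.2, fun h => by subst h; exact ⟨he, rfl⟩⟩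
          rw [this]
          simp only [Finset.prod_singleton]
          by_cases hf : forced (t e)
          · simp [he, hf, two_mul]
          · have := congrArg (fun ν : Measure ℝ => ν (s e)) (hdom e he)
            simp only [Measure.add_apply, Measure.smul_apply, smul_eq_mul] at this
            simp only [hf, decide_false, and_false, if_false]
            rw [← this, add_comm]
        · have : (Finset.univ.filter fun e' => Dom e' ∧ t e' = x) = ∅ := by
            ext e'
            simp only [Finset.mem_filter, Finset.mem_univ, true_and, Finset.notMem_empty, iff_false]
            exact fun h => hex ⟨e', h⟩
          rw [this]; simp only [Finset.prod_empty]; norm_num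
      rw [hadd, Finset.prod_congr rfl hx, Finset.prod_mul_distrib, Finset.prod_const]
      have hfib : ∏ x ∈ S, ∏ e with Dom e ∧ t e = x,
            (if Dom e ∧ forced (t e) then F e true else g) (s e) =
          ∏ e with Dom e, (if Dom e ∧ forced (t e) then F e true else g) (s e) := by
        rw [← Finset.prod_fiberwise_of_maps_to (s := Finset.univ.filter Dom) (t := S) (g := t)
            fun e he => ht e (Finset.mem_filter.mp he).2]
        exact Finset.prod_congr rfl fun x _ => by rw [Finset.filter_filter]
      rw [hfib, mul_left_comm, ← mul_assoc ((2 : ℝ≥0∞) ^ S.card)⁻¹, ENNReal.inv_mul_cancel h2 h2', one_mul,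
        ← Finset.prod_filter_mul_prod_filter_not Finset.univ Dom, mul_comm]
      congr 1
      exact Finset.prod_congr rfl fun e he => by simp [(Finset.mem_filter.mp he).2]
    rw [h3, smul_smul, ENNReal.mul_inv_cancel h2 h2', one_smul]
  have h4 := congrArg (fun ν : Measure (I → ℝ) => (ν A).toReal) key
  simp only [Measure.finsetSum_apply, Measure.smul_apply, smul_eq_mul, ENNReal.toReal_mul] at h4
  rw [ENNReal.toReal_sum fun E _ => measure_ne_top _ _] at h4
  simpa [Measure.real] using h4

/-- Selecting one of two independent values in each coordinate. -/
theorem map_select_pi {I : Type} [Fintype I] (F : I → Bool → Measure ℝ)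
    [∀ e b, IsProbabilityMeasure (F e b)] (x : I → Bool) :
    (Measure.pi fun eb : I × Bool => F eb.1 eb.2).map (fun ω e => ω (e, x e)) =
      Measure.pi fun e => F e (x e) := by
  classical
  have hmeas : Measurable fun (ω : I × Bool → ℝ) e => ω (e, x e) :=
    measurable_pi_lambda _ fun e => measurable_pi_apply _
  symm
  refine Measure.pi_eq fun s hs => ?_
  rw [Measure.map_apply hmeas (MeasurableSet.univ_pi hs)]
  have : (fun (ω : I × Bool → ℝ) e => ω (e, x e)) ⁻¹' Set.univ.pi s =
      Set.univ.pi fun eb : I × Bool => if eb.2 = x eb.1 then s eb.1 else Set.univ := by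
    ext ω
    simp only [Set.mem_preimage, Set.mem_univ_pi]
    constructor
    · rintro h ⟨e, b⟩
      by_cases hb : b = x e
      · simpa [hb] using h e
      · simp [hb]
    · intro h e
      simpa using h (e, x e)
  rw [this, Measure.pi_pi, Fintype.prod_prod_type]
  refine Finset.prod_congr rfl fun e _ => ?_
  rw [Fintype.prod_bool]
  cases x e <;> simp

end Hypergraphs

/-! ## The reduction from planted clique detection -/

section CliqueReduction

/-- The vertex attached to the index `i` of mode `k`. -/
def vertex {p : ℕ} (hp : 0 < p) (k i : ℕ) : Fin (3 * p) := ⟨(3 * i + k) % (3 * p), Nat.mod_lt _ (by omega)⟩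

/-- The residue modulo 3 records the mode. Interleaving the modes lets both halves of the vertex set
contain a fixed fraction of each mode and label. -/
theorem vertex_val {p : ℕ} (hp : 0 < p) {k i : ℕ} (hk : k < 3) (hi : i < p) :
    (vertex hp k i : ℕ) = 3 * i + k := Nat.mod_eq_of_lt (by omega)

/-- The half of the vertices on side `s`. -/
def half (N : ℕ) (s : Bool) : Finset (Fin N) := if s then firstHalf N else secondHalf N

theorem mem_half {N : ℕ} {s : Bool} {v : Fin N} :
    v ∈ half N s ↔ decide ((v : ℕ) < N / 2) = s := by
  cases s <;> simp [half, firstHalf, secondHalf]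

/-- The vertices of one half that are attached to indices of mode `k` with label `t`. -/
def cliqueBlock (N k r t : ℕ) (s : Bool) : Finset (Fin N) :=
  (half N s).filter fun v => (v : ℕ) % 3 = k ∧ (v : ℕ) / 3 % r = t

/-- Side of an index. -/
def cliqueSide {p n : ℕ} (hp : 0 < p) (k : ℕ) (i : Fin n) : Bool :=
  decide ((i : ℕ) < p ∧ (vertex hp k i : ℕ) < 3 * p / 2)

/-- Indicator of the clique along mode `k`. -/
def cliqueWeight {p n : ℕ} (hp : 0 < p) (k : ℕ) (C : Finset (Fin (3 * p))) (i : Fin n) : ℝ :=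
  if (i : ℕ) < p ∧ vertex hp k i ∈ C then 1 else 0

/-- Label of an index. -/
def modLabel {n r : ℕ} (hr : 1 ≤ r) (i : Fin n) : Fin r := ⟨i % r, Nat.mod_lt _ hr⟩

theorem card_half_le (N : ℕ) (s : Bool) : (half N s).card ≤ N / 2 + 1 := by
  calc (half N s).card = ((half N s).map Fin.valEmbedding).card := (Finset.card_map _).symm
    _ ≤ (Finset.Ico (if s then 0 else N / 2) (if s then N / 2 else N)).card := by
        refine Finset.card_le_card fun i hi => ?_
        obtain ⟨v, hv, rfl⟩ := Finset.mem_map.mp hi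
        have := mem_half.mp hv
        have := v.2
        cases s <;> simp_all
    _ ≤ _ := by cases s <;> simp; omega

theorem half_le_card_half (N : ℕ) (s : Bool) : N / 2 ≤ (half N s).card := by
  calc N / 2 = (Finset.univ : Finset (Fin (N / 2))).card := by simp
    _ ≤ _ := Finset.card_le_card_of_injOn
        (fun i => (⟨i + (if s then 0 else N - N / 2), by
          have := i.2; split_ifs <;> omega⟩ : Fin N))
        (fun i _ => by
          have := i.2
          rw [Finset.mem_coe, mem_half]
          cases s <;> simp; omega)
        (fun i _ j _ h => by
          simp only [Fin.mk.injEq, Nat.add_right_cancel_iff] at h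
          exact Fin.ext h)

/-- A block is a residue class modulo `3 * r` cut to one half, so it takes up a fixed fraction of
that half. -/
theorem card_cliqueBlock_ge {N k r t R : ℕ} (hk : k < 3) (ht : t < r) (hrR : r ≤ R)
    (hN : 100 * R ≤ N) (s : Bool) :
    (half N s).card ≤ 24 * R * (cliqueBlock N k r t s).card := by
  set q := N / 2 / (3 * r) with hq
  have hr : 0 < 3 * r := by omega
  have h1 : N / 2 < 3 * r * (q + 1) := by
    rw [hq]; exact Nat.lt_mul_div_succ _ hr
  have h2 : 3 * r * q ≤ N / 2 := Nat.mul_div_le _ _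
  have hq2 : 2 ≤ q := (Nat.le_div_iff_mul_le hr).mpr (by omega)
  have hB : q - 1 ≤ (cliqueBlock N k r t s).card := by
    -- The members `3 (r j' + t) + k` have `j' = j` for the first half and `j' = j + q + 1` for the
    -- second, which clears the midpoint since `N / 2 < 3 r (q + 1)`.
    have hv : ∀ j : Fin (q - 1),
        3 * (r * (j + (if s then 0 else q + 1)) + t) + k < N := fun j => by
      have hj := j.2
      have h3 : r * (j + (if s then 0 else q + 1)) + r ≤ r * (2 * q) := by
        have : (j : ℕ) + (if s then 0 else q + 1) + 1 ≤ 2 * q := by split_ifs <;> omega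
        calc r * (j + (if s then 0 else q + 1)) + r = r * (j + (if s then 0 else q + 1) + 1) := by ring
          _ ≤ _ := Nat.mul_le_mul_left r this
      have h4 : 3 * (r * (2 * q)) ≤ N := by
        have : 3 * (r * (2 * q)) = 2 * (3 * r * q) := by ring
        omega
      omega
    calc q - 1 = (Finset.univ : Finset (Fin (q - 1))).card := by simp
      _ ≤ _ := Finset.card_le_card_of_injOn (fun j => (⟨_, hv j⟩ : Fin N)) (fun j _ => ?_)
          fun i _ j _ h => ?_
    · have hj := j.2
      rw [Finset.mem_coe, cliqueBlock, Finset.mem_filter, mem_half]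
      simp only
      refine ⟨?_, by omega, ?_⟩
      · cases s
        · simp only [Bool.false_eq_true, if_false, decide_eq_false_iff_not, not_lt]
          have : 3 * r * (q + 1) ≤ 3 * (r * (j + (q + 1))) := by nlinarith
          omega
        · simp only [if_true, decide_eq_true_eq, add_zero]
          have : 3 * (r * (j + 1)) ≤ 3 * (r * q) :=
            Nat.mul_le_mul_left _ (Nat.mul_le_mul_left _ (by omega))
          have h5 : r * (j + 1) = r * j + r := by ring
          have h6 : 3 * (r * q) = 3 * r * q := by ring
          omega
      · have : (3 * (r * (j + (if s then 0 else q + 1)) + t) + k) / 3 =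
          r * (j + (if s then 0 else q + 1)) + t := by omega
        rw [this, Nat.mul_add_mod, Nat.mod_eq_of_lt ht]
    · simp only [Fin.mk.injEq] at h
      have h3 : r * (i + (if s then 0 else q + 1)) = r * (j + (if s then 0 else q + 1)) := by omega
      have h4 := Nat.eq_of_mul_eq_mul_left (by omega) h3
      exact Fin.ext (by omega)
  calc (half N s).card ≤ N / 2 + 1 := card_half_le N s
    _ ≤ 3 * r * (q + 1) := h1
    _ ≤ 24 * r * (q - 1) := by
        obtain ⟨q', hq'⟩ : ∃ q', q = q' + 2 := ⟨q - 2, by omega⟩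
        rw [hq', show q' + 2 - 1 = q' + 1 by omega]
        nlinarith
    _ ≤ 24 * R * (cliqueBlock N k r t s).card := by gcongr

/-- On vertices of mode `k`, `v ↦ v / 3` recovers the index, and the weight is an indicator. -/
theorem card_inter_cliqueBlock_le {p n k r : ℕ} (hp : 0 < p) (hn : p ≤ n) (hk : k < 3) (hr : 1 ≤ r)
    (C : Finset (Fin (3 * p))) (s : Bool) (t : Fin r) :
    ((C ∩ cliqueBlock (3 * p) k r t s).card : ℝ) ≤
      ∑ i : Fin n, if modLabel hr i = t then cliqueWeight hp k C i ^ 2 else 0 := by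
  have h1 : (∑ i : Fin n, if modLabel hr i = t then cliqueWeight hp k C i ^ 2 else 0) =
      ((Finset.univ.filter fun i : Fin n =>
        modLabel hr i = t ∧ (i : ℕ) < p ∧ vertex hp k i ∈ C).card : ℝ) := by
    rw [Finset.natCast_card_filter]
    refine Finset.sum_congr rfl fun i _ => ?_
    simp only [cliqueWeight]
    split_ifs <;> simp_all
  rw [h1]
  refine Nat.cast_le.mpr (Finset.card_le_card_of_injOn
    (fun v => (⟨(v : ℕ) / 3, by have := v.2; omega⟩ : Fin n)) (fun v hv => ?_) fun v hv w hw h => ?_)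
  · obtain ⟨hvC, hvB⟩ := Finset.mem_inter.mp hv
    obtain ⟨-, h3, h4⟩ := Finset.mem_filter.mp hvB
    have hv2 := v.2
    have hlt : (v : ℕ) / 3 < p := by omega
    have hvv : vertex hp k ((v : ℕ) / 3) = v := by
      apply Fin.ext
      rw [vertex_val hp hk hlt]; omega
    simp only [Finset.coe_filter, Finset.mem_univ, true_and]
    exact ⟨Fin.ext h4, hlt, by rw [hvv]; exact hvC⟩
  · obtain ⟨-, h3, -⟩ := Finset.mem_filter.mp (Finset.mem_inter.mp hv).2
    obtain ⟨-, h4, -⟩ := Finset.mem_filter.mp (Finset.mem_inter.mp hw).2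
    simp only [Fin.mk.injEq] at h
    exact Fin.ext (by omega)

/-- All blocks of mode `k` contain many vertices of `C`. -/
def BlocksFull (N k r : ℕ) (s : Bool) (h : ℝ) (C : Finset (Fin N)) : Prop :=
  ∀ t < r, h ≤ ((C ∩ cliqueBlock N k r t s).card : ℝ)

-- The mean intersection with a block is at least `κ / (24 R)`. Falling below half of it has
-- probability at most `96 R / κ` by Chebyshev, and a union over at most `R` labels gives `96 R² / κ
-- ≤ 1/300`, as `28800 = 96 * 300`.
open Classical in
theorem card_not_blocksFull_le {N k r R κ : ℕ} (hk : k < 3) (hrR : r ≤ R) (hR : 1 ≤ R)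
    (hN : 100 * R ≤ N) (hκ : 28800 * R ^ 2 ≤ κ) (hκN : κ ≤ N / 2) (s : Bool) :
    ((((half N s).powersetCard κ).filter
      fun C => ¬ BlocksFull N k r s (κ / (48 * R)) C).card : ℝ) ≤
      1 / 300 * ((half N s).powersetCard κ).card := by
  set P := (half N s).powersetCard κ with hP
  have hR1 : (1 : ℝ) ≤ R := by exact_mod_cast hR
  have hκ1 : 28800 * (R : ℝ) ^ 2 ≤ κ := by exact_mod_cast hκ
  have hκ0 : (0 : ℝ) < κ := lt_of_lt_of_le (by positivity) hκ1
  have hκ2 : 2 ≤ κ := by nlinarith [Nat.one_le_pow 2 R hR]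
  have hV := hκN.trans (half_le_card_half N s)
  have hV0 : (0 : ℝ) < (half N s).card := by exact_mod_cast (show 0 < (half N s).card by omega)
  have hone : ∀ t < r, ((P.filter fun C =>
      ((C ∩ cliqueBlock N k r t s).card : ℝ) < κ / (48 * R)).card : ℝ) ≤
      96 * R / κ * P.card := fun t ht => by
    set m : ℝ := κ * (cliqueBlock N k r t s).card / (half N s).card with hm
    have hmge : (κ : ℝ) / (24 * R) ≤ m := by
      rw [hm, div_le_div_iff₀ (by positivity) hV0]
      have : ((half N s).card : ℝ) ≤ 24 * R * (cliqueBlock N k r t s).card := by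
        exact_mod_cast card_cliqueBlock_ge hk ht hrR hN s
      nlinarith
    have hch := card_small_inter_le (V := half N s) (B := cliqueBlock N k r t s)
      (Finset.filter_subset _ _) hκ2 hV hm
    have hsub : ((P.filter fun C => ((C ∩ cliqueBlock N k r t s).card : ℝ) < κ / (48 * R)).card : ℝ) ≤
        (P.filter fun C => ((C ∩ cliqueBlock N k r t s).card : ℝ) < m / 2).card := by
      refine Nat.cast_le.mpr (Finset.card_le_card (Finset.monotone_filter_right _ fun C _ hC => ?_))
      refine lt_of_lt_of_le hC ?_
      have : (κ : ℝ) / (48 * R) = κ / (24 * R) / 2 := by field_simp; norm_num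
      rw [this]; linarith
    refine hsub.trans ?_
    have hmpos : 0 < (κ : ℝ) / (24 * R) := by positivity
    set x : ℝ := ((P.filter fun C => ((C ∩ cliqueBlock N k r t s).card : ℝ) < m / 2).card : ℝ)
    have hx : x * (κ / (24 * R)) ≤ 4 * P.card :=
      (mul_le_mul_of_nonneg_left hmge (Nat.cast_nonneg _)).trans hch
    calc x = x * (κ / (24 * R)) * (24 * R / κ) := by field_simp
      _ ≤ 4 * P.card * (24 * R / κ) := by gcongr
      _ = _ := by ring
  have hsub : (P.filter fun C => ¬ BlocksFull N k r s (κ / (48 * R)) C) ⊆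
      (Finset.range r).biUnion fun t => P.filter fun C =>
        ((C ∩ cliqueBlock N k r t s).card : ℝ) < κ / (48 * R) := by
    intro C hC
    obtain ⟨hCP, hC⟩ := Finset.mem_filter.mp hC
    simp only [BlocksFull, not_forall, not_le] at hC
    obtain ⟨t, ht, hlt⟩ := hC
    exact Finset.mem_biUnion.mpr ⟨t, Finset.mem_range.mpr ht, Finset.mem_filter.mpr ⟨hCP, hlt⟩⟩
  calc _ ≤ (((Finset.range r).biUnion fun t => P.filter fun C =>
        ((C ∩ cliqueBlock N k r t s).card : ℝ) < κ / (48 * R)).card : ℝ) :=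
        Nat.cast_le.mpr (Finset.card_le_card hsub)
    _ ≤ ∑ t ∈ Finset.range r, ((P.filter fun C =>
        ((C ∩ cliqueBlock N k r t s).card : ℝ) < κ / (48 * R)).card : ℝ) := by
        exact_mod_cast Finset.card_biUnion_le
    _ ≤ ∑ _t ∈ Finset.range r, 96 * R / κ * (P.card : ℝ) :=
        Finset.sum_le_sum fun t ht => hone t (Finset.mem_range.mp ht)
    _ = r * (96 * R / κ) * P.card := by simp; ring
    _ ≤ R * (96 * R / κ) * P.card := by gcongr
    _ ≤ 1 / 300 * P.card := by
        refine mul_le_mul_of_nonneg_right ?_ (Nat.cast_nonneg _)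
        rw [mul_div_assoc', div_le_iff₀ hκ0]
        nlinarith

/-- The triple of vertices attached to an entry. -/
def vertexTriple {p a b c : ℕ} (hp : 0 < p) (e : Idx a b c) :
    Fin (3 * p) × Fin (3 * p) × Fin (3 * p) :=
  (vertex hp 0 e.1, vertex hp 1 e.2.1, vertex hp 2 e.2.2)

/-- The hyperedge attached to an entry. -/
def edgeOf {p a b c : ℕ} (hp : 0 < p) (e : Idx a b c) : Finset (Fin (3 * p)) :=
  {vertex hp 0 e.1, vertex hp 1 e.2.1, vertex hp 2 e.2.2}

/-- The entries that are computed from hyperedges. -/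
def CliqueEntry {a b c r₁ r₂ r₃ : ℕ} (p : ℕ) (T : Finset (Fin r₁ × Fin r₂ × Fin r₃)) (hr₁ : 1 ≤ r₁)
    (hr₂ : 1 ≤ r₂) (hr₃ : 1 ≤ r₃) (e : Idx a b c) : Prop :=
  ((e.1 : ℕ) < p ∧ (e.2.1 : ℕ) < p ∧ (e.2.2 : ℕ) < p) ∧
    (modLabel hr₁ e.1, modLabel hr₂ e.2.1, modLabel hr₃ e.2.2) ∈ T

theorem edgeOf_card {p a b c : ℕ} (hp : 0 < p) (e : Idx a b c)
    (he : (e.1 : ℕ) < p ∧ (e.2.1 : ℕ) < p ∧ (e.2.2 : ℕ) < p) : (edgeOf hp e).card = 3 := by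
  have h0 := vertex_val hp (k := 0) (by omega) he.1
  have h1 := vertex_val hp (k := 1) (by omega) he.2.1
  have h2 := vertex_val hp (k := 2) (by omega) he.2.2
  rw [edgeOf, Finset.card_eq_three]
  refine ⟨_, _, _, fun h => ?_, fun h => ?_, fun h => ?_, rfl⟩ <;>
  · have := congrArg Fin.val h
    omega

/-- Residues modulo 3 order the vertices of an edge by mode, so distinct entries read distinct,
hence independent, edges. -/
theorem edgeOf_inj {p a b c : ℕ} (hp : 0 < p) (e e' : Idx a b c)
    (he : (e.1 : ℕ) < p ∧ (e.2.1 : ℕ) < p ∧ (e.2.2 : ℕ) < p)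
    (he' : (e'.1 : ℕ) < p ∧ (e'.2.1 : ℕ) < p ∧ (e'.2.2 : ℕ) < p)
    (h : edgeOf hp e = edgeOf hp e') : e = e' := by
  have h0 := vertex_val hp (k := 0) (by omega) he.1
  have h1 := vertex_val hp (k := 1) (by omega) he.2.1
  have h2 := vertex_val hp (k := 2) (by omega) he.2.2
  have h0' := vertex_val hp (k := 0) (by omega) he'.1
  have h1' := vertex_val hp (k := 1) (by omega) he'.2.1
  have h2' := vertex_val hp (k := 2) (by omega) he'.2.2
  have m0 : vertex hp 0 e.1 ∈ edgeOf hp e' := h ▸ (by simp [edgeOf])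
  have m1 : vertex hp 1 e.2.1 ∈ edgeOf hp e' := h ▸ (by simp [edgeOf])
  have m2 : vertex hp 2 e.2.2 ∈ edgeOf hp e' := h ▸ (by simp [edgeOf])
  simp only [edgeOf, Finset.mem_insert, Finset.mem_singleton, Fin.ext_iff] at m0 m1 m2
  refine Prod.ext (Fin.ext ?_) (Prod.ext (Fin.ext ?_) (Fin.ext ?_)) <;> omega

/-- The clique lies in one half, so its weights vanish on the other side, and full blocks supply
energy `h` in every mode. -/
theorem planted_clique {r₁ r₂ r₃ : ℕ} (hr₁ : 1 ≤ r₁) (hr₂ : 1 ≤ r₂) (hr₃ : 1 ≤ r₃)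
    {T : Finset (Fin r₁ × Fin r₂ × Fin r₃)} (hT : IsTransversal T) {a b c p : ℕ} (hp : 0 < p)
    (ha : p ≤ a) (hb : p ≤ b) (hc : p ≤ c) {lam m h : ℝ} (hlam : 0 < lam) (hh : 0 ≤ h)
    (hle : lam ^ 2 ≤ m ^ 2 * h ^ 3) {s : Bool} {C : Finset (Fin (3 * p))} (hC : C ⊆ half (3 * p) s)
    (h₁ : BlocksFull (3 * p) 0 r₁ s h C) (h₂ : BlocksFull (3 * p) 1 r₂ s h C)
    (h₃ : BlocksFull (3 * p) 2 r₃ s h C) :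
    Planted r₁ r₂ r₃ lam (cliqueSide (n := a) hp 0) (cliqueSide (n := b) hp 1)
      (cliqueSide (n := c) hp 2) s
      (blockTensor T (modLabel hr₁) (modLabel hr₂) (modLabel hr₃) m (cliqueWeight hp 0 C)
        (cliqueWeight hp 1 C) (cliqueWeight hp 2 C)) := by
  have hsupp : ∀ {n : ℕ} (k : ℕ) (i : Fin n), cliqueSide hp k i ≠ s → cliqueWeight hp k C i = 0 := by
    intro n k i hi
    rw [cliqueWeight, if_neg]
    rintro ⟨hip, hv⟩
    have := mem_half.mp (hC hv)
    exact hi (by simpa [cliqueSide, hip] using this)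
  refine planted_blockTensor hr₁ hr₂ hr₃ hT _ _ _ m _ _ _ (n₁ := h) (n₂ := h) (n₃ := h) hlam hh hh hh
    (fun t => (h₁ t t.2).trans (card_inter_cliqueBlock_le hp ha (by omega) hr₁ C s t))
    (fun t => (h₂ t t.2).trans (card_inter_cliqueBlock_le hp hb (by omega) hr₂ C s t))
    (fun t => (h₃ t t.2).trans (card_inter_cliqueBlock_le hp hc (by omega) hr₃ C s t))
    (hle.trans (le_of_eq (by ring))) _ _ _ s (hsupp 0) (hsupp 1) (hsupp 2)

-- Identifies the mean of the Gaussian data with the planted signal: shifted entries are exactly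
-- those whose edge is forced by the clique.
open Classical in
theorem blockTensor_clique_eq {r₁ r₂ r₃ : ℕ} (hr₁ : 1 ≤ r₁) (hr₂ : 1 ≤ r₂) (hr₃ : 1 ≤ r₃)
    (T : Finset (Fin r₁ × Fin r₂ × Fin r₃)) {a b c p : ℕ} (hp : 0 < p) (m : ℝ)
    (C : Finset (Fin (3 * p))) :
    (blockTensor T (modLabel hr₁) (modLabel hr₂) (modLabel hr₃) m (cliqueWeight hp 0 C)
        (cliqueWeight hp 1 C) (cliqueWeight hp 2 C) : Tensor a b c) =
      fun e => if CliqueEntry p T hr₁ hr₂ hr₃ e ∧ edgeOf hp e ∈ Finset.powersetCard 3 C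
        then m else 0 := by
  funext e
  have hmem : (CliqueEntry p T hr₁ hr₂ hr₃ e ∧ edgeOf hp e ∈ Finset.powersetCard 3 C) ↔
      ((modLabel hr₁ e.1, modLabel hr₂ e.2.1, modLabel hr₃ e.2.2) ∈ T ∧
      ((e.1 : ℕ) < p ∧ vertex hp 0 e.1 ∈ C) ∧ ((e.2.1 : ℕ) < p ∧ vertex hp 1 e.2.1 ∈ C) ∧
      ((e.2.2 : ℕ) < p ∧ vertex hp 2 e.2.2 ∈ C)) := by
    constructor
    · rintro ⟨⟨⟨h1, h2, h3⟩, hT⟩, hC⟩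
      have := (Finset.mem_powersetCard.mp hC).1
      simp only [edgeOf, Finset.insert_subset_iff, Finset.singleton_subset_iff] at this
      exact ⟨hT, ⟨h1, this.1⟩, ⟨h2, this.2.1⟩, ⟨h3, this.2.2⟩⟩
    · rintro ⟨hT, ⟨h1, c1⟩, ⟨h2, c2⟩, ⟨h3, c3⟩⟩
      refine ⟨⟨⟨h1, h2, h3⟩, hT⟩, Finset.mem_powersetCard.mpr ⟨?_, edgeOf_card hp e ⟨h1, h2, h3⟩⟩⟩
      simp only [edgeOf, Finset.insert_subset_iff, Finset.singleton_subset_iff]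
      exact ⟨c1, c2, c3⟩
  simp only [hmem, blockTensor, cliqueWeight]
  split_ifs <;> simp_all

theorem adjacency_vertexTriple {a b c p : ℕ} (hp : 0 < p) (E : Finset (Finset (Fin (3 * p))))
    (C : Finset (Fin (3 * p))) (e : Idx a b c) :
    adjacency (plantClique E C) (vertexTriple hp e) =
      decide (edgeOf hp e ∈ E ∨ edgeOf hp e ∈ Finset.powersetCard 3 C) := by
  simp only [adjacency, plantClique, Finset.mem_union]
  rfl

end CliqueReduction

/-! ### A deterministic clique test from a sign test on Gaussian data -/

section CliqueTest

open scoped NNReal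

theorem inv_pow_le_two {q : ℝ} {n : ℕ} (hq1 : q ≤ 1 / 8) (hn : n * q ≤ 1 / 8) :
    ((1 - q)⁻¹) ^ n ≤ 2 := by
  have h := one_add_mul_le_pow (a := -q) (by linarith) n
  have h1 : (1 / 2 : ℝ) ≤ (1 - q) ^ n := by
    have : (1 + -q) = 1 - q := by ring
    rw [this] at h
    linarith
  rw [inv_pow, inv_le_comm₀ (by linarith) (by norm_num)]
  linarith

/-- Chebyshev's inequality, so that finitely many bits hold the recorded channel outputs. -/
theorem not_fits_le {σ δ : ℝ} (hσ : 0 < σ) (hδ : 0 < δ) (ℓ : ℕ) :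
    (gaussianReal 0 (Real.toNNReal (σ ^ 2))).real
      {y | ¬ (-2 ^ ℓ ≤ ⌊y / δ⌋ ∧ ⌊y / δ⌋ < 2 ^ ℓ)} ≤ (σ / δ) ^ 2 / 4 ^ ℓ := by
  set v := Real.toNNReal (σ ^ 2) with hv
  have hvR : (v : ℝ) = σ ^ 2 := Real.coe_toNNReal _ (by positivity)
  have hc : 0 < δ * 2 ^ ℓ := by positivity
  have h := meas_ge_le_variance_div_sq (μ := gaussianReal 0 v) (memLp_id_gaussianReal 2) hc
  rw [variance_id_gaussianReal] at h
  simp only [id, integral_id_gaussianReal, sub_zero, hvR] at h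
  have hsub : {y : ℝ | ¬ (-2 ^ ℓ ≤ ⌊y / δ⌋ ∧ ⌊y / δ⌋ < 2 ^ ℓ)} ⊆ {y | δ * 2 ^ ℓ ≤ |y|} := by
    intro y hy
    by_contra hlt
    apply hy
    have hlt' : |y| < δ * 2 ^ ℓ := not_le.mp hlt
    obtain ⟨h1, h2⟩ := abs_lt.mp hlt'
    constructor
    · rw [Int.le_floor]
      push_cast
      rw [le_div_iff₀ hδ]
      linarith
    · rw [Int.floor_lt]
      push_cast
      rw [div_lt_iff₀ hδ]
      linarith
  calc _ ≤ (gaussianReal 0 v).real {y | δ * 2 ^ ℓ ≤ |y|} := measureReal_mono hsub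
    _ ≤ σ ^ 2 / (δ * 2 ^ ℓ) ^ 2 := ENNReal.toReal_le_of_le_ofReal (by positivity) h
    _ = _ := by
        have h4 : (4 : ℝ) ^ ℓ = (2 ^ ℓ) ^ 2 := by
          rw [← pow_mul, mul_comm, pow_mul]; norm_num
        rw [h4, mul_pow, div_pow, div_div]

/-- The channels turn the hypergraph into tensor data on which the sign test errs rarely on average
over the channel randomness. Some outcome of that randomness is then good on average over
hypergraphs and cliques and also fits in `ℓ` bits. Its records are `q₀` and `q₁`. -/
theorem exists_clique_test {r₁ r₂ r₃ R : ℕ} (hr₁ : 1 ≤ r₁) (hr₂ : 1 ≤ r₂) (hr₃ : 1 ≤ r₃)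
    (hR₁ : r₁ ≤ R) (hR₂ : r₂ ≤ R) (hR₃ : r₃ ≤ R)
    {T : Finset (Fin r₁ × Fin r₂ × Fin r₃)} (hT : IsTransversal T) {a b c p κ ℓ : ℕ} (hp : 0 < p)
    (ha : p ≤ a) (hb : p ≤ b) (hc : p ≤ c) (hN : 100 * R ≤ 3 * p) (hκ : 28800 * R ^ 2 ≤ κ)
    (hκp : κ ≤ 3 * p / 2) {lam σ δ μ : ℝ} (hlam : 0 < lam) (hσ : 0 < σ) (hδ : 0 < δ) (hμ : 0 < μ)
    (hμ' : μ ≤ 1 / 2) (hq : 8 * (a * b * c) * Real.exp (-1 / (32 * μ ^ 2)) ≤ 1)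
    (hle : lam ^ 2 ≤ (μ * σ) ^ 2 * (κ / (48 * R)) ^ 3)
    (hℓ : 40 * (a * b * c) * (σ / δ) ^ 2 ≤ 4 ^ ℓ) (D : (Idx a b c → ℤ) → ℤ)
    (h : ∀ s X, Planted r₁ r₂ r₃ lam (cliqueSide (n := a) hp 0) (cliqueSide (n := b) hp 1)
      (cliqueSide (n := c) hp 2) s X →
      noise a b c σ {Z | SignErr s (D (record δ (X + Z)))} ≤ ENNReal.ofReal (1 / 16)) :
    ∃ q₀ q₁ : Idx a b c → ℤ, FitsIn ℓ q₀ ∧ FitsIn ℓ q₁ ∧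
      cliqueRisk κ (fun A : Fin (3 * p) × Fin (3 * p) × Fin (3 * p) → Bool =>
        decide (D (fun e => if A (vertexTriple hp e) then q₁ e else q₀ e) < 0)) ≤ 9 / 20 := by
  classical
  set v := Real.toNNReal (σ ^ 2) with hv
  have ha1 : (1 : ℝ) ≤ a := by exact_mod_cast (show 1 ≤ a by omega)
  have hb1 : (1 : ℝ) ≤ b := by exact_mod_cast (show 1 ≤ b by omega)
  have hc1 : (1 : ℝ) ≤ c := by exact_mod_cast (show 1 ≤ c by omega)
  have habc : (1 : ℝ) ≤ a * b * c := one_le_mul_of_one_le_of_one_le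
    (one_le_mul_of_one_le_of_one_le ha1 hb1) hc1
  have hcard : (Fintype.card (Idx a b c) : ℝ) = a * b * c := by
    simp [Idx, mul_assoc]
  have hR1 : (1 : ℝ) ≤ R := by exact_mod_cast hr₁.trans hR₁
  set x := Real.exp (-1 / (32 * μ ^ 2)) with hx
  have hx0 : 0 < x := Real.exp_pos _
  have hx8 : x ≤ 1 / 8 := by nlinarith
  obtain ⟨K, T', q, hKp, hKadd, hK1, hq0, hqx⟩ := exists_channel hσ hμ hμ' hx8
  set g := gaussianReal 0 v with hg
  set Dom : Idx a b c → Prop := CliqueEntry p T hr₁ hr₂ hr₃ with hDom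
  set F : Idx a b c → Bool → Measure ℝ := fun e b => if Dom e then K b else g with hF
  have hFp : ∀ e b, IsProbabilityMeasure (F e b) := fun e b => by
    simp only [hF]; split_ifs <;> infer_instance
  -- Both channel laws sit below twice the noise, so tail bounds for the noise transfer to them.
  have hF2 : ∀ e b (S : Set ℝ), (F e b).real S ≤ 2 * g.real S := fun e b S => by
    simp only [hF]
    split_ifs
    · have h1 : K b S ≤ 2 * g S := by
        have h2 := congrArg (fun ν : Measure ℝ => ν S) hKadd
        simp only [Measure.add_apply, Measure.smul_apply, smul_eq_mul] at h2
        rw [← h2]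
        cases b
        · exact le_self_add
        · exact le_add_self
      have h2 := ENNReal.toReal_mono (ENNReal.mul_ne_top ENNReal.ofNat_ne_top (measure_ne_top g S)) h1
      simpa [Measure.real] using h2
    · have : 0 ≤ g.real S := measureReal_nonneg
      linarith
  -- Both possible outputs of every entry are drawn in advance, independently of the hypergraph,
  -- whose bits merely select. This makes the randomness something that can be fixed.
  set Ω := Measure.pi fun eb : Idx a b c × Bool => F eb.1 eb.2 with hΩ
  set W : Bool → Set (Tensor a b c) := fun s => {Y | SignErr s (D (record δ Y))} with hW
  have hWm : ∀ s, MeasurableSet (W s) := fun s => measurableSet_record δ fun q => SignErr s (D q)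
  set bit : Finset (Finset (Fin (3 * p))) → Finset (Fin (3 * p)) → Idx a b c → Bool :=
    fun E C e => decide (edgeOf hp e ∈ E ∨ edgeOf hp e ∈ Finset.powersetCard 3 C) with hbit
  set G : Bool → Finset (Finset (Fin (3 * p))) → Finset (Fin (3 * p)) →
    Set (Idx a b c × Bool → ℝ) := fun s E C => {ω | (fun e => ω (e, bit E C e)) ∈ W s} with hG
  have hsel : ∀ E C, Measurable fun (ω : Idx a b c × Bool → ℝ) e => ω (e, bit E C e) := fun E C =>
    measurable_pi_lambda _ fun e => measurable_pi_apply _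
  have hGm : ∀ s E C, MeasurableSet (G s E C) := fun s E C => hsel E C (hWm s)
  set H := hypergraphs (3 * p) with hH
  set PC : Bool → Finset (Finset (Fin (3 * p))) := fun s => (half (3 * p) s).powersetCard κ with hPC
  have hHc : H.card = 2 ^ (Finset.powersetCard 3 (Finset.univ : Finset (Fin (3 * p)))).card :=
    Finset.card_powerset _
  have hH0 : (0 : ℝ) < H.card := by rw [hHc]; positivity
  have hPC0 : ∀ s, (0 : ℝ) < (PC s).card := fun s => by
    rw [hPC, Finset.card_powersetCard]
    exact_mod_cast Nat.choose_pos (hκp.trans (half_le_card_half _ s))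
  -- average error over hypergraphs for a fixed clique
  have havg : ∀ s C, ∑ E ∈ H, Ω.real (G s E C) = H.card * (Measure.pi fun e =>
      if Dom e ∧ edgeOf hp e ∈ Finset.powersetCard 3 C then F e true else g).real (W s) := by
    intro s C
    have h1 : ∀ E ∈ H, Ω.real (G s E C) = (Measure.pi fun e => F e (bit E C e)).real (W s) :=
      fun E _ => by
        rw [← map_select_pi F (bit E C), Measure.real, Measure.real,
          Measure.map_apply (hsel E C) (hWm s)]
        rfl
    rw [Finset.sum_congr rfl h1, hHc]
    have h2 := sum_powerset_pi (Finset.powersetCard 3 (Finset.univ : Finset (Fin (3 * p)))) Dom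
      (edgeOf hp) (fun e he => Finset.mem_powersetCard.mpr ⟨Finset.subset_univ _,
        edgeOf_card hp e he.1⟩) (fun e e' he he' hee => edgeOf_inj hp e e' he.1 he'.1 hee)
      (fun x => x ∈ Finset.powersetCard 3 C) F g
      (fun e he => by simp only [hF, if_pos he]; exact hKadd)
      (fun e b he => by simp only [hF, if_neg he]) (W s)
    push_cast
    convert h2
    rw [hH, hypergraphs]
  have hprobM : ∀ C : Finset (Fin (3 * p)), ∀ e, IsProbabilityMeasure
      (if Dom e ∧ edgeOf hp e ∈ Finset.powersetCard 3 C then F e true else g) := fun C e => by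
    split_ifs <;> infer_instance
  set full : Bool → Finset (Fin (3 * p)) → Prop := fun s C =>
    BlocksFull (3 * p) 0 r₁ s (κ / (48 * R)) C ∧ BlocksFull (3 * p) 1 r₂ s (κ / (48 * R)) C ∧
      BlocksFull (3 * p) 2 r₃ s (κ / (48 * R)) C with hfull
  -- Truncation costs at most a factor `(1 - q)⁻¹ ^ n ≤ 2`, so the error 1/16 under signal plus
  -- noise becomes at most 1/8.
  have hgood : ∀ s, ∀ C ∈ PC s, full s C → (Measure.pi fun e =>
      if Dom e ∧ edgeOf hp e ∈ Finset.powersetCard 3 C then F e true else g).real (W s) ≤ 1 / 8 := by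
    intro s C hCs hCf
    have hCsub : C ⊆ half (3 * p) s := (Finset.mem_powersetCard.mp hCs).1
    have hpl := planted_clique hr₁ hr₂ hr₃ hT hp ha hb hc hlam (m := μ * σ) (h := κ / (48 * R))
      (by positivity) hle hCsub hCf.1 hCf.2.1 hCf.2.2
    have hnoise := h s _ hpl
    rw [blockTensor_clique_eq hr₁ hr₂ hr₃ T hp (μ * σ) C] at hnoise
    set X : Tensor a b c := fun e => if CliqueEntry p T hr₁ hr₂ hr₃ e ∧
      edgeOf hp e ∈ Finset.powersetCard 3 C then μ * σ else 0 with hX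
    have h1 : (Measure.pi fun e => gaussianReal (X e) v) (W s) ≤ ENNReal.ofReal (1 / 16) := by
      rw [← map_noise_add σ X, Measure.map_apply (measurable_const_add X) (hWm s)]
      exact hnoise
    have h2 := pi_truncated_le hK1
      (fun e => Dom e ∧ edgeOf hp e ∈ Finset.powersetCard 3 C) (W s)
    have h3 : (fun e => if Dom e ∧ edgeOf hp e ∈ Finset.powersetCard 3 C then F e true else g) =
        fun e => if Dom e ∧ edgeOf hp e ∈ Finset.powersetCard 3 C then K true else g := by
      funext e
      split_ifs with he
      · simp only [hF, if_pos he.1]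
      · rfl
    rw [h3]
    set n := (Finset.univ.filter fun e => Dom e ∧ edgeOf hp e ∈ Finset.powersetCard 3 C).card
    have hn : (n : ℝ) ≤ a * b * c := by
      rw [← hcard]; exact_mod_cast Finset.card_le_univ _
    have hpow : ENNReal.ofReal (1 - q)⁻¹ ^ n ≤ ENNReal.ofReal 2 := by
      rw [← ENNReal.ofReal_pow (inv_nonneg.mpr (by linarith))]
      refine ENNReal.ofReal_le_ofReal (inv_pow_le_two (hqx.trans hx8) ?_)
      calc (n : ℝ) * q ≤ (a * b * c) * x := by gcongr
        _ ≤ 1 / 8 := by linarith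
    refine ENNReal.toReal_le_of_le_ofReal (by norm_num) (h2.trans ?_)
    rw [Measure.smul_apply, smul_eq_mul]
    calc _ ≤ ENNReal.ofReal 2 * ENNReal.ofReal (1 / 16) := mul_le_mul' hpow h1
      _ = ENNReal.ofReal (1 / 8) := by rw [← ENNReal.ofReal_mul (by norm_num)]; norm_num
  have hbad : ∀ s, (((PC s).filter fun C => ¬ full s C).card : ℝ) ≤ 1 / 100 * (PC s).card := by
    intro s
    have hR1' := hr₁.trans hR₁
    have b1 := card_not_blocksFull_le (k := 0) (by omega) hR₁ hR1' hN hκ hκp s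
    have b2 := card_not_blocksFull_le (k := 1) (by omega) hR₂ hR1' hN hκ hκp s
    have b3 := card_not_blocksFull_le (k := 2) (by omega) hR₃ hR1' hN hκ hκp s
    have hsub : ((PC s).filter fun C => ¬ full s C) ⊆
        ((PC s).filter fun C => ¬ BlocksFull (3 * p) 0 r₁ s (κ / (48 * R)) C) ∪
        (((PC s).filter fun C => ¬ BlocksFull (3 * p) 1 r₂ s (κ / (48 * R)) C) ∪
        ((PC s).filter fun C => ¬ BlocksFull (3 * p) 2 r₃ s (κ / (48 * R)) C)) := by
      intro C hC
      simp only [Finset.mem_union, Finset.mem_filter, hfull] at hC ⊢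
      tauto
    have hcu := (Finset.card_le_card hsub).trans ((Finset.card_union_le _ _).trans
      (Nat.add_le_add_left (Finset.card_union_le _ _) _))
    have hcu' : (((PC s).filter fun C => ¬ full s C).card : ℝ) ≤ _ := Nat.cast_le.mpr hcu
    push_cast at hcu'
    linarith
  have hside : ∀ s, ∑ C ∈ PC s, ∑ E ∈ H, Ω.real (G s E C) ≤
      (1 / 8 + 1 / 100) * ((H.card : ℝ) * (PC s).card) := by
    intro s
    simp only [havg]
    have h1 : ∀ C ∈ PC s, (H.card : ℝ) * (Measure.pi fun e =>
        if Dom e ∧ edgeOf hp e ∈ Finset.powersetCard 3 C then F e true else g).real (W s) ≤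
        H.card * (1 / 8 + if ¬ full s C then 1 else 0) := fun C hC => by
      refine mul_le_mul_of_nonneg_left ?_ hH0.le
      by_cases hf : full s C
      · simpa [hf] using hgood s C hC hf
      · rw [if_pos hf]
        exact measureReal_le_one.trans (by norm_num)
    refine (Finset.sum_le_sum h1).trans ?_
    rw [← Finset.mul_sum, Finset.sum_add_distrib, ← Finset.natCast_card_filter, Finset.sum_const,
      nsmul_eq_mul]
    have := hbad s
    nlinarith
  -- the risk of the test with fixed randomness
  set err : Bool → (Idx a b c × Bool → ℝ) → ℝ := fun s ω =>
    (∑ C ∈ PC s, ∑ E ∈ H, (G s E C).indicator (fun _ => (1 : ℝ)) ω) / (H.card * (PC s).card) with herr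
  have herrint : ∀ s, Integrable (err s) Ω := fun s =>
    (integrable_finsetSum _ fun C _ => integrable_finsetSum _ fun E _ =>
      (integrable_const (1 : ℝ)).indicator (hGm s E C)).div_const _
  have herr0 : ∀ s ω, 0 ≤ err s ω := fun s ω => div_nonneg (Finset.sum_nonneg fun C _ =>
    Finset.sum_nonneg fun E _ => Set.indicator_nonneg (fun _ _ => zero_le_one) _)
    (mul_nonneg hH0.le (hPC0 s).le)
  have herrle : ∀ s, ∫ ω, err s ω ∂Ω ≤ 1 / 8 + 1 / 100 := fun s => by
    rw [herr]
    simp only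
    rw [integral_div, div_le_iff₀ (mul_pos hH0 (hPC0 s)),
      integral_finsetSum _ fun C _ => integrable_finsetSum _ fun E _ =>
        (integrable_const (1 : ℝ)).indicator (hGm s E C)]
    refine le_trans (le_of_eq (Finset.sum_congr rfl fun C _ => ?_)) (hside s)
    rw [integral_finsetSum _ fun E _ => (integrable_const (1 : ℝ)).indicator (hGm s E C)]
    refine Finset.sum_congr rfl fun E _ => ?_
    rw [integral_indicator_const _ (hGm s E C)]
    simp
  set Bad : Set (Idx a b c × Bool → ℝ) :=
    ⋃ eb, {ω | ¬ (-2 ^ ℓ ≤ ⌊ω eb / δ⌋ ∧ ⌊ω eb / δ⌋ < 2 ^ ℓ)} with hBad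
  have hset : MeasurableSet {y : ℝ | ¬ (-2 ^ ℓ ≤ ⌊y / δ⌋ ∧ ⌊y / δ⌋ < 2 ^ ℓ)} :=
    (Int.measurable_floor.comp (measurable_id.div_const δ))
      ((Set.to_countable {z : ℤ | ¬ (-2 ^ ℓ ≤ z ∧ z < 2 ^ ℓ)}).measurableSet)
  have hBadm : MeasurableSet Bad := MeasurableSet.iUnion fun eb =>
    (measurable_pi_apply eb : Measurable fun ω : Idx a b c × Bool → ℝ => ω eb) hset
  have hBadle : Ω.real Bad ≤ 1 / 10 := by
    have h1 : ∀ eb : Idx a b c × Bool, Ω.real {ω | ¬ (-2 ^ ℓ ≤ ⌊ω eb / δ⌋ ∧ ⌊ω eb / δ⌋ < 2 ^ ℓ)} ≤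
        2 * ((σ / δ) ^ 2 / 4 ^ ℓ) := fun eb => by
      have h2 := (measurePreserving_eval (fun eb : Idx a b c × Bool => F eb.1 eb.2) eb).measure_preimage
        hset.nullMeasurableSet
      have h3 : Ω.real {ω | ¬ (-2 ^ ℓ ≤ ⌊ω eb / δ⌋ ∧ ⌊ω eb / δ⌋ < 2 ^ ℓ)} =
          (F eb.1 eb.2).real {y : ℝ | ¬ (-2 ^ ℓ ≤ ⌊y / δ⌋ ∧ ⌊y / δ⌋ < 2 ^ ℓ)} := by
        rw [Measure.real, Measure.real, ← h2]; rfl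
      rw [h3]
      exact (hF2 _ _ _).trans (mul_le_mul_of_nonneg_left (not_fits_le hσ hδ ℓ) (by norm_num))
    calc Ω.real Bad ≤ ∑ eb, Ω.real {ω | ¬ (-2 ^ ℓ ≤ ⌊ω eb / δ⌋ ∧ ⌊ω eb / δ⌋ < 2 ^ ℓ)} :=
          measureReal_iUnion_fintype_le _
      _ ≤ ∑ _eb : Idx a b c × Bool, 2 * ((σ / δ) ^ 2 / 4 ^ ℓ) := Finset.sum_le_sum fun eb _ => h1 eb
      _ = (a * b * c * 2) * (2 * ((σ / δ) ^ 2 / 4 ^ ℓ)) := by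
          rw [Finset.sum_const, Finset.card_univ, Fintype.card_prod, nsmul_eq_mul]
          push_cast
          rw [hcard]; simp
      _ = 40 * (a * b * c) * (σ / δ) ^ 2 / 4 ^ ℓ / 10 := by ring
      _ ≤ 1 / 10 := by
          have : 40 * (a * b * c) * (σ / δ) ^ 2 / 4 ^ ℓ ≤ 1 := by
            rw [div_le_one (by positivity)]; exact hℓ
          linarith
  -- Otherwise the mean of the total error would be at least `(9/20) * (9/10) = 0.405`, but it is at
  -- most `2 * (1/8 + 1/100) = 0.27`.
  obtain ⟨ω, hω, hωerr⟩ : ∃ ω, ω ∉ Bad ∧ err true ω + err false ω ≤ 9 / 20 := by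
    by_contra hcon
    push Not at hcon
    have h1 : ∫ ω, Badᶜ.indicator (fun _ => (9 / 20 : ℝ)) ω ∂Ω ≤
        ∫ ω, (err true ω + err false ω) ∂Ω := by
      refine integral_mono ((integrable_const _).indicator hBadm.compl)
        ((herrint true).add (herrint false)) fun ω => ?_
      by_cases hω : ω ∈ Bad
      · rw [Set.indicator_of_notMem (by simpa using hω)]
        exact add_nonneg (herr0 _ _) (herr0 _ _)
      · rw [Set.indicator_of_mem (by simpa using hω)]
        exact (hcon ω hω).le
    rw [integral_add (herrint true) (herrint false), integral_indicator_const _ hBadm.compl,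
      probReal_compl_eq_one_sub hBadm, smul_eq_mul] at h1
    linarith [herrle true, herrle false]
  have hfit : ∀ e b, -2 ^ ℓ ≤ ⌊ω (e, b) / δ⌋ ∧ ⌊ω (e, b) / δ⌋ < 2 ^ ℓ := fun e b => by
    by_contra hcon
    exact hω (Set.mem_iUnion.mpr ⟨(e, b), hcon⟩)
  refine ⟨fun e => ⌊ω (e, false) / δ⌋, fun e => ⌊ω (e, true) / δ⌋, fun e => hfit e false,
    fun e => hfit e true, ?_⟩
  have hD : ∀ E C, (fun e => if adjacency (plantClique E C) (vertexTriple hp e) = true then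
      ⌊ω (e, true) / δ⌋ else ⌊ω (e, false) / δ⌋) = record δ fun e => ω (e, bit E C e) := by
    intro E C
    funext e
    rw [adjacency_vertexTriple hp E C e]
    simp only [record, hbit]
    split_ifs with hh
    · rw [hh]
    · rw [Bool.not_eq_true] at hh; rw [hh]
  have hprob : ∀ s, plantedProb κ (half (3 * p) s) (fun A => SignErr s
      (D (fun e => if A (vertexTriple hp e) then ⌊ω (e, true) / δ⌋ else ⌊ω (e, false) / δ⌋))) =
      err s ω := by
    intro s
    rw [plantedProb, herr]
    simp only
    rw [Finset.card_product, Finset.natCast_card_filter, Finset.sum_product_right]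
    push_cast
    congr 1
    refine Finset.sum_congr rfl fun C _ => Finset.sum_congr rfl fun E _ => ?_
    rw [hD E C, Set.indicator_apply]
    rfl
  calc _ = err true ω + err false ω := by
        rw [← hprob true, ← hprob false, cliqueRisk]
        congr 1
        · simp [SignErr, half]
        · simp [SignErr, half]
    _ ≤ 9 / 20 := hωerr

end CliqueTest

/-! ## Clique sizes below the computational threshold -/

/-- A clique size that exceeds `N ^ ((1 - τ) / 2)` by a logarithmic factor. -/
def cliqueSize (τ : ℝ) (N : ℕ) : ℕ :=
  max 1 (min (N / 2) ⌊(N : ℝ) ^ ((1 - τ) / 2) * Real.log N⌋₊)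

theorem cliqueSize_bounds (τ : ℝ) {N : ℕ} (hN : 2 ≤ N) :
    1 ≤ cliqueSize τ N ∧ cliqueSize τ N ≤ N / 2 :=
  ⟨le_max_left _ _, max_le (by omega) (min_le_left _ _)⟩

theorem tendsto_log_natCast : Tendsto (fun N : ℕ => Real.log N) atTop atTop :=
  Real.tendsto_log_atTop.comp tendsto_natCast_atTop_atTop

/-- The logarithmic factor adds only `2 log log N / log N`, which tends to 0. -/
theorem limsup_log_cliqueSize_le {τ : ℝ} (hτ : τ < 1) :
    limsup (fun N : ℕ => Real.log (cliqueSize τ N) / Real.log (Real.sqrt N)) atTop ≤ 1 - τ := by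
  have hlim : Tendsto (fun N : ℕ => (1 - τ) + 2 * (Real.log (Real.log N) / Real.log N)) atTop
      (nhds (1 - τ)) := by
    have h1 : Tendsto (fun x : ℝ => Real.log x / x) atTop (nhds 0) := by
      simpa using Real.isLittleO_log_id_atTop.tendsto_div_nhds_zero
    simpa using ((h1.comp tendsto_log_natCast).const_mul 2).const_add (1 - τ)
  have hle : ∀ᶠ N : ℕ in atTop, Real.log (cliqueSize τ N) / Real.log (Real.sqrt N) ≤
      (1 - τ) + 2 * (Real.log (Real.log N) / Real.log N) := by
    filter_upwards [tendsto_log_natCast.eventually_ge_atTop 1, eventually_ge_atTop 1] with N hL hN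
    have hN' : (1 : ℝ) ≤ N := by exact_mod_cast hN
    have hpow : 1 ≤ (N : ℝ) ^ ((1 - τ) / 2) := Real.one_le_rpow hN' (by linarith)
    have hk : (cliqueSize τ N : ℝ) ≤ (N : ℝ) ^ ((1 - τ) / 2) * Real.log N := by
      have h1 : 1 ≤ (N : ℝ) ^ ((1 - τ) / 2) * Real.log N := one_le_mul_of_one_le_of_one_le hpow hL
      have h2 : cliqueSize τ N ≤ max 1 ⌊(N : ℝ) ^ ((1 - τ) / 2) * Real.log N⌋₊ :=
        max_le_max le_rfl (min_le_right _ _)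
      refine (Nat.cast_le.mpr h2).trans ?_
      push_cast
      exact max_le h1 (Nat.floor_le (by linarith))
    have h1 : (0 : ℝ) < cliqueSize τ N := by
      exact_mod_cast Nat.lt_of_lt_of_le Nat.zero_lt_one (le_max_left _ _)
    have h2 := Real.log_le_log h1 hk
    rw [Real.log_mul (by positivity) (by positivity), Real.log_rpow (by linarith)] at h2
    rw [Real.log_sqrt (by linarith), div_le_iff₀ (by linarith)]
    have h3 : Real.log (Real.log N) / Real.log N * Real.log N = Real.log (Real.log N) :=
      div_mul_cancel₀ _ (by linarith)
    calc _ ≤ _ := h2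
      _ = (1 - τ) * (Real.log N / 2) + Real.log (Real.log N) := by ring
      _ = (1 - τ) * (Real.log N / 2) + Real.log (Real.log N) / Real.log N * Real.log N := by rw [h3]
      _ = _ := by ring
  have hnn : ∀ N : ℕ, 0 ≤ Real.log (cliqueSize τ N) / Real.log (Real.sqrt N) := fun N => by
    rcases Nat.eq_zero_or_pos N with rfl | hN
    · simp
    · refine div_nonneg (Real.log_natCast_nonneg _) (Real.log_nonneg ?_)
      rw [Real.one_le_sqrt]
      exact_mod_cast hN
  calc _ ≤ limsup (fun N : ℕ => (1 - τ) + 2 * (Real.log (Real.log N) / Real.log N)) atTop :=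
        limsup_le_limsup hle (IsBoundedUnder.isCoboundedUnder_le (isBoundedUnder_of ⟨0, hnn⟩))
          hlim.isBoundedUnder_le
    _ = _ := hlim.limsup_eq

/-- The logarithm beats any constant `M`, and the cap `N / 2` is eventually inactive since `log N`
is negligible against `N ^ ((1 + τ) / 2)`. -/
theorem eventually_mul_rpow_le_cliqueSize {τ : ℝ} (hτ0 : 0 < τ) (hτ : τ < 1) (M : ℝ) :
    ∀ᶠ N : ℕ in atTop, M * (N : ℝ) ^ ((1 - τ) / 2) ≤ cliqueSize τ N := by
  have h1 : Tendsto (fun x : ℝ => Real.log x / x ^ ((1 + τ) / 2)) atTop (nhds 0) :=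
    (isLittleO_log_rpow_atTop (by linarith)).tendsto_div_nhds_zero
  have h2 : ∀ᶠ N : ℕ in atTop, Real.log N / (N : ℝ) ^ ((1 + τ) / 2) < 1 / 4 :=
    (h1.comp tendsto_natCast_atTop_atTop).eventually (gt_mem_nhds (by norm_num))
  filter_upwards [h2, tendsto_log_natCast.eventually_ge_atTop (|M| + 1), eventually_ge_atTop 2]
    with N hN hL hN2
  have hN0 : (0 : ℝ) < N := by exact_mod_cast (show 0 < N by omega)
  have hN1 : (1 : ℝ) ≤ N := by exact_mod_cast (show 1 ≤ N by omega)
  set y := (N : ℝ) ^ ((1 - τ) / 2) * Real.log N with hy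
  have hpow : 1 ≤ (N : ℝ) ^ ((1 - τ) / 2) := Real.one_le_rpow hN1 (by linarith)
  have hMN : M * (N : ℝ) ^ ((1 - τ) / 2) ≤ y - 1 := by
    have := le_abs_self M
    nlinarith
  have hyN : y ≤ N / 4 := by
    rw [div_lt_iff₀ (by positivity)] at hN
    have h3 : (N : ℝ) ^ ((1 - τ) / 2) * (N : ℝ) ^ ((1 + τ) / 2) = N := by
      rw [← Real.rpow_add hN0]
      ring_nf
      simp
    nlinarith
  have hfl : y - 1 < ⌊y⌋₊ := Nat.sub_one_lt_floor y
  have hy0 : 0 ≤ y := mul_nonneg (by positivity) (Real.log_natCast_nonneg _)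
  have hfl2 : ⌊y⌋₊ ≤ N / 2 := by
    have h4 : (⌊y⌋₊ : ℝ) ≤ N / 4 := (Nat.floor_le hy0).trans hyN
    have h5 : ((4 * ⌊y⌋₊ : ℕ) : ℝ) ≤ N := by push_cast; linarith
    have h6 : 4 * ⌊y⌋₊ ≤ N := by exact_mod_cast h5
    omega
  have h7 : (⌊y⌋₊ : ℝ) ≤ cliqueSize τ N := by
    exact_mod_cast (le_min hfl2 le_rfl).trans (le_max_right _ _)
  linarith

/-! ## Consequence of the hypothesis for circuits -/

theorem plantedProb_nonneg {N : ℕ} (κ : ℕ) (V : Finset (Fin N))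
    (Q : (Fin N × Fin N × Fin N → Bool) → Prop) : 0 ≤ plantedProb κ V Q := by
  unfold plantedProb
  positivity

theorem not_frequently_circuit {τ : ℝ} (hτ : τ < 1) (H : HypothesisH τ) (c : ℕ) :
    ¬ ∃ᶠ N in atTop, ∃ D : Circuit (Fin N × Fin N × Fin N) Unit, D.size ≤ (N + 2) ^ c ∧
      cliqueRisk (cliqueSize τ N) (fun A => D.eval A ()) ≤ 9 / 20 := by
  classical
  intro hfr
  set G : ∀ N, Circuit (Fin N × Fin N × Fin N) Unit → Prop := fun N D => D.size ≤ (N + 2) ^ c ∧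
      cliqueRisk (cliqueSize τ N) (fun A => D.eval A ()) ≤ 9 / 20 with hG
  -- A non-uniform choice: a good circuit where one exists and the empty circuit elsewhere.
  -- Infinitely many good `N` already push the liminf down to 9/20.
  set D : ∀ N, Circuit (Fin N × Fin N × Fin N) Unit := fun N =>
    if h : ∃ D, G N D then h.choose else ⟨[], fun _ => 0⟩ with hD
  have hDG : ∀ N, (∃ D, G N D) → G N (D N) := fun N h => by
    simp only [hD, dif_pos h]
    exact h.choose_spec
  have h := H (cliqueSize τ) (fun N hN => cliqueSize_bounds τ hN) (limsup_log_cliqueSize_le hτ)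
    (fun N A => (D N).eval A ()) ⟨c, fun N => ⟨D N, ?_, fun A => rfl⟩⟩
  · have h2 : liminf (fun N => cliqueRisk (cliqueSize τ N) fun A => (D N).eval A ()) atTop ≤ 9 / 20 :=
      liminf_le_of_frequently_le (hfr.mono fun N hN => (hDG N hN).2)
        (isBoundedUnder_of ⟨0, fun N => add_nonneg (plantedProb_nonneg _ _ _)
          (plantedProb_nonneg _ _ _)⟩)
    linarith
  · by_cases hN : ∃ D, G N D
    · exact (hDG N hN).1
    · simp [hD, dif_neg hN, Circuit.size]

/-! ## Polynomial bounds -/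

theorem add_le_pow_add {x a b i j : ℕ} (hx : 2 ≤ x) (ha : a ≤ x ^ i) (hb : b ≤ x ^ j) :
    a + b ≤ x ^ (i + j + 1) := by
  have h1 : x ^ i ≤ x ^ (i + j) := Nat.pow_le_pow_right (by omega) (by omega)
  have h2 : x ^ j ≤ x ^ (i + j) := Nat.pow_le_pow_right (by omega) (by omega)
  rw [pow_succ]
  nlinarith

theorem mul_le_pow_add {x a b i j : ℕ} (ha : a ≤ x ^ i) (hb : b ≤ x ^ j) : a * b ≤ x ^ (i + j) := by
  rw [pow_add]
  exact Nat.mul_le_mul ha hb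

theorem pow_le_pow_mul {x a i : ℕ} (ha : a ≤ x ^ i) (j : ℕ) : a ^ j ≤ x ^ (i * j) := by
  rw [pow_mul]
  exact Nat.pow_le_pow_left ha j

theorem le_pow_self_of_two_le {x : ℕ} (hx : 2 ≤ x) (k : ℕ) : k ≤ x ^ k :=
  (Nat.lt_pow_self (by omega)).le

theorem exists_size_bound (cB cJ cδ : ℕ) : ∃ e : ℕ, ∀ x n J ℓ w S : ℕ, 2 ≤ x → n ≤ x ^ 15 →
    J ≤ (n + 2) ^ cJ → ℓ = (n + 2) ^ cδ + n + 3 → w ≤ (n + ℓ + 2) ^ cB → S ≤ (n + ℓ + 2) ^ cB →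
    3 * (n * (ℓ + 1)) + S + 2 + J * (110 * (2 * w + J + 2) * (2 * w + J + 2 + 1)) +
      (2 * w + J + 2) ≤ x ^ e := by
  -- The exponent stays open and is read off from the combination of bounds at the end, which
  -- depends only on `cB`, `cJ` and `cδ`.
  apply Exists.intro
  intro x n J ℓ w S hx hn hJ hℓ hw hS
  have k := le_pow_self_of_two_le hx
  have hn2 := add_le_pow_add hx hn (k 2)
  have hJ' := hJ.trans (pow_le_pow_mul hn2 cJ)
  have hℓ' := hℓ.le.trans (add_le_pow_add hx (add_le_pow_add hx (pow_le_pow_mul hn2 cδ) hn) (k 3))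
  have hb := pow_le_pow_mul (add_le_pow_add hx (add_le_pow_add hx hn hℓ') (k 2)) cB
  have hw' := hw.trans hb
  have hS' := hS.trans hb
  have hs := add_le_pow_add hx (add_le_pow_add hx (mul_le_pow_add (k 2) hw') hJ') (k 2)
  exact add_le_pow_add hx (add_le_pow_add hx (add_le_pow_add hx (add_le_pow_add hx
    (mul_le_pow_add (k 3) (mul_le_pow_add hn (add_le_pow_add hx hℓ' (k 1)))) hS') (k 2))
    (mul_le_pow_add hJ' (mul_le_pow_add (mul_le_pow_add (k 110) hs) (add_le_pow_add hx hs (k 1)))))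
    hs

/-! ## Admissible parameters -/

theorem exp_neg_sixteen_log {N : ℝ} (hN : 0 < N) : Real.exp (-(16 * Real.log N)) = 1 / N ^ 16 := by
  rw [Real.exp_neg, mul_comm, show (16 : ℝ) = ((16 : ℕ) : ℝ) by norm_num, Real.exp_mul,
    Real.exp_log hN, Real.rpow_natCast, one_div]

theorem one_le_log_three_mul {p : ℕ} (hp : 1 ≤ p) : 1 ≤ Real.log (3 * p) := by
  have hp' : (1 : ℝ) ≤ p := by exact_mod_cast hp
  rw [Real.le_log_iff_exp_le (by linarith)]
  have := Real.exp_one_lt_d9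
  linarith

/-- With amplitude `μ = (512 log 3p)^(-1/2)`, the clique entries are strong enough and the
truncation error is negligible. -/
theorem clique_amplitude {τ : ℝ} (hτ : τ < 1) {p a b c κ R : ℕ} (hp : 1 ≤ p) (hR : 1 ≤ R)
    (hbox : a * b * c ≤ p ^ 15)
    (hκ : (384 * R : ℝ) * ((3 * p : ℕ) : ℝ) ^ ((1 - τ) / 2) ≤ κ) {lam σ : ℝ} (hlam : 0 < lam)
    (hσ : 0 < σ) (hle : lam / σ ≤ (p : ℝ) ^ (3 * (1 - τ) / 4) / Real.sqrt (Real.log (3 * p))) :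
    ∃ μ : ℝ, 0 < μ ∧ μ ≤ 1 / 2 ∧ 8 * ((a : ℝ) * b * c) * Real.exp (-1 / (32 * μ ^ 2)) ≤ 1 ∧
      lam ^ 2 ≤ (μ * σ) ^ 2 * (κ / (48 * R)) ^ 3 := by
  have hp' : (1 : ℝ) ≤ p := by exact_mod_cast hp
  have hR' : (1 : ℝ) ≤ R := by exact_mod_cast hR
  set L := Real.log (3 * p) with hL
  have hL1 : 1 ≤ L := one_le_log_three_mul hp
  have hμ2 : (1 / Real.sqrt (512 * L)) ^ 2 = 1 / (512 * L) := by
    rw [div_pow, one_pow, Real.sq_sqrt (by positivity)]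
  refine ⟨1 / Real.sqrt (512 * L), by positivity, ?_, ?_, ?_⟩
  · rw [div_le_div_iff_of_pos_left one_pos (by positivity) two_pos]
    exact Real.le_sqrt_of_sq_le (by linarith)
  -- The truncation probability is thus at most `(3p) ^ (-16)`, against at most `p ^ 15` entries.
  · have h1 : -1 / (32 * (1 / Real.sqrt (512 * L)) ^ 2) = -(16 * L) := by
      rw [hμ2]
      field_simp
      norm_num
    rw [h1, exp_neg_sixteen_log (by positivity), mul_one_div, div_le_one (by positivity)]
    have h2 : (a : ℝ) * b * c ≤ p ^ 15 := by exact_mod_cast hbox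
    calc 8 * ((a : ℝ) * b * c) ≤ 8 * p ^ 15 := by linarith
      _ ≤ 3 ^ 16 * p ^ 16 := by
          have : (p : ℝ) ^ 15 ≤ p ^ 16 := pow_le_pow_right₀ hp' (by norm_num)
          have h3 : (0 : ℝ) ≤ p ^ 16 := by positivity
          nlinarith
      _ = _ := by rw [mul_pow]
  · set y := (p : ℝ) ^ ((1 - τ) / 2) with hy
    have hy0 : 0 ≤ y := by positivity
    have hpw : ((p : ℝ) ^ (3 * (1 - τ) / 4)) ^ 2 = y ^ 3 := by
      rw [hy, ← Real.rpow_natCast, ← Real.rpow_natCast, ← Real.rpow_mul (by positivity),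
        ← Real.rpow_mul (by positivity)]
      congr 1
      push_cast
      ring
    have h1 : lam ^ 2 ≤ σ ^ 2 * (y ^ 3 / L) := by
      have h2 : (lam / σ) ^ 2 ≤ y ^ 3 / L := by
        calc _ ≤ ((p : ℝ) ^ (3 * (1 - τ) / 4) / Real.sqrt L) ^ 2 :=
              pow_le_pow_left₀ (by positivity) hle 2
          _ = _ := by rw [div_pow, hpw, Real.sq_sqrt (by positivity)]
      rw [div_pow, div_le_iff₀ (by positivity)] at h2
      linarith
    -- `384 = 8 * 48`, and the cube of 8 cancels the 512 in the amplitude.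
    have h2 : 8 * y ≤ κ / (48 * R) := by
      have h3 : y ≤ ((3 * p : ℕ) : ℝ) ^ ((1 - τ) / 2) :=
        Real.rpow_le_rpow (by positivity) (by push_cast; linarith) (by linarith)
      rw [le_div_iff₀ (by positivity)]
      nlinarith
    calc lam ^ 2 ≤ σ ^ 2 * (y ^ 3 / L) := h1
      _ = (1 / (512 * L)) * σ ^ 2 * (8 * y) ^ 3 := by field_simp; ring
      _ ≤ (1 / (512 * L)) * σ ^ 2 * (κ / (48 * R)) ^ 3 := by gcongr
      _ = _ := by rw [mul_pow, hμ2]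

/-- The three parts of `ℓ` pay for the precision, the number of entries and the constant: `40 ≤ 4 ^
3`. -/
theorem sq_precision_le {n k ℓ : ℕ} {s : ℝ} (hs0 : 0 ≤ s) (hs : s ≤ 2 ^ k) (hℓ : ℓ = k + n + 3) :
    40 * (n : ℝ) * s ^ 2 ≤ 4 ^ ℓ := by
  have h1 : s ^ 2 ≤ 4 ^ k := by
    calc s ^ 2 ≤ (2 ^ k) ^ 2 := pow_le_pow_left₀ hs0 hs 2
      _ = 4 ^ k := by rw [← pow_mul, mul_comm, pow_mul]; norm_num
  have h2 : (n : ℝ) ≤ 4 ^ n := by exact_mod_cast (Nat.lt_pow_self (by norm_num)).le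
  rw [hℓ, pow_add, pow_add]
  calc 40 * (n : ℝ) * s ^ 2 ≤ 40 * 4 ^ n * 4 ^ k := by gcongr
    _ ≤ _ := by
        have : (0 : ℝ) ≤ 4 ^ n * 4 ^ k := by positivity
        nlinarith

theorem signal_le_self {τ : ℝ} (hτ0 : 0 < τ) (hτ : τ < 1) {p : ℕ} (hp : 1 ≤ p) :
    (p : ℝ) ^ (3 * (1 - τ) / 4) / Real.sqrt (Real.log (3 * p)) ≤ p := by
  have hp' : (1 : ℝ) ≤ p := by exact_mod_cast hp
  have h1 : 1 ≤ Real.sqrt (Real.log (3 * p)) := Real.one_le_sqrt.mpr (one_le_log_three_mul hp)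
  calc _ ≤ (p : ℝ) ^ (3 * (1 - τ) / 4) := div_le_self (by positivity) h1
    _ ≤ (p : ℝ) ^ (1 : ℝ) := Real.rpow_le_rpow_of_exponent_le hp' (by linarith)
    _ = p := Real.rpow_one _

/-! ## The computational lower bound for integer quadratic tests -/

/-- The error bound is assumed for all choices of sides because the two regimes use different ones:
parity for wide tensors, the halves of the vertex set for the clique reduction. -/
theorem not_frequently_signErr_le {τ : ℝ} (hτ0 : 0 < τ) (hτ : τ < 1) (H : HypothesisH τ)
    {r₁ r₂ r₃ : ℕ} (hr₁ : 1 ≤ r₁) (hr₂ : 1 ≤ r₂) (hr₃ : 1 ≤ r₃) (h1 : r₁ ≤ r₂ * r₃)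
    (h2 : r₂ ≤ r₃ * r₁) (h3 : r₃ ≤ r₁ * r₂) {p₁ p₂ p₃ : ℕ → ℕ}
    (hmin : ∀ p, min (p₁ p) (min (p₂ p) (p₃ p)) = p) {lam σ δ : ℕ → ℝ} (hlam : ∀ p, 0 < lam p)
    (hσ : ∀ p, 0 < σ p)
    (hle : ∀ p : ℕ, 1 ≤ p → lam p / σ p ≤
      (p : ℝ) ^ (3 * (1 - τ) / 4) / Real.sqrt (Real.log (3 * p)))
    (hδ : Precision p₁ p₂ p₃ σ δ) {J : ℕ → Type} [∀ p, Fintype (J p)]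
    {B : ∀ p, (Idx (p₁ p) (p₂ p) (p₃ p) → ℤ) → (J p → ℤ)} (hB : PolyTimeIntMaps B) {cJ : ℕ}
    (hJ : ∀ p, 1 ≤ p → Fintype.card (J p) ≤ (p₁ p * p₂ p * p₃ p + 2) ^ cJ)
    {wt : ∀ p, (Fin (p₁ p) → Bool) → (Fin (p₂ p) → Bool) → (Fin (p₃ p) → Bool) → J p → ℤ}
    (hwt : ∀ p s₁ s₂ s₃ j, |wt p s₁ s₂ s₃ j| ≤ 1) :
    ¬ ∃ᶠ p in atTop, ∀ s₁ s₂ s₃ s X, Planted r₁ r₂ r₃ (lam p) s₁ s₂ s₃ s X →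
      noise (p₁ p) (p₂ p) (p₃ p) (σ p) {Z | SignErr s (∑ j, wt p s₁ s₂ s₃ j *
        B p (record (δ p) (X + Z)) j ^ 2)} ≤ ENNReal.ofReal (1 / 16) := by
  intro hfr
  obtain ⟨T, hT⟩ := exists_isTransversal hr₁ hr₂ hr₃ h1 h2 h3
  obtain ⟨cδ, hδ⟩ := hδ
  obtain ⟨cB, hB⟩ := hB
  obtain ⟨e, he⟩ := exists_size_bound cB cJ cδ
  set R := r₁ * r₂ * r₃ with hRdef
  have hR : 1 ≤ R := Nat.one_le_iff_ne_zero.mpr (by positivity)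
  have hR1 : r₁ ≤ R := by rw [hRdef, mul_assoc]; exact Nat.le_mul_of_pos_right _ (by positivity)
  have hR2 : r₂ ≤ R := by
    rw [hRdef, mul_comm r₁, mul_assoc]; exact Nat.le_mul_of_pos_right _ (by positivity)
  have hR3 : r₃ ≤ R := by rw [hRdef]; exact Nat.le_mul_of_pos_left _ (by positivity)
  have h3p : Tendsto (fun p : ℕ => 3 * p) atTop atTop := tendsto_id.const_mul_atTop' (by norm_num)
  have hev : ∀ᶠ p : ℕ in atTop, 4096 * R ^ 6 ≤ p ∧ 100 * R ≤ 3 * p ∧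
      (384 * R : ℝ) * ((3 * p : ℕ) : ℝ) ^ ((1 - τ) / 2) ≤ cliqueSize τ (3 * p) ∧
      28800 * R ^ 2 ≤ cliqueSize τ (3 * p) := by
    filter_upwards [eventually_ge_atTop (4096 * R ^ 6), h3p.eventually_ge_atTop (100 * R),
      h3p.eventually (eventually_mul_rpow_le_cliqueSize hτ0 hτ (384 * R)),
      h3p.eventually (eventually_mul_rpow_le_cliqueSize hτ0 hτ (28800 * R ^ 2))] with p q1 q2 q3 q4
    refine ⟨q1, q2, q3, ?_⟩
    have hp1 : (1 : ℝ) ≤ ((3 * p : ℕ) : ℝ) := by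
      exact_mod_cast (show 1 ≤ 3 * p by omega)
    have h5 : 1 ≤ ((3 * p : ℕ) : ℝ) ^ ((1 - τ) / 2) := Real.one_le_rpow hp1 (by linarith)
    have h6 : (28800 * R ^ 2 : ℝ) ≤ cliqueSize τ (3 * p) := by
      refine le_trans ?_ q4
      exact le_mul_of_one_le_right (by positivity) h5
    exact_mod_cast h6
  -- Infinitely many `p` give infinitely many `N = 3p`, which is enough to contradict the liminf in
  -- the hypothesis.
  refine not_frequently_circuit hτ H e (h3p.frequently ((hfr.and_eventually hev).mono ?_))
  rintro p ⟨hp, q1, q2, q3, q4⟩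
  have hp0 : 0 < p := lt_of_lt_of_le (by positivity) q1
  have hm := hmin p
  have ha : p ≤ p₁ p := by omega
  have hb : p ≤ p₂ p := by omega
  have hc : p ≤ p₃ p := by omega
  -- A wide mode is excluded statistically, so the number of entries, and with it the circuit size,
  -- is polynomial in `p`.
  have hsmall : p₁ p < p ^ 5 ∧ p₂ p < p ^ 5 ∧ p₃ p < p ^ 5 := by
    by_contra hbig
    have hbig' : p ^ 5 ≤ p₁ p ∨ p ^ 5 ≤ p₂ p ∨ p ^ 5 ≤ p₃ p := by
      by_contra hcon
      push Not at hcon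
      exact hbig hcon
    exact statistical_lower_bound hr₁ hr₂ hr₃ hT q1 ha hb hc hbig' (hlam p) (hσ p)
      ((hle p hp0).trans (signal_le_self hτ0 hτ hp0))
      (fun q => ∑ j, wt p paritySide paritySide paritySide j * B p q j ^ 2)
      fun s X hX => hp _ _ _ s X hX
  have hbox : p₁ p * p₂ p * p₃ p ≤ p ^ 15 := by
    calc p₁ p * p₂ p * p₃ p ≤ p ^ 5 * p ^ 5 * p ^ 5 :=
          Nat.mul_le_mul (Nat.mul_le_mul hsmall.1.le hsmall.2.1.le) hsmall.2.2.le
      _ = p ^ 15 := by ring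
  obtain ⟨μ, hμ, hμ', hq, hamp⟩ := clique_amplitude hτ hp0 hR hbox q3 (hlam p) (hσ p) (hle p hp0)
  set n := p₁ p * p₂ p * p₃ p with hn
  obtain ⟨ℓ, hℓ⟩ : ∃ ℓ, ℓ = (n + 2) ^ cδ + n + 3 := ⟨_, rfl⟩
  obtain ⟨hδ0, hδp⟩ := hδ p
  have hprec : 40 * ((p₁ p : ℝ) * p₂ p * p₃ p) * (σ p / δ p) ^ 2 ≤ 4 ^ ℓ := by
    have := sq_precision_le (n := n) (div_nonneg (hσ p).le hδ0.le) hδp hℓ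
    rw [hn] at this
    push_cast at this
    exact this
  obtain ⟨q₀, q₁, hq₀, hq₁, hrisk⟩ := exists_clique_test hr₁ hr₂ hr₃ hR1 hR2 hR3 hT hp0 ha hb hc
    q2 q4 (cliqueSize_bounds τ (show 2 ≤ 3 * p by omega)).2 (hlam p) (hσ p) hδ0 hμ hμ' hq hamp hprec
    (fun q => ∑ j, wt p (cliqueSide hp0 0) (cliqueSide hp0 1) (cliqueSide hp0 2) j * B p q j ^ 2)
    fun s X hX => hp _ _ _ s X hX
  obtain ⟨w, C, hw, hC, hCB⟩ := hB p ℓ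
  have hcard : Fintype.card (Idx (p₁ p) (p₂ p) (p₃ p)) = n := by simp [hn, mul_assoc]
  rw [hcard] at hw hC
  obtain ⟨D, hD, hDe⟩ := exists_circuit_sumSq_neg C (B p) hCB q₀ q₁ hq₀ hq₁ (vertexTriple hp0)
    (wt p (cliqueSide hp0 0) (cliqueSide hp0 1) (cliqueSide hp0 2)) (hwt p _ _ _)
  refine ⟨D, ?_, ?_⟩
  · rw [hcard] at hD
    refine hD.trans (he _ n _ ℓ w _ (by omega) (hbox.trans (Nat.pow_le_pow_left (by omega) _)) 
      (hJ p hp0) hℓ hw hC)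
  · simp only [hDe]
    exact hrisk

/-! ## Reduction of estimation to testing -/

theorem two_mul_le_of_lt {x : ℝ≥0∞} (h : x < ENNReal.ofReal (1 / 32)) :
    2 * x ≤ ENNReal.ofReal (1 / 16) := by
  calc 2 * x ≤ 2 * ENNReal.ofReal (1 / 32) := by gcongr
    _ = ENNReal.ofReal (2 * (1 / 32)) := by
        rw [ENNReal.ofReal_mul (by norm_num)]; simp
    _ = _ := by norm_num

theorem abs_firstColumn_weight {m r : ℕ} (side : Fin m → Bool) (e : Fin m × Fin r) :
    |if (e.2 : ℕ) = 0 then sideWeight (side e.1) else 0| ≤ 1 := by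
  split_ifs
  · exact abs_sideWeight _
  · simp

theorem card_firstColumn_le {m n r : ℕ} (h : m ≤ n) :
    Fintype.card (Fin m × Fin r) ≤ (n + 2) ^ (1 + r) := by
  have h1 : r ≤ (n + 2) ^ r := (Nat.lt_pow_self (by omega)).le
  rw [Fintype.card_prod, Fintype.card_fin, Fintype.card_fin, pow_add, pow_one]
  exact Nat.mul_le_mul (by omega) h1

/-- The bound for the singular subspaces of any of the matricizations. -/
theorem le_liminf_subspaceRisk {τ : ℝ} (hτ0 : 0 < τ) (hτ : τ < 1) (H : HypothesisH τ)
    {r₁ r₂ r₃ r : ℕ} (hr₁ : 1 ≤ r₁) (hr₂ : 1 ≤ r₂) (hr₃ : 1 ≤ r₃) (hr : 1 ≤ r)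
    (h1 : r₁ ≤ r₂ * r₃) (h2 : r₂ ≤ r₃ * r₁) (h3 : r₃ ≤ r₁ * r₂) {p₁ p₂ p₃ m : ℕ → ℕ}
    (hmin : ∀ p, min (p₁ p) (min (p₂ p) (p₃ p)) = p) {lam σ : ℕ → ℝ} (hlam : ∀ p, 0 < lam p)
    (hσ : ∀ p, 0 < σ p)
    (hle : ∀ p : ℕ, 1 ≤ p → lam p / σ p ≤
      (p : ℝ) ^ (3 * (1 - τ) / 4) / Real.sqrt (Real.log (3 * p)))
    (hm : ∀ p, p ≤ m p) (hm' : ∀ p, 1 ≤ p → m p ≤ p₁ p * p₂ p * p₃ p) {n : ℕ → Type}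
    [∀ p, Fintype (n p)]
    (unf : ∀ p, Tensor (p₁ p) (p₂ p) (p₃ p) → Matrix (Fin (m p)) (n p) ℝ)
    (side : ∀ p, (Fin (p₁ p) → Bool) → (Fin (p₂ p) → Bool) → (Fin (p₃ p) → Bool) →
      Fin (m p) → Bool)
    (hsvd : ∀ p s₁ s₂ s₃ s X, Planted r₁ r₂ r₃ (lam p) s₁ s₂ s₃ s X →
      ∃ U : Matrix (Fin (m p)) (Fin r) ℝ, IsLeftSingular U (unf p X) ∧
        ∀ i j, side p s₁ s₂ s₃ i ≠ s → U i j = 0)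
    {Uhat : ∀ p, Tensor (p₁ p) (p₂ p) (p₃ p) → Matrix (Fin (m p)) (Fin r) ℝ}
    (hU : PolyTimeSubspaceEstimator p₁ p₂ p₃ σ m r Uhat) :
    ENNReal.ofReal (1 / 32) ≤ liminf (fun p => subspaceRisk
      (lowRankClass (p₁ p) (p₂ p) (p₃ p) r₁ r₂ r₃ (lam p)) (σ p) (unf p) (Uhat p)) atTop := by
  obtain ⟨δ, B, hδ, hB, hUB⟩ := hU
  by_contra hlt
  have hfr := frequently_lt_of_liminf_lt (by isBoundedDefault) (not_le.mp hlt)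
  refine not_frequently_signErr_le hτ0 hτ H hr₁ hr₂ hr₃ h1 h2 h3 hmin hlam hσ hle hδ hB
    (cJ := 1 + r) (fun p hp => card_firstColumn_le (hm' p hp))
    (wt := fun p s₁ s₂ s₃ e => if (e.2 : ℕ) = 0 then sideWeight (side p s₁ s₂ s₃ e.1) else 0)
    (fun p s₁ s₂ s₃ e => abs_firstColumn_weight _ e)
    ((hfr.and_eventually (eventually_ge_atTop r)).mono ?_)
  -- Since `r ≤ p ≤ m p`, the estimator does return orthonormal columns.
  rintro p ⟨hp, hpr⟩ s₁ s₂ s₃ s X hX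
  exact (signErr_le_subspaceRisk hr _ (σ p) (δ p) (unf p) (Uhat p) (B p)
    (hUB p (hpr.trans (hm p))) (side p s₁ s₂ s₃) s hX.mem (hsvd p _ _ _ _ _ hX)).trans
    (two_mul_le_of_lt hp)

theorem le_liminf_tensorRisk {τ : ℝ} (hτ0 : 0 < τ) (hτ : τ < 1) (H : HypothesisH τ)
    {r₁ r₂ r₃ : ℕ} (hr₁ : 1 ≤ r₁) (hr₂ : 1 ≤ r₂) (hr₃ : 1 ≤ r₃) (h1 : r₁ ≤ r₂ * r₃)
    (h2 : r₂ ≤ r₃ * r₁) (h3 : r₃ ≤ r₁ * r₂) {p₁ p₂ p₃ : ℕ → ℕ}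
    (hmin : ∀ p, min (p₁ p) (min (p₂ p) (p₃ p)) = p) {lam σ : ℕ → ℝ} (hlam : ∀ p, 0 < lam p)
    (hσ : ∀ p, 0 < σ p)
    (hle : ∀ p : ℕ, 1 ≤ p → lam p / σ p ≤
      (p : ℝ) ^ (3 * (1 - τ) / 4) / Real.sqrt (Real.log (3 * p)))
    {Xhat : ∀ p, Tensor (p₁ p) (p₂ p) (p₃ p) → Tensor (p₁ p) (p₂ p) (p₃ p)}
    (hX : PolyTimeTensorEstimator p₁ p₂ p₃ σ Xhat) :
    ENNReal.ofReal (1 / 32) ≤ liminf (fun p => tensorRisk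
      (lowRankClass (p₁ p) (p₂ p) (p₃ p) r₁ r₂ r₃ (lam p)) (σ p) (Xhat p)) atTop := by
  obtain ⟨δ, η, B, hδ, hB, hXB⟩ := hX
  by_contra hlt
  have hfr := frequently_lt_of_liminf_lt (by isBoundedDefault) (not_le.mp hlt)
  refine not_frequently_signErr_le hτ0 hτ H hr₁ hr₂ hr₃ h1 h2 h3 hmin hlam hσ hle hδ hB
    (cJ := 1) (fun p _ => by simp [mul_assoc]) (wt := fun p s₁ s₂ s₃ e => sideWeight (s₁ e.1))
    (fun p s₁ s₂ s₃ e => abs_sideWeight _) (hfr.mono ?_)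
  intro p hp s₁ s₂ s₃ s X hPl
  exact (signErr_le_tensorRisk _ (σ p) (δ p) (η p) (Xhat p) (B p) (hXB p) s₁ s hPl.mem
    (frobSq_pos_of_mem (hlam p) hPl.mem) hPl.supp).trans (two_mul_le_of_lt hp)

end

/-! ### The four lower bounds -/

theorem theorem4 :
    ∃ c₀ : ℝ, 0 < c₀ ∧ ∃ c₁ : ℝ, 0 < c₁ ∧
      ∀ τ : ℝ, 0 < τ → τ < 1 → HypothesisH τ →
      ∀ r₁ r₂ r₃ : ℕ, 1 ≤ r₁ → 1 ≤ r₂ → 1 ≤ r₃ →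
        r₁ ≤ r₂ * r₃ → r₂ ≤ r₃ * r₁ → r₃ ≤ r₁ * r₂ →
      ∀ p₁ p₂ p₃ : ℕ → ℕ, (∀ p, min (p₁ p) (min (p₂ p) (p₃ p)) = p) →
      ∀ lam σ : ℕ → ℝ, (∀ p, 0 < lam p) → (∀ p, 0 < σ p) →
        (∀ p : ℕ, 1 ≤ p → lam p / σ p ≤
          c₀ * ((p : ℝ) ^ (3 * (1 - τ) / 4) / Real.sqrt (Real.log (3 * p)))) →
      (∀ Uhat : ∀ p, Tensor (p₁ p) (p₂ p) (p₃ p) → Matrix (Fin (p₁ p)) (Fin r₁) ℝ,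
        PolyTimeSubspaceEstimator p₁ p₂ p₃ σ p₁ r₁ Uhat →
        ENNReal.ofReal c₁ ≤ liminf (fun p => subspaceRisk
          (lowRankClass (p₁ p) (p₂ p) (p₃ p) r₁ r₂ r₃ (lam p)) (σ p) unfold1 (Uhat p)) atTop) ∧
      (∀ Uhat : ∀ p, Tensor (p₁ p) (p₂ p) (p₃ p) → Matrix (Fin (p₂ p)) (Fin r₂) ℝ,
        PolyTimeSubspaceEstimator p₁ p₂ p₃ σ p₂ r₂ Uhat →
        ENNReal.ofReal c₁ ≤ liminf (fun p => subspaceRisk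
          (lowRankClass (p₁ p) (p₂ p) (p₃ p) r₁ r₂ r₃ (lam p)) (σ p) unfold2 (Uhat p)) atTop) ∧
      (∀ Uhat : ∀ p, Tensor (p₁ p) (p₂ p) (p₃ p) → Matrix (Fin (p₃ p)) (Fin r₃) ℝ,
        PolyTimeSubspaceEstimator p₁ p₂ p₃ σ p₃ r₃ Uhat →
        ENNReal.ofReal c₁ ≤ liminf (fun p => subspaceRisk
          (lowRankClass (p₁ p) (p₂ p) (p₃ p) r₁ r₂ r₃ (lam p)) (σ p) unfold3 (Uhat p)) atTop) ∧
      (∀ Xhat : ∀ p, Tensor (p₁ p) (p₂ p) (p₃ p) → Tensor (p₁ p) (p₂ p) (p₃ p),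
        PolyTimeTensorEstimator p₁ p₂ p₃ σ Xhat →
        ENNReal.ofReal c₁ ≤ liminf (fun p => tensorRisk
          (lowRankClass (p₁ p) (p₂ p) (p₃ p) r₁ r₂ r₃ (lam p)) (σ p) (Xhat p)) atTop) := by
  -- `c₀ = 1` works because the logarithm in the clique size outgrows every constant; `c₁ = 1/32` is
  -- half of the error level 1/16.
  refine ⟨1, one_pos, 1 / 32, by norm_num, fun τ hτ0 hτ H r₁ r₂ r₃ hr₁ hr₂ hr₃ h1 h2 h3 p₁ p₂ p₃
    hmin lam σ hlam hσ hle => ?_⟩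
  simp only [one_mul] at hle
  have hge : ∀ p, p ≤ p₁ p ∧ p ≤ p₂ p ∧ p ≤ p₃ p := fun p => by
    have := hmin p
    omega
  have hbox : ∀ p, 1 ≤ p → p₁ p ≤ p₁ p * p₂ p * p₃ p ∧ p₂ p ≤ p₁ p * p₂ p * p₃ p ∧
      p₃ p ≤ p₁ p * p₂ p * p₃ p := fun p hp => by
    obtain ⟨ha, hb, hc⟩ := hge p
    have ha' : 0 < p₁ p := by omega
    have hb' : 0 < p₂ p := by omega
    have hc' : 0 < p₃ p := by omega
    exact ⟨by rw [mul_assoc]; exact Nat.le_mul_of_pos_right _ (by positivity),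
      by rw [mul_comm (p₁ p), mul_assoc]; exact Nat.le_mul_of_pos_right _ (by positivity),
      Nat.le_mul_of_pos_left _ (by positivity)⟩
  refine ⟨fun Uhat hU => ?_, fun Uhat hU => ?_, fun Uhat hU => ?_, fun Xhat hX => ?_⟩
  · exact le_liminf_subspaceRisk hτ0 hτ H hr₁ hr₂ hr₃ hr₁ h1 h2 h3 hmin hlam hσ hle
      (fun p => (hge p).1) (fun p hp => (hbox p hp).1) (fun p => unfold1) (fun p s₁ s₂ s₃ => s₁)
      (fun p s₁ s₂ s₃ s X hX => hX.svd1) hU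
  · exact le_liminf_subspaceRisk hτ0 hτ H hr₁ hr₂ hr₃ hr₂ h1 h2 h3 hmin hlam hσ hle
      (fun p => (hge p).2.1) (fun p hp => (hbox p hp).2.1) (fun p => unfold2) (fun p s₁ s₂ s₃ => s₂)
      (fun p s₁ s₂ s₃ s X hX => hX.svd2) hU
  · exact le_liminf_subspaceRisk hτ0 hτ H hr₁ hr₂ hr₃ hr₃ h1 h2 h3 hmin hlam hσ hle
      (fun p => (hge p).2.2) (fun p hp => (hbox p hp).2.2) (fun p => unfold3) (fun p s₁ s₂ s₃ => s₃)
      (fun p s₁ s₂ s₃ s X hX => hX.svd3) hU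
  · exact le_liminf_tensorRisk hτ0 hτ H hr₁ hr₂ hr₃ h1 h2 h3 hmin hlam hσ hle hX
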